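/- For $\alpha\in\mathbb R$ let $\omega(\xi,\mu)=\xi^5-\alpha\xi^3+\mu^2/\xi$ be the dispersion function of the fifth order KP-I equation, and let $\langle a\rangle=(1+|a|^2)^{1/2}$. With the space-time Fourier transform $\hat f(\tau,\xi,\mu)=\int_{\mathbb R^3}e^{-i(t\tau+x\xi+y\mu)}f(t,x,y)\,dt\,dx\,dy$ (in the sense of tempered distributions), define for $s_1,s_2\ge 0$ and $b\in\mathbb R$ $$\|f\|_{X^{s_1,s_2}_b}=\big\|\langle\tau-\omega(\xi,\mu)\rangle^{b}\langle\xi\rangle^{s_1}\langle\mu\rangle^{s_2}\hat f(\tau,\xi,\mu)\big\|_{L^2(\mathbb R^3)}\in[0,\infty]$$ (equal to $\infty$ if $\hat f$ is not a function). Then there is $\varepsilon_0>0$ such that for all $\alpha\in\mathbb R$, all $s_1,s_2\ge 0$ and all $\varepsilon,\varepsilon'\in(0,\varepsilon_0)$ there is a finite constant $C$, depending only on $\alpha,s_1,s_2,\varepsilon,\varepsilon'$, such that $$\|\partial_x(uv)\|_{X^{s_1,s_2}_{-\frac12+\varepsilon'}}\le C\,\|u\|_{X^{s_1,s_2}_{\frac12+\varepsilon}}\,\|v\|_{X^{s_1,s_2}_{\frac12+\varepsilon}}$$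 for every $T\in(0,1)$ and all $u,v\in L^2(\mathbb R^3;\mathbb C)$ that vanish for almost every $(t,x,y)$ with $t\notin[-T,T]$. Here $\partial_x$ is the distributional derivative of $uv\in L^1(\mathbb R^3)$. -/

import Mathlib

open MeasureTheory FourierTransform LineDeriv
open scoped ENNReal NNReal SchwartzMap

noncomputable section

namespace KPI

/-- Space-time `ℝ³`, with coordinates `(t, x, y)`; its dual variables are `(τ, ξ, μ)`. -/
abbrev SpaceTime : Type := EuclideanSpace ℝ (Fin 3)

/-- The Japanese bracket `⟨x⟩ = (1 + |x|²)^{1/2}`. -/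
def bracket (x : ℝ) : ℝ := Real.sqrt (1 + x ^ 2)

/-- The dispersion function `ω(ξ, μ) = ξ⁵ - α ξ³ + μ² / ξ` of the fifth order KP-I equation. -/
def omega (α ξ μ : ℝ) : ℝ := ξ ^ 5 - α * ξ ^ 3 + μ ^ 2 / ξ

/-- The weight `⟨τ - ω(ξ, μ)⟩ᵇ ⟨ξ⟩^{s₁} ⟨μ⟩^{s₂}` at `k = (τ, ξ, μ)`. -/
def weight (α s₁ s₂ b : ℝ) (k : SpaceTime) : ℝ :=
  bracket (k 0 - omega α (k 1) (k 2)) ^ b * bracket (k 1) ^ s₁ * bracket (k 2) ^ s₂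

/-- The tempered distribution `f` is the function `F`, i.e. it acts on Schwartz functions by
(absolutely convergent) integration against `F`. Such an `F` is unique almost everywhere. -/
def IsGivenBy (f : 𝓢'(SpaceTime, ℂ)) (F : SpaceTime → ℂ) : Prop :=
  ∀ φ : 𝓢(SpaceTime, ℂ), Integrable (fun k => φ k * F k) ∧ f φ = ∫ k, φ k * F k

/-- The Bourgain norm `‖⟨τ - ω(ξ, μ)⟩ᵇ ⟨ξ⟩^{s₁} ⟨μ⟩^{s₂} f̂(τ, ξ, μ)‖_{L²(ℝ³)}` of a tempered
distribution, where `f̂(k) = ∫ e^{-i k·z} f(z) dz`; it is `∞` if `f̂` is not a function. Mathlib's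
transform `𝓕` has the kernel `e^{-2πi k·z}`, so that `f̂(k) = (𝓕 f)(k / 2π)`. The infimum is over
the almost everywhere equal representatives `F` of `𝓕 f`. -/
def bourgainNorm (α s₁ s₂ b : ℝ) (f : 𝓢'(SpaceTime, ℂ)) : ℝ≥0∞ :=
  ⨅ (F : SpaceTime → ℂ) (_ : IsGivenBy (𝓕 f) F),
    eLpNorm (fun k : SpaceTime => (weight α s₁ s₂ b k : ℂ) * F ((2 * Real.pi)⁻¹ • k)) 2 volume

/-- The distributional derivative `∂ₓ(uv)` of the product `uv ∈ L¹(ℝ³)` of `u, v ∈ L²(ℝ³)`. -/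
def dxMul (u v : Lp ℂ 2 (volume : Measure SpaceTime)) : 𝓢'(SpaceTime, ℂ) :=
  ∂_{(EuclideanSpace.single 1 1 : SpaceTime)}
    (Lp.toTemperedDistribution (u • v : Lp ℂ 1 (volume : Measure SpaceTime)))

/-- `u(t, x, y)` vanishes for (almost) all `t` outside `[-T, T]`. -/
def TimeSupported (T : ℝ) (u : Lp ℂ 2 (volume : Measure SpaceTime)) : Prop :=
  ∀ᵐ z : SpaceTime, z 0 ∉ Set.Icc (-T) T → u z = 0

end KPI

end

noncomputable section

set_option linter.unusedSectionVars false

namespace KPI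

/-! ### The Japanese bracket -/

/-! Write σ, σ₁, σ₂ for the modulations τ - ω at k = k₁ + k₂, k₁, k₂, and put p = 1 + 2ε, q = 1 -
2ε', so that p > 1 and 3/4 < q < 1. The transform of uv is the convolution of the transforms,
Peetre's inequality distributes the weights in ξ and μ, and duality reduces the theorem to the L²
boundedness of the trilinear form with kernel |ξ| ⟨σ⟩^{-q/2} ⟨σ₁⟩^{-p/2} ⟨σ₂⟩^{-p/2}
(`exists_formBound_ker`). By symmetry one may take |ξ₁| ≤ |ξ₂|.

The geometry is that of the resonance function: with κ = (μ₁/ξ₁ - μ₂/ξ₂)/ξ, σ₁ + σ₂ - σ = ξ ξ₁ ξ₂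
(5(ξ₁² + ξ₁ξ₂ + ξ₂²) - 3α - κ²). The bracket can vanish, so large frequencies do not force a large
modulation.

Away from resonance, Cauchy-Schwarz suffices: one of k, k₁, k₂ is fixed and the square of the kernel
is integrated over the remaining frequency. The τ integral merges two weights into one, whose
argument is quadratic in μ and so integrates to the inverse square root of the leading coefficient
(`exists_lintegral_sum_quadratic_le`, `exists_lintegral_left_quadratic_le`). This settles bounded
frequencies, and also the case 1 ≤ |ξ₁| when some modulation is at least |ξ| |ξ₁| |ξ₂|³ / 10. When
|ξ₁| ≤ 1 and |ξ₂| is large, the resonance function itself is taken as an integration variable, in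
place of κ if |κ| ≥ |ξ| and in place of ξ₁ otherwise (`lintegral_lowHigh_le`).

If all three modulations are small, then |κ| is comparable to |ξ₂|; reflections give ξ₂ > 0 and κ >
0. For fixed σ₁ and σ₂, Cauchy-Schwarz in ζ₁ = (ξ₁, μ₁) (`lintegral_kernel_le_of_forall`) leaves an
integral over ζ₂ of two interactions sharing ζ₂, one with ζ₁ and one with a fixed u = (a, aM). In
the first, ζ = ζ₁ + ζ₂ and its time frequency τ become variables; what remains is one integral along
the curve of all ζ₂ compatible with (τ, ζ), parametrized by x = ξ₂. The slope μ₂/ξ₂ increases along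
this curve, and therefore the resonance function of u with the moving point is monotone, with
derivative at least |a| x³ in size (`pow_three_le_curveRes_deriv`). Half a power of the output
modulation is worth at most 2x³, so this derivative upgrades the non-integrable ⟨·⟩^{-q} to the
integrable ⟨·⟩^{-q-1/2}. Integration over σ₁ and σ₂ uses p > 1. -/

lemma one_le_bracket (x : ℝ) : 1 ≤ bracket x := by
  unfold bracket
  exact Real.one_le_sqrt.2 (by nlinarith [sq_nonneg x])

lemma bracket_pos (x : ℝ) : 0 < bracket x := one_pos.trans_le (one_le_bracket x)

lemma bracket_sq (x : ℝ) : bracket x ^ 2 = 1 + x ^ 2 := by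
  unfold bracket
  exact Real.sq_sqrt (by positivity)

@[simp] lemma bracket_neg (x : ℝ) : bracket (-x) = bracket x := by simp [bracket]

lemma abs_le_bracket (x : ℝ) : |x| ≤ bracket x :=
  abs_le_of_sq_le_sq (by rw [bracket_sq]; linarith) (bracket_pos x).le

lemma bracket_le_one_add_abs (x : ℝ) : bracket x ≤ 1 + |x| := by
  refine le_of_sq_le_sq ?_ (by positivity)
  rw [bracket_sq]
  nlinarith [abs_nonneg x, sq_abs x]

lemma bracket_le_bracket {x y : ℝ} (h : |x| ≤ |y|) : bracket x ≤ bracket y := by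
  unfold bracket
  exact Real.sqrt_le_sqrt (by nlinarith [sq_le_sq.2 h])

lemma bracket_le_two_mul {x y : ℝ} (h : |x| ≤ 2 * |y|) : bracket x ≤ 2 * bracket y := by
  refine le_of_sq_le_sq ?_ (by have := bracket_pos y; positivity)
  rw [mul_pow, bracket_sq, bracket_sq]
  have := mul_self_le_mul_self (abs_nonneg x) h
  nlinarith [sq_abs x, sq_abs y]

/-- Peetre's inequality. -/
lemma bracket_add_le (x y : ℝ) : bracket (x + y) ≤ 2 * (bracket x * bracket y) := by
  have hx := bracket_pos x
  have hy := bracket_pos y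
  refine le_of_sq_le_sq ?_ (by positivity)
  rw [mul_pow, mul_pow, bracket_sq, bracket_sq, bracket_sq]
  nlinarith [sq_nonneg (x - y), sq_nonneg (x * y), sq_nonneg x, sq_nonneg y]

@[fun_prop]
lemma continuous_bracket : Continuous bracket := by
  unfold bracket
  fun_prop

@[fun_prop]
lemma measurable_bracket : Measurable bracket := continuous_bracket.measurable

/-- The decaying weight `⟨s⟩^{-p}`, with values in `[0, ∞]`. -/
def jb (p s : ℝ) : ℝ≥0∞ := ENNReal.ofReal (bracket s ^ (-p))

@[fun_prop]
lemma measurable_jb (p : ℝ) : Measurable (jb p) := by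
  unfold jb
  fun_prop

@[simp] lemma jb_neg (p s : ℝ) : jb p (-s) = jb p s := by simp [jb]

lemma jb_sub_comm (p a b : ℝ) : jb p (a - b) = jb p (b - a) := by rw [← jb_neg, neg_sub]

lemma jb_sq (p s : ℝ) : jb (p / 2) s ^ 2 = jb p s := by
  unfold jb
  rw [← ENNReal.ofReal_pow (by have := bracket_pos s; positivity), ← Real.rpow_natCast,
    ← Real.rpow_mul (bracket_pos s).le]
  congr 2
  push_cast
  ring

lemma jb_le_jb {p q : ℝ} (h : q ≤ p) (s : ℝ) : jb p s ≤ jb q s :=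
  ENNReal.ofReal_le_ofReal (Real.rpow_le_rpow_of_exponent_le (one_le_bracket s) (by linarith))

lemma jb_le_one {p : ℝ} (h : 0 ≤ p) (s : ℝ) : jb p s ≤ 1 := by
  have := jb_le_jb h s
  simpa [jb] using this

lemma jb_ne_top (p s : ℝ) : jb p s ≠ ∞ := ENNReal.ofReal_ne_top

lemma jb_mono {p : ℝ} (hp : 0 ≤ p) {x y : ℝ} (h : |x| ≤ |y|) : jb p y ≤ jb p x :=
  ENNReal.ofReal_le_ofReal (Real.rpow_le_rpow_of_nonpos (bracket_pos x)
    (bracket_le_bracket h) (by linarith))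

lemma jb_le_two_rpow_mul {p : ℝ} (hp : 0 ≤ p) {x y : ℝ} (h : |x| ≤ 2 * |y|) :
    jb p y ≤ ENNReal.ofReal (2 ^ p) * jb p x := by
  unfold jb
  rw [← ENNReal.ofReal_mul (by positivity)]
  refine ENNReal.ofReal_le_ofReal ?_
  have hx := bracket_pos x
  have hy := bracket_pos y
  have h2 : (2 * bracket y) ^ (-p) ≤ bracket x ^ (-p) :=
    Real.rpow_le_rpow_of_nonpos hx (bracket_le_two_mul h) (by linarith)
  rw [Real.mul_rpow (by norm_num) hy.le, Real.rpow_neg (by norm_num)] at h2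
  have h3 : (0 : ℝ) < 2 ^ p := by positivity
  calc bracket y ^ (-p) = 2 ^ p * ((2 ^ p)⁻¹ * bracket y ^ (-p)) := by field_simp
    _ ≤ _ := by gcongr

/-! ### One-dimensional integrals of the bracket weight -/

lemma lintegral_jb_lt_top {p : ℝ} (hp : 1 < p) : ∫⁻ s, jb p s < ∞ := by
  have h : Integrable (fun x : ℝ => (1 + ‖x‖ ^ 2) ^ (-p / 2)) :=
    integrable_rpow_neg_one_add_norm_sq (by simpa using hp)
  refine lt_of_le_of_lt (lintegral_mono fun s => ?_) h.lintegral_lt_top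
  refine ENNReal.ofReal_le_ofReal (le_of_eq ?_)
  rw [Real.norm_eq_abs, sq_abs, bracket, Real.sqrt_eq_rpow, ← Real.rpow_mul (by positivity)]
  congr 1
  ring

/-- Since ⟨s⟩² ≤ 2⟨s²⟩, a quadratic argument doubles the decay; this is why q > 1/2 is enough for
integrals along parabolas. -/
lemma jb_sq_arg_le {q : ℝ} (hq : 0 ≤ q) (s : ℝ) :
    jb q (s ^ 2) ≤ ENNReal.ofReal (2 ^ q) * jb (2 * q) s := by
  unfold jb
  rw [← ENNReal.ofReal_mul (by positivity)]
  refine ENNReal.ofReal_le_ofReal ?_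
  have hs := bracket_pos s
  have hs2 := bracket_pos (s ^ 2)
  have h1 : bracket s ^ 2 ≤ 2 * bracket (s ^ 2) := by
    have := abs_le_bracket (s ^ 2)
    rw [abs_of_nonneg (sq_nonneg s)] at this
    rw [bracket_sq]
    linarith [one_le_bracket (s ^ 2)]
  have h2 : (2 * bracket (s ^ 2)) ^ (-q) ≤ (bracket s ^ 2) ^ (-q) :=
    Real.rpow_le_rpow_of_nonpos (by positivity) h1 (by linarith)
  rw [Real.mul_rpow (by norm_num) hs2.le, Real.rpow_neg (by norm_num),
    ← Real.rpow_natCast (bracket s), ← Real.rpow_mul hs.le] at h2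
  have h3 : (0 : ℝ) < 2 ^ q := by positivity
  calc bracket (s ^ 2) ^ (-q) = 2 ^ q * ((2 ^ q)⁻¹ * bracket (s ^ 2) ^ (-q)) := by field_simp
    _ ≤ 2 ^ q * bracket s ^ (((2 : ℕ) : ℝ) * -q) := by gcongr
    _ = _ := by congr 2; push_cast; ring

lemma lintegral_jb_sq_arg_lt_top {q : ℝ} (hq : 1 / 2 < q) : ∫⁻ s, jb q (s ^ 2) < ∞ := by
  refine lt_of_le_of_lt (lintegral_mono fun s => jb_sq_arg_le (by linarith) s) ?_
  rw [lintegral_const_mul _ (measurable_jb _)]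
  exact ENNReal.mul_lt_top ENNReal.ofReal_lt_top (lintegral_jb_lt_top (by linarith))

lemma lintegral_comp_affine (f : ℝ → ℝ≥0∞) {c : ℝ} (hc : c ≠ 0) (d : ℝ) :
    ∫⁻ x, f x = ENNReal.ofReal |c| * ∫⁻ x, f (c * x + d) := by
  have hd : ∀ x ∈ (Set.univ : Set ℝ), HasDerivWithinAt (fun x => c * x + d) c Set.univ x := by
    intro x _
    have h := ((hasDerivAt_id x).const_mul c).add_const d
    rw [mul_one] at h
    exact h.hasDerivWithinAt
  have hinj : Set.InjOn (fun x : ℝ => c * x + d) Set.univ := by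
    intro x _ y _ h
    simpa [hc] using h
  have himg : (fun x : ℝ => c * x + d) '' Set.univ = Set.univ := by
    rw [Set.image_univ, Set.range_eq_univ]
    intro y
    exact ⟨(y - d) / c, by field_simp; ring⟩
  have h := lintegral_image_eq_lintegral_abs_deriv_mul MeasurableSet.univ hd hinj f
  rw [himg, Measure.restrict_univ] at h
  rw [h, lintegral_const_mul' _ _ ENNReal.ofReal_ne_top]

/-- If a = -A² is negative, |s² - A²| = |s - A| |s + A| dominates the square of the smaller factor,
so the weight is controlled by translates of ⟨s²⟩^{-q} centred at the two roots. If a ≥ 0 the square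
root is 0 and a only helps. -/
lemma jb_add_sq_le {q : ℝ} (hq : 0 ≤ q) (a s : ℝ) :
    jb q (a + s ^ 2) ≤ jb q ((s - √(-a)) ^ 2) + jb q ((s + √(-a)) ^ 2) := by
  rcases le_total 0 a with ha | ha
  · rw [Real.sqrt_eq_zero_of_nonpos (by linarith)]
    refine le_add_right (jb_mono hq ?_)
    rw [sub_zero, abs_of_nonneg (by positivity), abs_of_nonneg (by positivity)]
    linarith
  · have hA := Real.sqrt_nonneg (-a)
    have hA2 : √(-a) ^ 2 = -a := Real.sq_sqrt (by linarith)
    set A := √(-a)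
    have hfac : a + s ^ 2 = (s - A) * (s + A) := by linear_combination hA2
    rcases le_total 0 s with hs | hs
    · refine le_add_right (jb_mono hq ?_)
      rw [hfac, abs_pow, abs_mul, sq]
      gcongr ?_ * ?_
      exact abs_le_abs (by linarith) (by linarith)
    · refine le_add_left (jb_mono hq ?_)
      rw [hfac, abs_pow, abs_mul, sq]
      gcongr 1
      rw [← abs_neg (s - A)]
      exact abs_le_abs (by linarith) (by linarith)

/-- Integrals of `⟨·⟩^{-q}` along a quadratic polynomial only see the leading coefficient. -/
lemma exists_lintegral_jb_quadratic_le {q : ℝ} (hq : 1 / 2 < q) :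
    ∃ C : ℝ≥0, ∀ a b c : ℝ, c ≠ 0 →
      ∫⁻ s, jb q (a + b * s + c * s ^ 2) ≤ C * ENNReal.ofReal ((√|c|)⁻¹) := by
  have hfin := lintegral_jb_sq_arg_lt_top hq
  lift (∫⁻ s, jb q (s ^ 2)) to ℝ≥0 using hfin.ne with I hI
  refine ⟨2 * I, fun a b c hc => ?_⟩
  have hpos : ∀ a b c : ℝ, 0 < c →
      ∫⁻ s, jb q (a + b * s + c * s ^ 2) ≤ 2 * I * ENNReal.ofReal ((√|c|)⁻¹) := by
    intro a b c hc
    have hs : 0 < √c := Real.sqrt_pos.2 hc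
    have hs2 : √c ^ 2 = c := Real.sq_sqrt hc.le
    -- Completing the square: the shift moves to the vertex, the scaling by c^{-1/2} makes the
    -- leading coefficient 1 and produces the asserted factor.
    rw [lintegral_comp_affine _ (inv_ne_zero hs.ne') (-b / (2 * c)), abs_of_pos hc, mul_comm,
      abs_of_pos (inv_pos.2 hs)]
    gcongr
    have h1 : ∀ s, a + b * ((√c)⁻¹ * s + -b / (2 * c)) + c * ((√c)⁻¹ * s + -b / (2 * c)) ^ 2 =
        (a - b ^ 2 / (4 * c)) + s ^ 2 := by
      intro s
      have h2 : c * (√c)⁻¹ ^ 2 = 1 := by rw [inv_pow, hs2]; field_simp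
      have h3 : c * (-b / (2 * c)) = -b / 2 := by field_simp
      have h4 : b * (-b / (2 * c)) = - (b ^ 2 / (4 * c)) * 2 := by field_simp; ring
      have h5 : c * (-b / (2 * c)) ^ 2 = b ^ 2 / (4 * c) := by field_simp; ring
      linear_combination s ^ 2 * h2 + 2 * (√c)⁻¹ * s * h3 + h4 + h5
    simp_rw [h1]
    refine (lintegral_mono fun s => jb_add_sq_le (by linarith) _ s).trans ?_
    rw [lintegral_add_left (by fun_prop)]
    have e1 := lintegral_sub_right_eq_self (μ := (volume : Measure ℝ)) (fun s => jb q (s ^ 2))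
      (√(-(a - b ^ 2 / (4 * c))))
    have e2 := lintegral_add_right_eq_self (μ := (volume : Measure ℝ)) (fun s => jb q (s ^ 2))
      (√(-(a - b ^ 2 / (4 * c))))
    rw [e1, e2, ← hI, two_mul]
  push_cast
  rcases lt_or_gt_of_ne hc with h | h
  · have := hpos (-a) (-b) (-c) (by linarith)
    rw [abs_neg] at this
    convert this using 3 with s
    rw [← jb_neg]
    congr 1
    ring
  · exact hpos a b c h

/-- The larger of |t - a| and |t - b| is at least |a - b| / 2, so one factor yields ⟨a - b⟩^{-q} and
the other stays to be integrated. -/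
lemma jb_mul_jb_le {p q : ℝ} (hq : 0 ≤ q) (hpq : q ≤ p) (a b t : ℝ) :
    jb p (t - a) * jb q (t - b) ≤
      ENNReal.ofReal (2 ^ q) * jb q (a - b) * (jb p (t - a) + jb p (t - b)) := by
  rcases le_total |t - a| |t - b| with h | h
  · have h2 : |a - b| ≤ 2 * |t - b| := by
      have := abs_sub_le a t b
      rw [abs_sub_comm a t] at this
      linarith
    calc jb p (t - a) * jb q (t - b)
        ≤ jb p (t - a) * (ENNReal.ofReal (2 ^ q) * jb q (a - b)) := by
          gcongr; exact jb_le_two_rpow_mul hq h2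
      _ ≤ (jb p (t - a) + jb p (t - b)) * (ENNReal.ofReal (2 ^ q) * jb q (a - b)) := by
          gcongr; exact le_self_add
      _ = _ := by ring
  · have h2 : |a - b| ≤ 2 * |t - a| := by
      have := abs_sub_le a t b
      rw [abs_sub_comm a t] at this
      linarith
    -- Here t - a is the larger argument. Exchanging the exponents puts q on it and keeps the
    -- exponent p on the factor that will be integrated.
    have hsw : jb p (t - a) * jb q (t - b) ≤ jb q (t - a) * jb p (t - b) := by
      unfold jb
      have ha := bracket_pos (t - a)
      have hb := bracket_pos (t - b)
      rw [← ENNReal.ofReal_mul (by positivity), ← ENNReal.ofReal_mul (by positivity)]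
      refine ENNReal.ofReal_le_ofReal ?_
      have e1 : bracket (t - a) ^ (-p) = bracket (t - a) ^ (-q) * bracket (t - a) ^ (q - p) := by
        rw [← Real.rpow_add ha]; congr 1; ring
      have e2 : bracket (t - b) ^ (-p) = bracket (t - b) ^ (-q) * bracket (t - b) ^ (q - p) := by
        rw [← Real.rpow_add hb]; congr 1; ring
      have e3 : bracket (t - a) ^ (q - p) ≤ bracket (t - b) ^ (q - p) :=
        Real.rpow_le_rpow_of_nonpos hb (bracket_le_bracket h) (by linarith)
      rw [e1, e2]
      calc _ = bracket (t - a) ^ (-q) * bracket (t - b) ^ (-q) * bracket (t - a) ^ (q - p) := by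
            ring
        _ ≤ bracket (t - a) ^ (-q) * bracket (t - b) ^ (-q) * bracket (t - b) ^ (q - p) := by
            gcongr
        _ = _ := by ring
    calc jb p (t - a) * jb q (t - b) ≤ jb q (t - a) * jb p (t - b) := hsw
      _ ≤ (ENNReal.ofReal (2 ^ q) * jb q (a - b)) * jb p (t - b) := by
          gcongr; exact jb_le_two_rpow_mul hq h2
      _ ≤ (ENNReal.ofReal (2 ^ q) * jb q (a - b)) * (jb p (t - a) + jb p (t - b)) := by
          gcongr; exact le_add_self
      _ = _ := by ring

/-- This performs every τ integral of the non-resonant analysis: two modulation weights merge into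
one, with the weaker exponent. -/
lemma exists_lintegral_jb_mul_jb_le {p q : ℝ} (hp : 1 < p) (hq : 0 ≤ q) (hpq : q ≤ p) :
    ∃ C : ℝ≥0, ∀ a b : ℝ, ∫⁻ t, jb p (t - a) * jb q (t - b) ≤ C * jb q (a - b) := by
  have hfin := lintegral_jb_lt_top hp
  lift (∫⁻ s, jb p s) to ℝ≥0 using hfin.ne with I hI
  refine ⟨Real.toNNReal (2 ^ q) * (I + I), fun a b => ?_⟩
  refine (lintegral_mono fun t => jb_mul_jb_le hq hpq a b t).trans ?_
  rw [lintegral_const_mul _ (by fun_prop), lintegral_add_left (by fun_prop)]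
  have e1 := lintegral_sub_right_eq_self (μ := (volume : Measure ℝ)) (jb p) a
  have e2 := lintegral_sub_right_eq_self (μ := (volume : Measure ℝ)) (jb p) b
  rw [e1, e2, ← hI]
  push_cast
  rw [ENNReal.ofReal]
  apply le_of_eq
  ring

/-- Change of variables along an injective differentiable function, as an inequality. -/
lemma lintegral_abs_deriv_mul_comp_le {f f' : ℝ → ℝ} {s : Set ℝ} (hs : MeasurableSet s)
    (hf' : ∀ x ∈ s, HasDerivAt f (f' x) x) (hf : Set.InjOn f s) (g : ℝ → ℝ≥0∞) :
    ∫⁻ x in s, ENNReal.ofReal |f' x| * g (f x) ≤ ∫⁻ y, g y := by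
  rw [← lintegral_image_eq_lintegral_abs_deriv_mul hs
    (fun x hx => (hf' x hx).hasDerivWithinAt) hf]
  exact setLIntegral_le_lintegral _ _

/-! ### Weighted convolution forms -/

/-- The `L²` norm of a function with values in `[0, ∞]`. -/
def l2 {X : Type*} [MeasureSpace X] (f : X → ℝ≥0∞) : ℝ≥0∞ := (∫⁻ x, f x ^ 2) ^ (1 / 2 : ℝ)

section

variable {X Y : Type*} [MeasureSpace X] [MeasureSpace Y]

lemma l2_sq (f : X → ℝ≥0∞) : l2 f ^ 2 = ∫⁻ x, f x ^ 2 := by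
  rw [l2, ← ENNReal.rpow_natCast, ← ENNReal.rpow_mul]
  norm_num

lemma le_of_sq_le_sq_ennreal {a b : ℝ≥0∞} (h : a ^ 2 ≤ b ^ 2) : a ≤ b :=
  (ENNReal.pow_le_pow_left_iff two_ne_zero).1 h

lemma lintegral_mul_le_l2 {f g : X → ℝ≥0∞} (hf : Measurable f) (hg : Measurable g) :
    ∫⁻ x, f x * g x ≤ l2 f * l2 g := by
  have h := ENNReal.lintegral_mul_le_Lp_mul_Lq (volume : Measure X) Real.HolderConjugate.two_two
    hf.aemeasurable hg.aemeasurable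
  simpa [l2] using h

lemma l2_comp {f : Y → ℝ≥0∞} {φ : X → Y} (hφ : MeasurePreserving φ) (hf : Measurable f) :
    l2 (fun x => f (φ x)) = l2 f := by
  unfold l2
  rw [hφ.lintegral_comp (f := fun y => f y ^ 2) (by fun_prop)]

variable [SFinite (volume : Measure X)] [SFinite (volume : Measure Y)]

/-- A `T T^*` bound for a bilinear form whose kernel is `e t H`. -/
lemma lintegral_kernel_le_of_forall {e t H : X → Y → ℝ≥0∞} (he : Measurable (Function.uncurry e))
    (ht : Measurable (Function.uncurry t)) (hH : Measurable (Function.uncurry H)) {M : ℝ≥0∞}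
    (hM : ∀ x', ∫⁻ y, ∫⁻ x, e x y * H x y ^ 2 * (e x' y * t x' y ^ 2) ≤ M ^ 2)
    {g₁ : X → ℝ≥0∞} {g₂ : Y → ℝ≥0∞} (hg₁ : Measurable g₁) (hg₂ : Measurable g₂) :
    ∫⁻ y, ∫⁻ x, e x y * t x y * H x y * g₁ x * g₂ y ≤ M * l2 g₁ * l2 g₂ := by
  have he' : Measurable fun p : Y × X => e p.2 p.1 := he.comp measurable_swap
  have ht' : Measurable fun p : Y × X => t p.2 p.1 := ht.comp measurable_swap
  have hH' : Measurable fun p : Y × X => H p.2 p.1 := hH.comp measurable_swap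
  have he1 : ∀ y, Measurable fun x => e x y := fun y => he'.comp measurable_prodMk_left
  have ht1 : ∀ y, Measurable fun x => t x y := fun y => ht'.comp measurable_prodMk_left
  have hH1 : ∀ y, Measurable fun x => H x y := fun y => hH'.comp measurable_prodMk_left
  set A : Y → ℝ≥0∞ := fun y => ∫⁻ x, e x y * t x y * H x y * g₁ x with hA
  have hAm : Measurable A := Measurable.lintegral_prod_right'
    (f := fun p : Y × X => e p.2 p.1 * t p.2 p.1 * H p.2 p.1 * g₁ p.2) (by fun_prop)
  -- Cauchy-Schwarz with e shared as e^{1/2} e^{1/2}: H goes with one half, t and g₁ with the other.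
  -- The two factors carry independent variables x and x', which couple two interactions through the
  -- same y.
  have hA2 : ∀ y, A y ^ 2 ≤ ∫⁻ x', (∫⁻ x, e x y * H x y ^ 2) * (e x' y * t x' y ^ 2 * g₁ x' ^ 2) := by
    intro y
    have hs : ∀ x, (e x y ^ (1 / 2 : ℝ)) ^ 2 = e x y := by
      intro x
      rw [← ENNReal.rpow_natCast, ← ENNReal.rpow_mul]
      norm_num
    have h1 : A y = ∫⁻ x, (e x y ^ (1 / 2 : ℝ) * H x y) * (e x y ^ (1 / 2 : ℝ) * t x y * g₁ x) := by
      refine lintegral_congr fun x => ?_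
      have h := hs x
      calc _ = (e x y ^ (1 / 2 : ℝ)) ^ 2 * t x y * H x y * g₁ x := by rw [h]
        _ = _ := by ring
    have h2 := lintegral_mul_le_l2 (f := fun x => e x y ^ (1 / 2 : ℝ) * H x y)
      (g := fun x => e x y ^ (1 / 2 : ℝ) * t x y * g₁ x)
      (((he1 y).pow_const _).mul (hH1 y)) ((((he1 y).pow_const _).mul (ht1 y)).mul hg₁)
    rw [← h1] at h2
    calc A y ^ 2 ≤ (l2 (fun x => e x y ^ (1 / 2 : ℝ) * H x y) *
          l2 (fun x => e x y ^ (1 / 2 : ℝ) * t x y * g₁ x)) ^ 2 := by gcongr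
      _ = (∫⁻ x, e x y * H x y ^ 2) * ∫⁻ x', e x' y * t x' y ^ 2 * g₁ x' ^ 2 := by
          rw [mul_pow, l2_sq, l2_sq]
          simp only [mul_pow, hs]
      _ = _ := by
          rw [lintegral_const_mul]
          exact ((he1 y).mul ((ht1 y).pow_const _)).mul (hg₁.pow_const _)
  have hB : Measurable fun y => ∫⁻ x, e x y * H x y ^ 2 := Measurable.lintegral_prod_right'
    (f := fun p : Y × X => e p.2 p.1 * H p.2 p.1 ^ 2) (by fun_prop)
  have hAint : ∫⁻ y, A y ^ 2 ≤ (M * l2 g₁) ^ 2 := by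
    calc ∫⁻ y, A y ^ 2
        ≤ ∫⁻ y, ∫⁻ x', (∫⁻ x, e x y * H x y ^ 2) * (e x' y * t x' y ^ 2 * g₁ x' ^ 2) :=
          lintegral_mono hA2
      _ = ∫⁻ x', ∫⁻ y, (∫⁻ x, e x y * H x y ^ 2) * (e x' y * t x' y ^ 2 * g₁ x' ^ 2) := by
          refine lintegral_lintegral_swap (Measurable.aemeasurable ?_)
          simp only [Function.uncurry_def]
          fun_prop
      _ ≤ ∫⁻ x', M ^ 2 * g₁ x' ^ 2 := by
          refine lintegral_mono fun x' => ?_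
          have he2 : Measurable fun y => e x' y := he.comp measurable_prodMk_left
          have ht2 : Measurable fun y => t x' y := ht.comp measurable_prodMk_left
          have h4 : ∀ y, ∫⁻ x, e x y * H x y ^ 2 * (e x' y * t x' y ^ 2) =
              (∫⁻ x, e x y * H x y ^ 2) * (e x' y * t x' y ^ 2) := fun y =>
            lintegral_mul_const _ ((he1 y).mul ((hH1 y).pow_const _))
          have h3 : ∀ y, (∫⁻ x, e x y * H x y ^ 2) * (e x' y * t x' y ^ 2 * g₁ x' ^ 2) =
              (∫⁻ x, e x y * H x y ^ 2 * (e x' y * t x' y ^ 2)) * g₁ x' ^ 2 := by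
            intro y
            rw [h4]
            ring
          simp_rw [h3]
          have hm : Measurable fun y => ∫⁻ x, e x y * H x y ^ 2 * (e x' y * t x' y ^ 2) := by
            simp_rw [h4]
            fun_prop
          rw [lintegral_mul_const _ hm]
          gcongr
          exact hM x'
      _ = (M * l2 g₁) ^ 2 := by
          rw [lintegral_const_mul _ (by fun_prop), mul_pow, l2_sq]
  calc ∫⁻ y, ∫⁻ x, e x y * t x y * H x y * g₁ x * g₂ y = ∫⁻ y, A y * g₂ y := by
        refine lintegral_congr fun y => ?_
        rw [lintegral_mul_const]
        exact (((he1 y).mul (ht1 y)).mul (hH1 y)).mul hg₁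
    _ ≤ l2 A * l2 g₂ := lintegral_mul_le_l2 hAm hg₂
    _ ≤ M * l2 g₁ * l2 g₂ := by
        gcongr
        exact le_of_sq_le_sq_ennreal (by rw [l2_sq]; exact hAint)

end

section

variable {G : Type*} [MeasureSpace G] [AddCommGroup G] [MeasurableAdd₂ G] [MeasurableNeg G]
  [SFinite (volume : Measure G)] [(volume : Measure G).IsAddLeftInvariant]
  {W : G → G → ℝ≥0∞} {h g₁ g₂ : G → ℝ≥0∞} {C : ℝ≥0∞}

/-- The trilinear form `∬ W(k₁, k₂) h(k₁ + k₂) g₁(k₁) g₂(k₂)`. -/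
def form (W : G → G → ℝ≥0∞) (h g₁ g₂ : G → ℝ≥0∞) : ℝ≥0∞ :=
  ∫⁻ k : G × G, W k.1 k.2 * h (k.1 + k.2) * g₁ k.1 * g₂ k.2

/-- The kernel `W` defines a trilinear form bounded on `L²` with constant `C`. -/
def FormBound (W : G → G → ℝ≥0∞) (C : ℝ≥0∞) : Prop :=
  ∀ h g₁ g₂ : G → ℝ≥0∞, Measurable h → Measurable g₁ → Measurable g₂ →
    form W h g₁ g₂ ≤ C * l2 h * l2 g₁ * l2 g₂

lemma lintegral_prod_mul_sq {f g : G → ℝ≥0∞} (hf : Measurable f) (hg : Measurable g) :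
    ∫⁻ k : G × G, (f k.1 * g k.2) ^ 2 = (l2 f * l2 g) ^ 2 := by
  rw [mul_pow, l2_sq, l2_sq]
  simp_rw [mul_pow]
  exact lintegral_prod_mul (f := fun x => f x ^ 2) (g := fun x => g x ^ 2)
    (hf.pow_const 2).aemeasurable (hg.pow_const 2).aemeasurable

lemma lintegral_comp_add_right_sq {f g : G → ℝ≥0∞} (hf : Measurable f) (hg : Measurable g) :
    ∫⁻ k : G × G, (f (k.1 + k.2) * g k.2) ^ 2 = (l2 f * l2 g) ^ 2 := by
  rw [← lintegral_prod_mul_sq hf hg]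
  exact (measurePreserving_add_prod (volume : Measure G) (volume : Measure G)).lintegral_comp
    (f := fun k : G × G => (f k.1 * g k.2) ^ 2) (by fun_prop)

lemma form_swap (W : G → G → ℝ≥0∞) (h g₁ g₂ : G → ℝ≥0∞) :
    form W h g₁ g₂ = form (fun a b => W b a) h g₂ g₁ := by
  unfold form
  have e := (Measure.measurePreserving_swap (μ := (volume : Measure G))
    (ν := (volume : Measure G))).lintegral_comp_emb (MeasurableEquiv.prodComm).measurableEmbedding
      (fun k : G × G => W k.1 k.2 * h (k.1 + k.2) * g₁ k.1 * g₂ k.2)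
  refine (Eq.trans ?_ e).symm
  refine lintegral_congr fun k => ?_
  simp only [Prod.fst_swap, Prod.snd_swap, add_comm k.2 k.1]
  ring

lemma FormBound.swap (hW : FormBound W C) : FormBound (fun a b => W b a) C := by
  intro h g₁ g₂ hh hg₁ hg₂
  rw [form_swap]
  refine (hW h g₂ g₁ hh hg₂ hg₁).trans (le_of_eq ?_)
  ring

lemma FormBound.mono {W' : G → G → ℝ≥0∞} (hW : FormBound W C) (hle : ∀ a b, W' a b ≤ W a b) :
    FormBound W' C := by
  intro h g₁ g₂ hh hg₁ hg₂
  refine le_trans (lintegral_mono fun k => ?_) (hW h g₁ g₂ hh hg₁ hg₂)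
  gcongr
  exact hle _ _

lemma FormBound.add {W' : G → G → ℝ≥0∞} {C' : ℝ≥0∞} (hW : FormBound W C) (hW' : FormBound W' C')
    (hm : Measurable (Function.uncurry W)) :
    FormBound (fun a b => W a b + W' a b) (C + C') := by
  intro h g₁ g₂ hh hg₁ hg₂
  have e : form (fun a b => W a b + W' a b) h g₁ g₂ = form W h g₁ g₂ + form W' h g₁ g₂ := by
    unfold form
    have hm' : Measurable fun k : G × G => W k.1 k.2 := hm
    rw [← lintegral_add_left (by fun_prop)]
    refine lintegral_congr fun k => ?_
    ring
  rw [e, add_mul, add_mul, add_mul]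
  exact add_le_add (hW h g₁ g₂ hh hg₁ hg₂) (hW' h g₁ g₂ hh hg₁ hg₂)

/-- Invariance of bounded forms under measure preserving additive involutions. -/
lemma FormBound.comp_involution (hW : FormBound W C) (hm : Measurable (Function.uncurry W))
    {T : G → G} (hT : MeasurePreserving T) (hadd : ∀ a b, T (a + b) = T a + T b)
    (hinv : ∀ a, T (T a) = a) : FormBound (fun a b => W (T a) (T b)) C := by
  intro h g₁ g₂ hh hg₁ hg₂
  have hTm := hT.measurable
  have hm' : Measurable fun k : G × G => W k.1 k.2 := hm
  have e : form (fun a b => W (T a) (T b)) h g₁ g₂ =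
      form W (fun k => h (T k)) (fun k => g₁ (T k)) (fun k => g₂ (T k)) := by
    unfold form
    refine Eq.trans (lintegral_congr fun k => ?_) ((hT.prod hT).lintegral_comp
      (f := fun k : G × G => W k.1 k.2 * h (T (k.1 + k.2)) * g₁ (T k.1) * g₂ (T k.2))
      (by fun_prop))
    simp only [Prod.map_fst, Prod.map_snd, hadd, hinv]
  rw [e, ← l2_comp hT hh, ← l2_comp hT hg₁, ← l2_comp hT hg₂]
  exact hW _ _ _ (by fun_prop) (by fun_prop) (by fun_prop)

/-- Cauchy-Schwarz on the product space, pairing W(k₁, k₂) g₂(k₂) with h(k₁ + k₂) g₁(k₁); the norm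
of the second factor splits because (k₁, k₂) ↦ (k₁ + k₂, k₁) preserves the measure. The two variants
below fix k₁ or k₁ + k₂ instead. -/
lemma formBound_of_right (hW : Measurable (Function.uncurry W))
    (hC : ∀ k₂, ∫⁻ k₁, W k₁ k₂ ^ 2 ≤ C ^ 2) : FormBound W C := by
  intro h g₁ g₂ hh hg₁ hg₂
  have hm : Measurable fun k : G × G => W k.1 k.2 := hW
  have h1 : ∫⁻ k : G × G, (W k.1 k.2 * g₂ k.2) ^ 2 ≤ (C * l2 g₂) ^ 2 := by
    rw [Measure.volume_eq_prod, lintegral_prod_symm' _ (by fun_prop), mul_pow, l2_sq,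
      ← lintegral_const_mul _ (by fun_prop)]
    refine lintegral_mono fun k₂ => ?_
    have hm2 : Measurable fun k₁ => W k₁ k₂ := hm.comp measurable_prodMk_right
    simp_rw [mul_pow]
    rw [lintegral_mul_const _ (by fun_prop)]
    gcongr
    exact hC k₂
  have h2 : ∫⁻ k : G × G, (h (k.1 + k.2) * g₁ k.1) ^ 2 ≤ (l2 h * l2 g₁) ^ 2 := by
    rw [← lintegral_comp_add_right_sq hh hg₁]
    have e := (Measure.measurePreserving_swap (μ := (volume : Measure G))
      (ν := (volume : Measure G))).lintegral_comp
        (f := fun k : G × G => (h (k.1 + k.2) * g₁ k.2) ^ 2) (by fun_prop)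
    refine le_of_eq (Eq.trans (lintegral_congr fun k => ?_) e)
    simp only [Prod.fst_swap, Prod.snd_swap, add_comm k.2 k.1]
  calc form W h g₁ g₂
      = ∫⁻ k : G × G, (W k.1 k.2 * g₂ k.2) * (h (k.1 + k.2) * g₁ k.1) :=
        lintegral_congr fun k => by ring
    _ ≤ l2 (fun k : G × G => W k.1 k.2 * g₂ k.2) * l2 (fun k : G × G => h (k.1 + k.2) * g₁ k.1) :=
        lintegral_mul_le_l2 (by fun_prop) (by fun_prop)
    _ ≤ (C * l2 g₂) * (l2 h * l2 g₁) := by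
        gcongr
        · exact le_of_sq_le_sq_ennreal (by rw [l2_sq]; exact h1)
        · exact le_of_sq_le_sq_ennreal (by rw [l2_sq]; exact h2)
    _ = _ := by ring

lemma formBound_of_left (hW : Measurable (Function.uncurry W))
    (hC : ∀ k₁, ∫⁻ k₂, W k₁ k₂ ^ 2 ≤ C ^ 2) : FormBound W C :=
  (formBound_of_right (W := fun a b => W b a) (hW.comp measurable_swap) hC).swap

lemma formBound_of_sum (hW : Measurable (Function.uncurry W))
    (hC : ∀ k, ∫⁻ k₁, W k₁ (k - k₁) ^ 2 ≤ C ^ 2) : FormBound W C := by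
  intro h g₁ g₂ hh hg₁ hg₂
  have hm : Measurable fun k : G × G => W k.1 k.2 := hW
  have h1 : ∫⁻ k : G × G, (W k.1 k.2 * h (k.1 + k.2)) ^ 2 ≤ (C * l2 h) ^ 2 := by
    have e1 : ∀ k₁, ∫⁻ k₂, (W k₁ k₂ * h (k₁ + k₂)) ^ 2 =
        ∫⁻ k, (W k₁ (k - k₁) * h k) ^ 2 := by
      intro k₁
      rw [← lintegral_sub_right_eq_self _ k₁]
      simp only [add_sub_cancel]
    rw [Measure.volume_eq_prod, lintegral_prod _ (by fun_prop)]
    simp only [e1]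
    rw [lintegral_lintegral_swap (by
      refine Measurable.aemeasurable ?_
      simp only [Function.uncurry_def]
      exact ((hm.comp (measurable_fst.prodMk (measurable_snd.sub measurable_fst))).mul
        (hh.comp measurable_snd)).pow_const 2), mul_pow, l2_sq,
      ← lintegral_const_mul _ (by fun_prop)]
    refine lintegral_mono fun k => ?_
    have hm2 : Measurable fun k₁ => W k₁ (k - k₁) :=
      hm.comp (measurable_id.prodMk (measurable_const.sub measurable_id))
    simp_rw [mul_pow]
    rw [lintegral_mul_const _ (by fun_prop)]
    gcongr
    exact hC k
  calc form W h g₁ g₂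
      = ∫⁻ k : G × G, (W k.1 k.2 * h (k.1 + k.2)) * (g₁ k.1 * g₂ k.2) :=
        lintegral_congr fun k => by ring
    _ ≤ l2 (fun k : G × G => W k.1 k.2 * h (k.1 + k.2)) * l2 (fun k : G × G => g₁ k.1 * g₂ k.2) :=
        lintegral_mul_le_l2 (by fun_prop) (by fun_prop)
    _ ≤ (C * l2 h) * (l2 g₁ * l2 g₂) := by
        gcongr
        · exact le_of_sq_le_sq_ennreal (by rw [l2_sq]; exact h1)
        · exact le_of_sq_le_sq_ennreal (by rw [l2_sq, lintegral_prod_mul_sq hg₁ hg₂])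
    _ = _ := by ring

end

/-! ### The kernel of the bilinear estimate -/

/-- Frequency space, with coordinates `(τ, (ξ, μ))`. -/
abbrev Freq : Type := ℝ × ℝ × ℝ

instance isAddLeftInvariant_volume_freq : (volume : Measure Freq).IsAddLeftInvariant := by
  have : (volume : Measure (ℝ × ℝ)).IsAddLeftInvariant := inferInstance
  exact Measure.prod.instIsAddLeftInvariant (μ := (volume : Measure ℝ))
    (ν := (volume : Measure (ℝ × ℝ)))

lemma measurableSet_and {X : Type*} [MeasurableSpace X] {P Q : X → Prop}
    (hP : MeasurableSet {x | P x}) (hQ : MeasurableSet {x | Q x}) :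
    MeasurableSet {x | P x ∧ Q x} := hP.inter hQ

@[fun_prop]
lemma measurable_omega {X : Type*} [MeasurableSpace X] {α : ℝ} {f g : X → ℝ} (hf : Measurable f)
    (hg : Measurable g) : Measurable fun x => omega α (f x) (g x) := by
  unfold omega
  fun_prop

/-- The modulation `τ - ω(ξ, μ)`. -/
def modulation (α : ℝ) (k : Freq) : ℝ := k.1 - omega α k.2.1 k.2.2

@[fun_prop]
lemma measurable_modulation (α : ℝ) : Measurable (modulation α) := by
  unfold modulation
  fun_prop

/-- The kernel `|ξ| ⟨σ⟩^{-q/2} ⟨σ₁⟩^{-p/2} ⟨σ₂⟩^{-p/2}`, where `k = k₁ + k₂`. -/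
def ker (α p q : ℝ) (k₁ k₂ : Freq) : ℝ≥0∞ :=
  ENNReal.ofReal |k₁.2.1 + k₂.2.1| * jb (q / 2) (modulation α (k₁ + k₂)) *
    jb (p / 2) (modulation α k₁) * jb (p / 2) (modulation α k₂)

/-- The kernel `ker` restricted to a region of pairs of frequencies. -/
def kerOn (α p q : ℝ) (A : Set (Freq × Freq)) (k₁ k₂ : Freq) : ℝ≥0∞ :=
  A.indicator (fun z => ker α p q z.1 z.2) (k₁, k₂)

lemma measurable_ker (α p q : ℝ) : Measurable fun z : Freq × Freq => ker α p q z.1 z.2 := by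
  unfold ker
  fun_prop

lemma measurable_kerOn (α p q : ℝ) {A : Set (Freq × Freq)} (hA : MeasurableSet A) :
    Measurable (Function.uncurry (kerOn α p q A)) :=
  (measurable_ker α p q).indicator hA

lemma ker_comm (α p q : ℝ) (k₁ k₂ : Freq) : ker α p q k₁ k₂ = ker α p q k₂ k₁ := by
  unfold ker
  rw [add_comm k₁ k₂, add_comm k₁.2.1]
  ring

lemma kerOn_le (α p q : ℝ) (A : Set (Freq × Freq)) (k₁ k₂ : Freq) :
    kerOn α p q A k₁ k₂ ≤ ker α p q k₁ k₂ :=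
  Set.indicator_le_self A (fun z : Freq × Freq => ker α p q z.1 z.2) (k₁, k₂)

lemma kerOn_of_mem {α p q : ℝ} {A : Set (Freq × Freq)} {k₁ k₂ : Freq} (h : (k₁, k₂) ∈ A) :
    kerOn α p q A k₁ k₂ = ker α p q k₁ k₂ := by
  simp [kerOn, h]

lemma kerOn_of_notMem {α p q : ℝ} {A : Set (Freq × Freq)} {k₁ k₂ : Freq} (h : (k₁, k₂) ∉ A) :
    kerOn α p q A k₁ k₂ = 0 := by
  simp [kerOn, h]

lemma ker_sq (α p q : ℝ) (k₁ k₂ : Freq) :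
    ker α p q k₁ k₂ ^ 2 = ENNReal.ofReal ((k₁.2.1 + k₂.2.1) ^ 2) *
      jb q (modulation α (k₁ + k₂)) * jb p (modulation α k₁) * jb p (modulation α k₂) := by
  unfold ker
  rw [mul_pow, mul_pow, mul_pow, jb_sq, jb_sq, jb_sq, ← ENNReal.ofReal_pow (abs_nonneg _), sq_abs]

lemma lintegral_freq {f : Freq → ℝ≥0∞} (hf : Measurable f) :
    ∫⁻ k, f k = ∫⁻ ξ, ∫⁻ μ, ∫⁻ τ, f (τ, ξ, μ) := by
  rw [Measure.volume_eq_prod, lintegral_prod_symm' _ hf, Measure.volume_eq_prod,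
    lintegral_prod _ (Measurable.aemeasurable
      (Measurable.lintegral_prod_left' hf))]

/-- With k fixed, |ξ| and ⟨σ⟩ are constants, and the τ₁ integral merges the weights of σ₁ and σ₂
into one weight at σ₁ + σ₂, which does not depend on τ₁. The set S only has to contain the ξ₁ that
occur in A. -/
lemma exists_lintegral_sum_le (α : ℝ) {p q : ℝ} (hp : 1 < p) :
    ∃ C : ℝ≥0, ∀ (k : Freq) (S : Set ℝ) (A : Set (Freq × Freq)), MeasurableSet A →
      MeasurableSet S → (∀ k₁, (k₁, k - k₁) ∈ A → k₁.2.1 ∈ S) →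
      ∫⁻ k₁, kerOn α p q A k₁ (k - k₁) ^ 2 ≤ C * (ENNReal.ofReal (k.2.1 ^ 2) *
        jb q (modulation α k) * ∫⁻ ξ in S, ∫⁻ μ,
          jb p (k.1 - omega α ξ μ - omega α (k.2.1 - ξ) (k.2.2 - μ))) := by
  obtain ⟨C, hC⟩ := exists_lintegral_jb_mul_jb_le hp (by linarith) le_rfl
  refine ⟨C, fun k S A hA hS hAS => ?_⟩
  set c := ENNReal.ofReal (k.2.1 ^ 2) * jb q (modulation α k)
  have hm : Measurable fun k₁ : Freq => kerOn α p q A k₁ (k - k₁) ^ 2 :=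
    ((measurable_kerOn α p q hA).comp
      (measurable_id.prodMk (measurable_const.sub measurable_id))).pow_const 2
  rw [lintegral_freq hm]
  have hb : ∀ ξ μ, ∫⁻ τ, kerOn α p q A (τ, ξ, μ) (k - (τ, ξ, μ)) ^ 2 ≤
      S.indicator (fun ξ => c * (C * jb p (k.1 - omega α ξ μ -
        omega α (k.2.1 - ξ) (k.2.2 - μ)))) ξ := by
    intro ξ μ
    by_cases hξ : ξ ∈ S
    · rw [Set.indicator_of_mem hξ]
      calc ∫⁻ τ, kerOn α p q A (τ, ξ, μ) (k - (τ, ξ, μ)) ^ 2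
          ≤ ∫⁻ τ, c * (jb p (τ - omega α ξ μ) *
              jb p (τ - (k.1 - omega α (k.2.1 - ξ) (k.2.2 - μ)))) := by
            refine lintegral_mono fun τ => ?_
            refine (pow_le_pow_left' (kerOn_le α p q A _ _) 2).trans (le_of_eq ?_)
            rw [ker_sq, jb_sub_comm p τ (k.1 - _)]
            simp only [c, modulation, Prod.fst_sub, Prod.snd_sub,
              add_sub_cancel]
            rw [show k.1 - omega α (k.2.1 - ξ) (k.2.2 - μ) - τ =
              k.1 - τ - omega α (k.2.1 - ξ) (k.2.2 - μ) by ring]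
            ring
        _ ≤ _ := by
            rw [lintegral_const_mul _ (by fun_prop)]
            gcongr
            refine (hC _ _).trans (le_of_eq ?_)
            rw [jb_sub_comm]
            congr 2
            ring
    · rw [Set.indicator_of_notMem hξ, nonpos_iff_eq_zero]
      refine (lintegral_congr fun τ => ?_).trans lintegral_zero
      rw [kerOn_of_notMem (fun h => hξ (hAS _ h))]
      simp
  calc ∫⁻ ξ, ∫⁻ μ, ∫⁻ τ, kerOn α p q A (τ, ξ, μ) (k - (τ, ξ, μ)) ^ 2
      ≤ ∫⁻ ξ, ∫⁻ μ, S.indicator (fun ξ => c * (C * jb p (k.1 - omega α ξ μ -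
        omega α (k.2.1 - ξ) (k.2.2 - μ)))) ξ :=
        lintegral_mono fun ξ => lintegral_mono fun μ => hb ξ μ
    _ = ∫⁻ ξ, S.indicator (fun ξ => (c * C) * ∫⁻ μ, jb p (k.1 - omega α ξ μ -
        omega α (k.2.1 - ξ) (k.2.2 - μ))) ξ := by
        refine lintegral_congr fun ξ => ?_
        by_cases hξ : ξ ∈ S
        · simp only [Set.indicator_of_mem hξ, ← mul_assoc]
          rw [lintegral_const_mul _ (by fun_prop)]
        · simp [Set.indicator_of_notMem hξ]
    _ = _ := by
        rw [lintegral_indicator hS, lintegral_const_mul]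
        · ring
        · exact Measurable.lintegral_prod_right' (f := fun z : ℝ × ℝ =>
            jb p (k.1 - omega α z.1 z.2 - omega α (k.2.1 - z.1) (k.2.2 - z.2))) (by fun_prop)

/-- With k₁ fixed the τ₂ integral merges the weights of σ₂ and σ into one at σ - σ₂, with the
smaller exponent q. The factor |ξ|² now varies and stays under the integral. -/
lemma exists_lintegral_left_le (α : ℝ) {p q : ℝ} (hp : 1 < p) (hq : 0 ≤ q) (hpq : q ≤ p) :
    ∃ C : ℝ≥0, ∀ (k₁ : Freq) (S : Set ℝ) (A : Set (Freq × Freq)), MeasurableSet A →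
      MeasurableSet S → (∀ k₂, (k₁, k₂) ∈ A → k₂.2.1 ∈ S) →
      ∫⁻ k₂, kerOn α p q A k₁ k₂ ^ 2 ≤ C * (jb p (modulation α k₁) *
        ∫⁻ ξ in S, ENNReal.ofReal ((k₁.2.1 + ξ) ^ 2) * ∫⁻ μ,
          jb q (k₁.1 + omega α ξ μ - omega α (k₁.2.1 + ξ) (k₁.2.2 + μ))) := by
  obtain ⟨C, hC⟩ := exists_lintegral_jb_mul_jb_le hp hq hpq
  refine ⟨C, fun k S A hA hS hAS => ?_⟩
  set c := jb p (modulation α k)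
  have hm : Measurable fun k₂ : Freq => kerOn α p q A k k₂ ^ 2 :=
    ((measurable_kerOn α p q hA).comp (measurable_const.prodMk measurable_id)).pow_const 2
  rw [lintegral_freq hm]
  have hb : ∀ ξ μ, ∫⁻ τ, kerOn α p q A k (τ, ξ, μ) ^ 2 ≤
      S.indicator (fun ξ => c * ENNReal.ofReal ((k.2.1 + ξ) ^ 2) * (C * jb q (k.1 + omega α ξ μ -
        omega α (k.2.1 + ξ) (k.2.2 + μ)))) ξ := by
    intro ξ μ
    by_cases hξ : ξ ∈ S
    · rw [Set.indicator_of_mem hξ]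
      calc ∫⁻ τ, kerOn α p q A k (τ, ξ, μ) ^ 2
          ≤ ∫⁻ τ, c * ENNReal.ofReal ((k.2.1 + ξ) ^ 2) * (jb p (τ - omega α ξ μ) *
              jb q (τ - (omega α (k.2.1 + ξ) (k.2.2 + μ) - k.1))) := by
            refine lintegral_mono fun τ => ?_
            refine (pow_le_pow_left' (kerOn_le α p q A _ _) 2).trans (le_of_eq ?_)
            rw [ker_sq]
            simp only [c, modulation, Prod.fst_add, Prod.snd_add]
            rw [show τ - (omega α (k.2.1 + ξ) (k.2.2 + μ) - k.1) =
              k.1 + τ - omega α (k.2.1 + ξ) (k.2.2 + μ) by ring]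
            ring
        _ ≤ _ := by
            rw [lintegral_const_mul _ (by fun_prop)]
            gcongr
            refine (hC _ _).trans (le_of_eq ?_)
            congr 2
            ring
    · rw [Set.indicator_of_notMem hξ, nonpos_iff_eq_zero]
      refine (lintegral_congr fun τ => ?_).trans lintegral_zero
      rw [kerOn_of_notMem (fun h => hξ (hAS _ h))]
      simp
  have hmi : Measurable fun ξ => ∫⁻ μ, jb q (k.1 + omega α ξ μ -
        omega α (k.2.1 + ξ) (k.2.2 + μ)) :=
    Measurable.lintegral_prod_right' (f := fun z : ℝ × ℝ =>
            jb q (k.1 + omega α z.1 z.2 - omega α (k.2.1 + z.1) (k.2.2 + z.2))) (by fun_prop)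
  calc ∫⁻ ξ, ∫⁻ μ, ∫⁻ τ, kerOn α p q A k (τ, ξ, μ) ^ 2
      ≤ ∫⁻ ξ, ∫⁻ μ, S.indicator (fun ξ => c * ENNReal.ofReal ((k.2.1 + ξ) ^ 2) *
        (C * jb q (k.1 + omega α ξ μ - omega α (k.2.1 + ξ) (k.2.2 + μ)))) ξ :=
        lintegral_mono fun ξ => lintegral_mono fun μ => hb ξ μ
    _ = ∫⁻ ξ, S.indicator (fun ξ => (c * C) * (ENNReal.ofReal ((k.2.1 + ξ) ^ 2) *
        ∫⁻ μ, jb q (k.1 + omega α ξ μ - omega α (k.2.1 + ξ) (k.2.2 + μ)))) ξ := by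
        refine lintegral_congr fun ξ => ?_
        by_cases hξ : ξ ∈ S
        · simp only [Set.indicator_of_mem hξ, ← mul_assoc]
          rw [lintegral_const_mul _ (by fun_prop)]
          ring
        · simp [Set.indicator_of_notMem hξ]
    _ = _ := by
        rw [lintegral_indicator hS, lintegral_const_mul _ (by fun_prop)]
        ring

lemma ae_ne_real (a : ℝ) : ∀ᵐ x : ℝ, x ≠ a := by
  simp [ae_iff, measure_singleton]

/-- Bound for a fixed total frequency, using the curvature in `μ₁`. -/
lemma exists_lintegral_sum_quadratic_le (α : ℝ) {p q : ℝ} (hp : 1 < p) :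
    ∃ C : ℝ≥0, ∀ (k : Freq) (S : Set ℝ) (A : Set (Freq × Freq)), MeasurableSet A →
      MeasurableSet S → (∀ k₁, (k₁, k - k₁) ∈ A → k₁.2.1 ∈ S) →
      ∫⁻ k₁, kerOn α p q A k₁ (k - k₁) ^ 2 ≤ C * (jb q (modulation α k) *
        ∫⁻ ξ in S, ENNReal.ofReal (k.2.1 ^ 2 * (√|k.2.1 / (ξ * (k.2.1 - ξ))|)⁻¹)) := by
  obtain ⟨C₁, h₁⟩ := exists_lintegral_sum_le α (q := q) hp
  obtain ⟨C₂, h₂⟩ := exists_lintegral_jb_quadratic_le (q := p) (by linarith)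
  refine ⟨C₁ * C₂, fun k S A hA hS hAS => (h₁ k S A hA hS hAS).trans ?_⟩
  rcases eq_or_ne k.2.1 0 with h0 | h0
  · simp [h0]
  have hb : ∫⁻ ξ in S, ∫⁻ μ, jb p (k.1 - omega α ξ μ - omega α (k.2.1 - ξ) (k.2.2 - μ)) ≤
      ∫⁻ ξ in S, C₂ * ENNReal.ofReal ((√|k.2.1 / (ξ * (k.2.1 - ξ))|)⁻¹) := by
    refine lintegral_mono_ae ?_
    filter_upwards [ae_restrict_of_ae (ae_ne_real 0), ae_restrict_of_ae (ae_ne_real k.2.1)]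
      with ξ hξ0 hξ
    have hξ' : k.2.1 - ξ ≠ 0 := sub_ne_zero.2 hξ.symm
    have hc : k.2.1 / (ξ * (k.2.1 - ξ)) ≠ 0 := by positivity
    have := h₂ (k.1 - (ξ ^ 5 - α * ξ ^ 3) - ((k.2.1 - ξ) ^ 5 - α * (k.2.1 - ξ) ^ 3) -
      k.2.2 ^ 2 / (k.2.1 - ξ)) (2 * k.2.2 / (k.2.1 - ξ)) (-(k.2.1 / (ξ * (k.2.1 - ξ))))
      (neg_ne_zero.2 hc)
    rw [abs_neg] at this
    refine le_trans (le_of_eq (lintegral_congr fun μ => ?_)) this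
    congr 1
    -- As a polynomial in μ₁ the argument has leading coefficient -(1/ξ₁ + 1/(ξ - ξ₁)) = -ξ/(ξ₁(ξ -
    -- ξ₁)).
    unfold omega
    field_simp
    ring
  calc C₁ * (ENNReal.ofReal (k.2.1 ^ 2) * jb q (modulation α k) * ∫⁻ ξ in S, ∫⁻ μ,
          jb p (k.1 - omega α ξ μ - omega α (k.2.1 - ξ) (k.2.2 - μ)))
      ≤ C₁ * (ENNReal.ofReal (k.2.1 ^ 2) * jb q (modulation α k) *
        ∫⁻ ξ in S, C₂ * ENNReal.ofReal ((√|k.2.1 / (ξ * (k.2.1 - ξ))|)⁻¹)) := by gcongr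
    _ = _ := by
        rw [lintegral_const_mul _ (by fun_prop)]
        simp_rw [ENNReal.ofReal_mul (sq_nonneg k.2.1)]
        rw [lintegral_const_mul _ (by fun_prop)]
        push_cast
        ring

/-- Bound for a fixed first frequency, using the curvature in `μ₂`. -/
lemma exists_lintegral_left_quadratic_le (α : ℝ) {p q : ℝ} (hp : 1 < p) (hq : 1 / 2 < q)
    (hpq : q ≤ p) :
    ∃ C : ℝ≥0, ∀ (k₁ : Freq) (S : Set ℝ) (A : Set (Freq × Freq)), MeasurableSet A →
      MeasurableSet S → (∀ k₂, (k₁, k₂) ∈ A → k₂.2.1 ∈ S) → k₁.2.1 ≠ 0 →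
      ∫⁻ k₂, kerOn α p q A k₁ k₂ ^ 2 ≤ C * (jb p (modulation α k₁) *
        ∫⁻ ξ in S, ENNReal.ofReal
          ((k₁.2.1 + ξ) ^ 2 * (√|k₁.2.1 / (ξ * (k₁.2.1 + ξ))|)⁻¹)) := by
  obtain ⟨C₁, h₁⟩ := exists_lintegral_left_le α hp (by linarith) hpq
  obtain ⟨C₂, h₂⟩ := exists_lintegral_jb_quadratic_le hq
  refine ⟨C₁ * C₂, fun k S A hA hS hAS h0 => (h₁ k S A hA hS hAS).trans ?_⟩
  have hb : ∫⁻ ξ in S, ENNReal.ofReal ((k.2.1 + ξ) ^ 2) *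
      ∫⁻ μ, jb q (k.1 + omega α ξ μ - omega α (k.2.1 + ξ) (k.2.2 + μ)) ≤
      ∫⁻ ξ in S, C₂ * ENNReal.ofReal
        ((k.2.1 + ξ) ^ 2 * (√|k.2.1 / (ξ * (k.2.1 + ξ))|)⁻¹) := by
    refine lintegral_mono_ae ?_
    filter_upwards [ae_restrict_of_ae (ae_ne_real 0), ae_restrict_of_ae (ae_ne_real (-k.2.1))]
      with ξ hξ0 hξ
    have hξ' : k.2.1 + ξ ≠ 0 := fun h => hξ (by linarith)
    have hc : k.2.1 / (ξ * (k.2.1 + ξ)) ≠ 0 := by positivity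
    have := h₂ (k.1 + (ξ ^ 5 - α * ξ ^ 3) - ((k.2.1 + ξ) ^ 5 - α * (k.2.1 + ξ) ^ 3) -
      k.2.2 ^ 2 / (k.2.1 + ξ)) (-2 * k.2.2 / (k.2.1 + ξ)) (k.2.1 / (ξ * (k.2.1 + ξ))) hc
    rw [ENNReal.ofReal_mul (sq_nonneg _), mul_left_comm]
    gcongr
    refine le_trans (le_of_eq (lintegral_congr fun μ => ?_)) this
    congr 1
    unfold omega
    field_simp
    ring
  calc _ ≤ C₁ * (jb p (modulation α k) * ∫⁻ ξ in S, C₂ * ENNReal.ofReal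
        ((k.2.1 + ξ) ^ 2 * (√|k.2.1 / (ξ * (k.2.1 + ξ))|)⁻¹)) := by gcongr
    _ = _ := by
        rw [lintegral_const_mul _ (by fun_prop)]
        push_cast
        ring

/-! ### Low frequencies and non-resonant interactions -/

lemma exists_formBound_of_sum {W : Freq → Freq → ℝ≥0∞} (hW : Measurable (Function.uncurry W))
    {C : ℝ≥0} (h : ∀ k, ∫⁻ k₁, W k₁ (k - k₁) ^ 2 ≤ C) : ∃ C : ℝ≥0, FormBound W C :=
  ⟨NNReal.sqrt C, formBound_of_sum hW fun k => by
    rw [← ENNReal.coe_pow, NNReal.sq_sqrt]; exact h k⟩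

lemma exists_formBound_of_left {W : Freq → Freq → ℝ≥0∞} (hW : Measurable (Function.uncurry W))
    {C : ℝ≥0} (h : ∀ k₁, ∫⁻ k₂, W k₁ k₂ ^ 2 ≤ C) : ∃ C : ℝ≥0, FormBound W C :=
  ⟨NNReal.sqrt C, formBound_of_left hW fun k => by
    rw [← ENNReal.coe_pow, NNReal.sq_sqrt]; exact h k⟩

/-- The size left by the μ integral when k is fixed, with x = ξ and y, z the two input frequencies;
its primed companion serves the case of a fixed input frequency. -/
lemma sq_mul_inv_sqrt_eq (x y z : ℝ) :
    x ^ 2 * (√|x / (y * z)|)⁻¹ = √(|x| ^ 3 * |y| * |z|) := by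
  rcases eq_or_ne x 0 with rfl | hx
  · simp
  have hx' : 0 < |x| := abs_pos.2 hx
  rw [← Real.sqrt_inv, ← Real.sqrt_sq (sq_nonneg x), ← Real.sqrt_mul (by positivity)]
  congr 1
  rw [← sq_abs x, abs_div, abs_mul, inv_div]
  field_simp

lemma sq_mul_inv_sqrt_eq' (x y z : ℝ) :
    x ^ 2 * (√|y / (z * x)|)⁻¹ = √(|x| ^ 5 * |z| / |y|) := by
  rw [← Real.sqrt_inv, ← Real.sqrt_sq (sq_nonneg x), ← Real.sqrt_mul (by positivity)]
  congr 1
  rw [← sq_abs x, abs_div, abs_mul, inv_div]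
  ring

/-- Both frequencies bounded by `N`. -/
lemma exists_formBound_low (α : ℝ) {p q : ℝ} (hp : 1 < p) (hq : 0 ≤ q) (N : ℝ) :
    ∃ C : ℝ≥0, FormBound (kerOn α p q {z | |z.1.2.1| ≤ N ∧ |z.2.2.1| ≤ N}) C := by
  have hA : MeasurableSet {z : Freq × Freq | |z.1.2.1| ≤ N ∧ |z.2.2.1| ≤ N} := by
    exact measurableSet_and (measurableSet_le (by fun_prop) (by fun_prop))
      (measurableSet_le (by fun_prop) (by fun_prop))
  obtain ⟨C, hC⟩ := exists_lintegral_sum_quadratic_le α (q := q) hp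
  refine exists_formBound_of_sum (measurable_kerOn α p q hA)
    (C := C * (Real.toNNReal √((2 * N) ^ 3 * N * N) * Real.toNNReal (2 * N))) fun k => ?_
  have hS : MeasurableSet {ξ : ℝ | |ξ| ≤ N ∧ |k.2.1 - ξ| ≤ N} := by
    exact measurableSet_and (measurableSet_le (by fun_prop) (by fun_prop))
      (measurableSet_le (by fun_prop) (by fun_prop))
  refine (hC k {ξ | |ξ| ≤ N ∧ |k.2.1 - ξ| ≤ N} _ hA hS fun k₁ h => by simpa using h).trans ?_
  rw [ENNReal.coe_mul]
  gcongr
  calc jb q (modulation α k) * ∫⁻ ξ in {ξ : ℝ | |ξ| ≤ N ∧ |k.2.1 - ξ| ≤ N},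
        ENNReal.ofReal (k.2.1 ^ 2 * (√|k.2.1 / (ξ * (k.2.1 - ξ))|)⁻¹)
      ≤ 1 * ∫⁻ ξ in {ξ : ℝ | |ξ| ≤ N ∧ |k.2.1 - ξ| ≤ N},
        ENNReal.ofReal √((2 * N) ^ 3 * N * N) := by
        refine mul_le_mul' (jb_le_one hq _) (setLIntegral_mono measurable_const fun ξ hξ => ?_)
        refine ENNReal.ofReal_le_ofReal ?_
        rw [sq_mul_inv_sqrt_eq]
        have h1 : |k.2.1| ≤ 2 * N := by
          have := abs_add_le ξ (k.2.1 - ξ)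
          rw [add_sub_cancel] at this
          linarith [hξ.1, hξ.2]
        refine Real.sqrt_le_sqrt ?_
        have hN : 0 ≤ N := (abs_nonneg ξ).trans hξ.1
        gcongr
        · exact hξ.1
        · exact hξ.2
    _ ≤ _ := by
        rw [one_mul, setLIntegral_const]
        push_cast
        rw [ENNReal.ofReal, ENNReal.ofNNReal_toNNReal]
        gcongr
        refine (measure_mono (t := Set.Icc (-N) N) fun ξ hξ => abs_le.1 hξ.1).trans ?_
        rw [Real.volume_Icc]
        exact ENNReal.ofReal_le_ofReal (by linarith)

/-! ### Non-resonant interactions of high frequencies -/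

lemma rpow_neg_mul_sqrt_le {b q x y z : ℝ} (hq : 3 / 4 ≤ q) (hb : 1 ≤ b) (hx : x = y + z)
    (hy : 1 ≤ |y|) (hyz : |y| ≤ |z|) (hK : |x| * |y| * |z| ^ 3 / 10 ≤ b) :
    b ^ (-q) * √(|x| ^ 3 * |y| * |z|) ≤ 20 * bracket y ^ (-(5 / 4) : ℝ) := by
  have hB := bracket_pos y
  have hxz : |x| ≤ 2 * |z| := by
    rw [hx]
    linarith [abs_add_le y z]
  set X := |x|
  set Y := |y|
  set Z := |z|
  have hX : 0 ≤ X := abs_nonneg x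
  have hB2 : bracket y ^ 2 ≤ 2 * Y ^ 2 := by
    rw [bracket_sq, ← sq_abs y]
    nlinarith
  have h1 : b ^ (-q) ≤ b ^ (-(3 / 4) : ℝ) :=
    Real.rpow_le_rpow_of_exponent_le hb (by linarith)
  refine (mul_le_mul_of_nonneg_right h1 (Real.sqrt_nonneg _)).trans ?_
  have h4 : (b ^ (-(3 / 4) : ℝ)) ^ 4 = (b ^ 3)⁻¹ := by
    rw [← Real.rpow_natCast, ← Real.rpow_mul (by linarith), ← Real.rpow_natCast b,
      ← Real.rpow_neg (by linarith)]
    norm_num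
  have h5 : (bracket y ^ (-(5 / 4) : ℝ)) ^ 4 = (bracket y ^ 5)⁻¹ := by
    rw [← Real.rpow_natCast, ← Real.rpow_mul hB.le, ← Real.rpow_natCast (bracket y),
      ← Real.rpow_neg hB.le]
    norm_num
  have h6 : √(X ^ 3 * Y * Z) ^ 4 = (X ^ 3 * Y * Z) ^ 2 := by
    rw [show (4 : ℕ) = 2 * 2 from rfl, pow_mul, Real.sq_sqrt (by positivity)]
  -- Fourth powers clear the exponents 3/4, 1/2 and 5/4. Up to constants the claim is then X³Y⁴ ≤
  -- 8Z⁷, which follows from X ≤ 2Z and Y ≤ Z.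
  refine le_of_pow_le_pow_left₀ (n := 4) (by norm_num) (by positivity) ?_
  rw [mul_pow, mul_pow, h4, h5, h6]
  have hb0 : 0 < b := by linarith
  rw [inv_mul_le_iff₀ (by positivity)]
  have h7 : (X * Y * Z ^ 3 / 10) ^ 3 ≤ b ^ 3 := pow_le_pow_left₀ (by positivity) hK 3
  have h8 : bracket y ^ 5 ≤ 6 * Y ^ 5 := by
    have h9 : bracket y ≤ 3 / 2 * Y := by
      refine le_of_sq_le_sq ?_ (by positivity)
      nlinarith
    calc bracket y ^ 5 ≤ bracket y ^ 2 * bracket y ^ 2 * bracket y := le_of_eq (by ring)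
      _ ≤ (2 * Y ^ 2) * (2 * Y ^ 2) * (3 / 2 * Y) := by gcongr
      _ = _ := by ring
  have hZ : 1 ≤ Z := hy.trans hyz
  have h10 : X ^ 3 * Y ^ 4 ≤ 8 * Z ^ 7 := by
    calc X ^ 3 * Y ^ 4 ≤ (2 * Z) ^ 3 * Z ^ 4 := by gcongr
      _ = _ := by ring
  calc (X ^ 3 * Y * Z) ^ 2
      ≤ (X * Y * Z ^ 3 / 10) ^ 3 * (20 ^ 4 * (6 * Y ^ 5)⁻¹) := by
        rw [← div_eq_mul_inv, ← mul_div_assoc, le_div_iff₀ (by positivity)]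
        have : X ^ 3 * Y ^ 4 * (X ^ 3 * Y ^ 3 * Z ^ 2 * 6) ≤
            8 * Z ^ 7 * (X ^ 3 * Y ^ 3 * Z ^ 2 * 6) := by gcongr
        have h11 : 0 ≤ X ^ 3 * Y ^ 3 * Z ^ 9 := by positivity
        nlinarith
    _ ≤ b ^ 3 * (20 ^ 4 * (bracket y ^ 5)⁻¹) := by gcongr

/-- The high frequency interactions with `1 ≤ |ξ₁| ≤ |ξ₂|`. -/
def highRegion : Set (Freq × Freq) := {z | 1 ≤ |z.1.2.1| ∧ |z.1.2.1| ≤ |z.2.2.1|}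

/-- The size `|ξ| |ξ₁| |ξ₂|³` of the resonance function when `|ξ₁| ≤ |ξ₂|`. -/
def resSize (z : Freq × Freq) : ℝ := |z.1.2.1 + z.2.2.1| * |z.1.2.1| * |z.2.2.1| ^ 3

lemma measurable_resSize : Measurable resSize := by
  unfold resSize
  fun_prop

lemma measurableSet_highRegion : MeasurableSet highRegion := by
  exact measurableSet_and (measurableSet_le (by fun_prop) (by fun_prop))
      (measurableSet_le (by fun_prop) (by fun_prop))

/-- The large output modulation beats the size (|ξ|³ |ξ₁| |ξ₂|)^{1/2} left by the μ integral down to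
⟨ξ₁⟩^{-5/4}, which is integrable. This is where q ≥ 3/4 is spent. -/
lemma exists_formBound_sum_nonresonant (α : ℝ) {p q : ℝ} (hp : 1 < p) (hq : 3 / 4 ≤ q) :
    ∃ C : ℝ≥0, FormBound (kerOn α p q
      (highRegion ∩ {z | resSize z / 10 ≤ |modulation α (z.1 + z.2)|})) C := by
  have hA : MeasurableSet
      (highRegion ∩ {z | resSize z / 10 ≤ |modulation α (z.1 + z.2)|}) :=
    measurableSet_highRegion.inter
      (measurableSet_le (measurable_resSize.div_const _) (by fun_prop))
  obtain ⟨C, hC⟩ := exists_lintegral_sum_quadratic_le α (q := q) hp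
  have hfin := lintegral_jb_lt_top (p := 5 / 4) (by norm_num)
  lift (∫⁻ s, jb (5 / 4) s) to ℝ≥0 using hfin.ne with I hI
  refine exists_formBound_of_sum (measurable_kerOn α p q hA)
    (C := C * (20 * I)) fun k => ?_
  set S := {ξ : ℝ | 1 ≤ |ξ| ∧ |ξ| ≤ |k.2.1 - ξ| ∧
    |k.2.1| * |ξ| * |k.2.1 - ξ| ^ 3 / 10 ≤ |modulation α k|}
  have hS : MeasurableSet S := by
    exact measurableSet_and (measurableSet_le (by fun_prop) (by fun_prop))
      (measurableSet_and (measurableSet_le (by fun_prop) (by fun_prop))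
        (measurableSet_le (by fun_prop) (by fun_prop)))
  refine (hC k S _ hA hS fun k₁ h => ?_).trans ?_
  · have h1 := h.1.1
    have h2 := h.1.2
    have h3 := h.2
    simp only [resSize, Set.mem_ofPred_eq, add_sub_cancel, Prod.snd_sub, Prod.fst_sub] at h1 h2 h3
    exact ⟨h1, h2, h3⟩
  rw [ENNReal.coe_mul, ENNReal.coe_mul]
  gcongr (C : ℝ≥0∞) * ?_
  rw [← lintegral_const_mul _ (by fun_prop), hI, ← lintegral_const_mul _ (by fun_prop)]
  refine le_trans (setLIntegral_mono (g := fun ξ => ((20 : ℝ≥0) : ℝ≥0∞) * jb (5 / 4) ξ)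
    (by fun_prop) fun ξ hξ => ?_) (setLIntegral_le_lintegral _ _)
  rw [sq_mul_inv_sqrt_eq, jb, jb, ← ENNReal.ofReal_mul (by have := bracket_pos (modulation α k); positivity),
    show ((20 : ℝ≥0) : ℝ≥0∞) = ENNReal.ofReal 20 by simp, ← ENNReal.ofReal_mul (by norm_num)]
  refine ENNReal.ofReal_le_ofReal (rpow_neg_mul_sqrt_le hq (one_le_bracket _) (by ring)
    hξ.1 hξ.2.1 (hξ.2.2.trans (abs_le_bracket _)))

lemma exists_formBound_right_nonresonant (α : ℝ) {p q : ℝ} (hp : 1 < p) (hq : 3 / 4 ≤ q)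
    (hpq : q ≤ p) :
    ∃ C : ℝ≥0, FormBound (kerOn α p q
      (highRegion ∩ {z | resSize z / 10 ≤ |modulation α z.2|})) C := by
  set A := highRegion ∩ {z | resSize z / 10 ≤ |modulation α z.2|}
  have hA : MeasurableSet A := measurableSet_highRegion.inter
    (measurableSet_le (measurable_resSize.div_const _) (by fun_prop))
  have hA' : MeasurableSet (Prod.swap ⁻¹' A) := measurable_swap hA
  obtain ⟨C, hC⟩ := exists_lintegral_left_quadratic_le α hp (by linarith) hpq
  have hfin := lintegral_jb_lt_top (p := 5 / 4) (by norm_num)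
  lift (∫⁻ s, jb (5 / 4) s) to ℝ≥0 using hfin.ne with I hI
  -- The kernel is symmetric, so the frequency with the large modulation can be moved to the first
  -- slot, where the bound for a fixed first frequency applies.
  suffices h : ∃ C : ℝ≥0, FormBound (kerOn α p q (Prod.swap ⁻¹' A)) C by
    obtain ⟨C, hC⟩ := h
    refine ⟨C, hC.swap.mono fun a b => le_of_eq ?_⟩
    simp only [kerOn]
    by_cases hab : (a, b) ∈ A
    · rw [Set.indicator_of_mem hab, Set.indicator_of_mem (by exact hab), ker_comm]
    · rw [Set.indicator_of_notMem hab, Set.indicator_of_notMem (by exact hab)]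
  refine exists_formBound_of_left (measurable_kerOn α p q hA')
    (C := C * (40 * I)) fun k => ?_
  by_cases hk : 1 ≤ |k.2.1|
  swap
  · have h0 : ∀ k₂, kerOn α p q (Prod.swap ⁻¹' A) k k₂ = 0 := by
      intro k₂
      refine kerOn_of_notMem fun h => hk ?_
      exact h.1.1.trans h.1.2
    simp [h0]
  set S := {ξ : ℝ | 1 ≤ |ξ| ∧ |ξ| ≤ |k.2.1| ∧
    |ξ + k.2.1| * |ξ| * |k.2.1| ^ 3 / 10 ≤ |modulation α k|}
  have hS : MeasurableSet S := by
    exact measurableSet_and (measurableSet_le (by fun_prop) (by fun_prop))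
      (measurableSet_and (measurableSet_le (by fun_prop) (by fun_prop))
        (measurableSet_le (by fun_prop) (by fun_prop)))
  have hk0 : k.2.1 ≠ 0 := by
    intro h
    rw [h, abs_zero] at hk
    linarith
  refine (hC k S _ hA' hS (fun k₁ h => ⟨h.1.1, h.1.2, h.2⟩) hk0).trans ?_
  rw [ENNReal.coe_mul, ENNReal.coe_mul]
  gcongr (C : ℝ≥0∞) * ?_
  rw [← lintegral_const_mul _ (by fun_prop), hI, ← lintegral_const_mul _ (by fun_prop)]
  refine le_trans (setLIntegral_mono (g := fun ξ => ((40 : ℝ≥0) : ℝ≥0∞) * jb (5 / 4) ξ)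
    (by fun_prop) fun ξ hξ => ?_) (setLIntegral_le_lintegral _ _)
  have hb := bracket_pos (modulation α k)
  have hb1 := bracket_pos ξ
  rw [sq_mul_inv_sqrt_eq', jb, jb, ← ENNReal.ofReal_mul (by positivity),
    show ((40 : ℝ≥0) : ℝ≥0∞) = ENNReal.ofReal 40 by simp, ← ENNReal.ofReal_mul (by norm_num)]
  refine ENNReal.ofReal_le_ofReal ?_
  have h := rpow_neg_mul_sqrt_le (q := p) (x := ξ + k.2.1) (hq.trans hpq)
    (one_le_bracket (modulation α k)) rfl hξ.1 hξ.2.1 (hξ.2.2.trans (abs_le_bracket _))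
  -- The fixed frequency is the larger one, so |ξ|² ≤ 4|ξ₂|² for the sum, and the pointwise bound
  -- from the case of a large output modulation can be reused.
  have h2 : √(|k.2.1 + ξ| ^ 5 * |ξ| / |k.2.1|) ≤ 2 * √(|ξ + k.2.1| ^ 3 * |ξ| * |k.2.1|) := by
    rw [show (2 : ℝ) = √(2 ^ 2) by rw [Real.sqrt_sq]; norm_num, ← Real.sqrt_mul (by norm_num),
      add_comm ξ k.2.1]
    refine Real.sqrt_le_sqrt ?_
    rw [div_le_iff₀ (by linarith)]
    have h3 : |k.2.1 + ξ| ≤ 2 * |k.2.1| := by linarith [abs_add_le k.2.1 ξ, hξ.2.1]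
    calc |k.2.1 + ξ| ^ 5 * |ξ| = |k.2.1 + ξ| ^ 3 * |ξ| * |k.2.1 + ξ| ^ 2 := by ring
      _ ≤ |k.2.1 + ξ| ^ 3 * |ξ| * (2 * |k.2.1|) ^ 2 := by gcongr
      _ = _ := by ring
  calc _ ≤ bracket (modulation α k) ^ (-p) * (2 * √(|ξ + k.2.1| ^ 3 * |ξ| * |k.2.1|)) := by gcongr
    _ ≤ _ := by linarith

lemma rpow_neg_mul_sqrt_le' {b p x y z : ℝ} (hp : 1 < p) (hp2 : p ≤ 5 / 4)
    (hx : x = y + z) (hy : 1 ≤ |y|) (hyz : |y| ≤ |z|) (hK : |x| * |y| * |z| ^ 3 / 10 ≤ b) :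
    b ^ (-p) * √(|x| ^ 5 * |z| / |y|) ≤ 10 ^ p * 2 ^ (5 / 2 : ℝ) * |z| ^ (3 - 4 * p) := by
  have hxz : |x| ≤ 2 * |z| := by
    rw [hx]
    linarith [abs_add_le y z]
  rcases eq_or_ne x 0 with h0 | h0
  · rw [h0]
    simp only [abs_zero]
    norm_num
    positivity
  have hX : 0 < |x| := abs_pos.2 h0
  set X := |x|
  set Y := |y|
  set Z := |z|
  have hZ : 1 ≤ Z := hy.trans hyz
  have h1 : b ^ (-p) ≤ (X * Y * Z ^ 3 / 10) ^ (-p) :=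
    Real.rpow_le_rpow_of_nonpos (by positivity) hK (by linarith)
  have h2 : √(X ^ 5 * Z / Y) ≤ X ^ (5 / 2 : ℝ) * Z ^ (1 / 2 : ℝ) := by
    rw [Real.sqrt_le_left (by positivity), mul_pow, ← Real.rpow_natCast (X ^ (5 / 2 : ℝ)),
      ← Real.rpow_natCast (Z ^ (1 / 2 : ℝ)), ← Real.rpow_mul hX.le,
      ← Real.rpow_mul (by linarith)]
    norm_num
    exact div_le_self (by positivity) hy
  have h3 : (X * Y * Z ^ 3 / 10) ^ (-p) ≤ 10 ^ p * (X ^ (-p) * Z ^ (-(3 * p))) := by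
    rw [Real.div_rpow (by positivity) (by norm_num), Real.mul_rpow (by positivity) (by positivity),
      Real.mul_rpow (by positivity) (by positivity), Real.rpow_neg (x := 10) (by norm_num),
      div_inv_eq_mul, mul_comm, ← Real.rpow_natCast Z, ← Real.rpow_mul (by linarith)]
    gcongr
    · calc X ^ (-p) * Y ^ (-p) ≤ X ^ (-p) * 1 := by
            gcongr
            exact Real.rpow_le_one_of_one_le_of_nonpos hy (by linarith)
        _ = _ := mul_one _
    · push_cast
      linarith
  calc b ^ (-p) * √(X ^ 5 * Z / Y)
      ≤ (10 ^ p * (X ^ (-p) * Z ^ (-(3 * p)))) * (X ^ (5 / 2 : ℝ) * Z ^ (1 / 2 : ℝ)) :=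
        mul_le_mul (h1.trans h3) h2 (Real.sqrt_nonneg _) (by positivity)
    _ = 10 ^ p * (X ^ (5 / 2 - p) * Z ^ (1 / 2 - 3 * p)) := by
        rw [show (5 / 2 - p : ℝ) = -p + 5 / 2 by ring, Real.rpow_add hX,
          show (1 / 2 - 3 * p : ℝ) = -(3 * p) + 1 / 2 by ring, Real.rpow_add (by linarith)]
        ring
    _ ≤ 10 ^ p * ((2 * Z) ^ (5 / 2 - p) * Z ^ (1 / 2 - 3 * p)) := by
        gcongr
        linarith
    _ = 10 ^ p * (2 ^ (5 / 2 - p) * Z ^ (3 - 4 * p)) := by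
        rw [Real.mul_rpow (by norm_num) (by linarith), mul_assoc, ← Real.rpow_add (by linarith)]
        congr 3
        ring
    _ ≤ 10 ^ p * (2 ^ (5 / 2 : ℝ) * Z ^ (3 - 4 * p)) := by
        gcongr
        · norm_num
        · linarith
    _ = _ := by ring

/-- The smaller frequency is fixed and ξ₂ is integrated over an unbounded range. The large σ₁ leaves
|ξ₂|^{3 - 4p}, integrable exactly because p > 1. -/
lemma exists_formBound_left_nonresonant (α : ℝ) {p q : ℝ} (hp : 1 < p) (hq : 1 / 2 < q)
    (hpq : q ≤ p) :
    ∃ C : ℝ≥0, FormBound (kerOn α p q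
      (highRegion ∩ {z | resSize z / 10 ≤ |modulation α z.1|})) C := by
  set A := highRegion ∩ {z | resSize z / 10 ≤ |modulation α z.1|}
  have hA : MeasurableSet A := measurableSet_highRegion.inter
    (measurableSet_le (measurable_resSize.div_const _) (by fun_prop))
  obtain ⟨C, hC⟩ := exists_lintegral_left_quadratic_le α hp hq hpq
  -- Capping the exponent keeps 5/2 - p' nonnegative, so that |ξ| may be replaced by 2|ξ₂|, while
  -- 4p' - 3 > 1 still holds.
  set p' := min p (5 / 4) with hp'
  have hp1 : 1 < p' := lt_min hp (by norm_num)
  have hfin := lintegral_jb_lt_top (p := 4 * p' - 3) (by linarith)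
  lift (∫⁻ s, jb (4 * p' - 3) s) to ℝ≥0 using hfin.ne with I hI
  set B : ℝ≥0 := Real.toNNReal (10 ^ p' * 2 ^ (5 / 2 : ℝ) * 2 ^ (4 * p' - 3)) with hB
  refine exists_formBound_of_left (measurable_kerOn α p q hA)
    (C := C * (B * I)) fun k => ?_
  by_cases hk : 1 ≤ |k.2.1|
  swap
  · have h0 : ∀ k₂, kerOn α p q A k k₂ = 0 := fun k₂ => kerOn_of_notMem fun h => hk h.1.1
    simp [h0]
  set S := {ξ : ℝ | |k.2.1| ≤ |ξ| ∧
    |k.2.1 + ξ| * |k.2.1| * |ξ| ^ 3 / 10 ≤ |modulation α k|}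
  have hS : MeasurableSet S := by
    exact measurableSet_and (measurableSet_le (by fun_prop) (by fun_prop))
      (measurableSet_le (by fun_prop) (by fun_prop))
  have hk0 : k.2.1 ≠ 0 := by
    intro h
    rw [h, abs_zero] at hk
    linarith
  refine (hC k S _ hA hS (fun k₁ h => ⟨h.1.2, h.2⟩) hk0).trans ?_
  rw [ENNReal.coe_mul, ENNReal.coe_mul]
  gcongr (C : ℝ≥0∞) * ?_
  rw [← lintegral_const_mul _ (by fun_prop), hI, ← lintegral_const_mul _ (by fun_prop)]
  refine le_trans (setLIntegral_mono (g := fun ξ => (B : ℝ≥0∞) * jb (4 * p' - 3) ξ)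
    (by fun_prop) fun ξ hξ => ?_) (setLIntegral_le_lintegral _ _)
  refine (mul_le_mul_left (jb_le_jb (min_le_left p (5 / 4)) _) _).trans ?_
  have hb := bracket_pos (modulation α k)
  have hb1 := bracket_pos ξ
  have hξ1 : 1 ≤ |ξ| := hk.trans hξ.1
  rw [sq_mul_inv_sqrt_eq', ← hp', jb, jb, ← ENNReal.ofReal_mul (by positivity), hB]
  change _ ≤ ENNReal.ofReal _ * _
  rw [← ENNReal.ofReal_mul (by positivity)]
  refine ENNReal.ofReal_le_ofReal ?_
  refine (rpow_neg_mul_sqrt_le' hp1 (min_le_right _ _) rfl hk hξ.1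
    (hξ.2.trans (abs_le_bracket _))).trans ?_
  rw [mul_assoc _ (2 ^ (4 * p' - 3) : ℝ)]
  gcongr
  have h1 : bracket ξ ≤ 2 * |ξ| := (bracket_le_one_add_abs ξ).trans (by linarith)
  have h2 : (2 * |ξ|) ^ (-(4 * p' - 3)) ≤ bracket ξ ^ (-(4 * p' - 3)) :=
    Real.rpow_le_rpow_of_nonpos hb1 h1 (by linarith)
  rw [Real.mul_rpow (by norm_num) (by linarith), Real.rpow_neg (by norm_num)] at h2
  rw [show 3 - 4 * p' = -(4 * p' - 3) by ring]
  rwa [inv_mul_le_iff₀ (by positivity)] at h2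

/-! ### Interactions of a low and a high frequency -/

/-- The resonance function in the coordinates `μ₁ = ξ₁ (m + ξ₂ κ)`, `μ₂ = ξ₂ (m - ξ₁ κ)`. -/
def res (α a b κ : ℝ) : ℝ := (a + b) * a * b * (5 * (a ^ 2 + a * b + b ^ 2) - 3 * α - κ ^ 2)

/-- These coordinates diagonalize the quadratic part: μ₁²/ξ₁ + μ₂²/ξ₂ = ξ m² + ξ ξ₁ ξ₂ κ² with m =
μ/ξ, so m cancels from the resonance function. -/
lemma omega_sub_sub_eq_res {α a b m κ : ℝ} (_ha : a ≠ 0) (_hb : b ≠ 0) (_hab : a + b ≠ 0) :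
    omega α (a + b) ((a + b) * m) - omega α a (a * (m + b * κ)) - omega α b (b * (m - a * κ)) =
      res α a b κ := by
  unfold omega res
  field_simp
  ring

lemma hasDerivAt_res_sub (α ξ κ z : ℝ) : HasDerivAt (fun z => res α z (ξ - z) κ)
    (ξ * (ξ - 2 * z) * (5 * (z ^ 2 + (ξ - z) ^ 2) - 3 * α - κ ^ 2)) z := by
  have h : (fun z => res α z (ξ - z) κ) = fun z =>
      ξ * ((ξ * z - z ^ 2) * (5 * (ξ ^ 2 - ξ * z + z ^ 2) - 3 * α - κ ^ 2)) := by
    funext z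
    unfold res
    ring
  rw [h]
  have h1 : HasDerivAt (fun z : ℝ => ξ * z - z ^ 2) (ξ - 2 * z) z := by
    refine (((hasDerivAt_id z).const_mul ξ).sub (hasDerivAt_pow 2 z)).congr_deriv ?_
    norm_num
  have h2 : HasDerivAt (fun z : ℝ => 5 * (ξ ^ 2 - ξ * z + z ^ 2) - 3 * α - κ ^ 2)
      (5 * (-ξ + 2 * z)) z := by
    have := ((((hasDerivAt_id z).const_mul ξ).const_sub (ξ ^ 2)).add (hasDerivAt_pow 2 z)).const_mul
      (5 : ℝ) |>.sub_const (3 * α) |>.sub_const (κ ^ 2)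
    simpa using this
  refine ((h1.mul h2).const_mul ξ).congr_deriv ?_
  ring

/-- The κ-derivative of the resonance function is 2|κ| |ξ z (ξ - z)| in size, at least 2ξ² times the
Jacobian |z(ξ - z)|. Each half-line is treated separately, since only there is κ determined by κ².
-/
lemma lintegral_res_large_le (α : ℝ) {p ξ z σ : ℝ} (hξ : 1 ≤ |ξ|) (hz : z ≠ 0) (hz' : ξ - z ≠ 0) :
    ∫⁻ κ in {κ : ℝ | |ξ| ≤ |κ|}, ENNReal.ofReal |z * (ξ - z)| * jb p (σ + res α z (ξ - z) κ) ≤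
      ENNReal.ofReal ((ξ ^ 2)⁻¹) * ∫⁻ s, jb p s := by
  have hξ0 : ξ ≠ 0 := by
    rintro rfl
    simp at hξ
    linarith
  have hone : ∀ s : Set ℝ, MeasurableSet s → (∀ κ ∈ s, |ξ| ≤ |κ|) →
      (∀ κ ∈ s, ∀ κ' ∈ s, κ ^ 2 = κ' ^ 2 → κ = κ') →
      ∫⁻ κ in s, ENNReal.ofReal |z * (ξ - z)| * jb p (σ + res α z (ξ - z) κ) ≤
      ENNReal.ofReal ((2 * ξ ^ 2)⁻¹) * ∫⁻ s, jb p s := by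
    intro s hs hκ hinj
    have hd : ∀ κ ∈ s, HasDerivAt (fun κ => σ + res α z (ξ - z) κ)
        (ξ * z * (ξ - z) * (-(2 * κ))) κ := by
      intro κ _
      have := ((((hasDerivAt_pow 2 κ).const_sub
        (5 * (z ^ 2 + z * (ξ - z) + (ξ - z) ^ 2) - 3 * α)).const_mul
        ((z + (ξ - z)) * z * (ξ - z))).const_add σ)
      refine this.congr_deriv ?_
      norm_num
    have hI : Set.InjOn (fun κ => σ + res α z (ξ - z) κ) s := by
      intro κ h κ' h' e
      refine hinj κ h κ' h' ?_
      have e' : ξ * z * (ξ - z) * (κ ^ 2 - κ' ^ 2) = 0 := by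
        simp only [res] at e
        linear_combination -e
      have : κ ^ 2 - κ' ^ 2 = 0 := by simpa [hξ0, hz, hz'] using e'
      linarith
    have := lintegral_abs_deriv_mul_comp_le hs hd hI (jb p)
    refine le_trans ?_ (mul_le_mul_right this (ENNReal.ofReal ((2 * ξ ^ 2)⁻¹)))
    rw [← lintegral_const_mul' _ _ ENNReal.ofReal_ne_top]
    refine setLIntegral_mono' hs fun κ h => ?_
    rw [← mul_assoc, ← ENNReal.ofReal_mul (by positivity)]
    gcongr
    have hk := hκ κ h
    have hX : 0 < |ξ| := by linarith
    rw [abs_mul, abs_mul, abs_mul, abs_mul, abs_neg, abs_mul, ← sq_abs ξ, inv_mul_eq_div,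
      le_div_iff₀ (by positivity), abs_two]
    calc |z| * |ξ - z| * (2 * |ξ| ^ 2) = |ξ| * |z| * |ξ - z| * (2 * |ξ|) := by ring
      _ ≤ |ξ| * |z| * |ξ - z| * (2 * |κ|) := by gcongr
  have hsplit : {κ : ℝ | |ξ| ≤ |κ|} ⊆ Set.Ici |ξ| ∪ Set.Iic (-|ξ|) := by
    intro κ h
    rcases le_abs.1 (show |ξ| ≤ |κ| from h) with h | h
    · exact Or.inl h
    · exact Or.inr (Set.mem_Iic.2 (by linarith))
  refine (lintegral_mono_set hsplit).trans ((lintegral_union_le _ _ _).trans ?_)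
  have hX : 0 < |ξ| := by linarith
  have e1 := hone (Set.Ici |ξ|) measurableSet_Ici (fun κ h => (Set.mem_Ici.1 h).trans (le_abs_self κ))
    (fun κ h κ' h' e => by
      have h1 : 0 ≤ κ := hX.le.trans h
      have h2 : 0 ≤ κ' := hX.le.trans h'
      exact (sq_eq_sq₀ h1 h2).1 e)
  have e2 := hone (Set.Iic (-|ξ|)) measurableSet_Iic
    (fun κ h => by have := Set.mem_Iic.1 h; exact le_abs.2 (Or.inr (by linarith)))
    (fun κ h κ' h' e => by
      have h1 : 0 ≤ -κ := by have := Set.mem_Iic.1 h; linarith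
      have h2 : 0 ≤ -κ' := by have := Set.mem_Iic.1 h'; linarith
      have := (sq_eq_sq₀ h1 h2).1 (by rw [neg_sq, neg_sq]; exact e)
      linarith)
  refine (add_le_add e1 e2).trans (le_of_eq ?_)
  rw [← add_mul, ← ENNReal.ofReal_add (by positivity) (by positivity)]
  congr 2
  field_simp
  norm_num

/-- For |κ| ≤ |ξ| and |z| ≤ 1 the quintic term dominates κ², so the resonance function increases in
z at rate at least |ξ|⁴/2, whereas the Jacobian is at most 2|ξ|. -/
lemma lintegral_res_small_le {α p ξ κ σ : ℝ} (hξ : 9 + 10 * |α| ≤ |ξ|) (hκ : |κ| ≤ |ξ|) :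
    ∫⁻ z in Set.Icc (-1 : ℝ) 1, ENNReal.ofReal |z * (ξ - z)| * jb p (σ + res α z (ξ - z) κ) ≤
      ENNReal.ofReal (4 * (|ξ| ^ 3)⁻¹) * ∫⁻ s, jb p s := by
  have hα := abs_nonneg α
  have hX : 9 ≤ |ξ| := by linarith
  have hder : ∀ z ∈ Set.Icc (-1 : ℝ) 1, |ξ| ^ 4 / 2 ≤
      ξ * (ξ - 2 * z) * (5 * (z ^ 2 + (ξ - z) ^ 2) - 3 * α - κ ^ 2) := by
    intro z hz
    have hz1 : |z| ≤ 1 := abs_le.2 hz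
    have h1 : |ξ| ^ 2 / 2 ≤ ξ * (ξ - 2 * z) := by
      have : ξ * z ≤ |ξ| * 1 := (le_abs_self _).trans (by rw [abs_mul]; gcongr)
      rw [sq_abs]
      nlinarith [sq_abs ξ]
    have h2 : |ξ| ^ 2 ≤ 5 * (z ^ 2 + (ξ - z) ^ 2) - 3 * α - κ ^ 2 := by
      have h3 : (|ξ| - 1) ^ 2 ≤ (ξ - z) ^ 2 := by
        rw [← sq_abs (ξ - z)]
        have := abs_sub_abs_le_abs_sub ξ z
        exact pow_le_pow_left₀ (by linarith) (by linarith) 2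
      have h4 : κ ^ 2 ≤ |ξ| ^ 2 := by
        rw [← sq_abs κ]
        gcongr
      nlinarith [le_abs_self α, sq_nonneg z]
    calc |ξ| ^ 4 / 2 = |ξ| ^ 2 / 2 * |ξ| ^ 2 := by ring
      _ ≤ _ := mul_le_mul h1 h2 (by positivity) ((by positivity : (0 : ℝ) ≤ |ξ| ^ 2 / 2).trans h1)
  have hd : ∀ z ∈ Set.Icc (-1 : ℝ) 1, HasDerivAt (fun z => σ + res α z (ξ - z) κ)
      (ξ * (ξ - 2 * z) * (5 * (z ^ 2 + (ξ - z) ^ 2) - 3 * α - κ ^ 2)) z :=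
    fun z _ => (hasDerivAt_res_sub α ξ κ z).const_add σ
  have hmono : StrictMonoOn (fun z => σ + res α z (ξ - z) κ) (Set.Icc (-1 : ℝ) 1) := by
    refine strictMonoOn_of_deriv_pos (convex_Icc _ _)
      (fun z hz => (hd z hz).continuousAt.continuousWithinAt) fun z hz => ?_
    have hz' := interior_subset hz
    rw [(hd z hz').deriv]
    exact lt_of_lt_of_le (by positivity) (hder z hz')
  have := lintegral_abs_deriv_mul_comp_le measurableSet_Icc hd hmono.injOn (jb p)
  refine le_trans ?_ (mul_le_mul_right this (ENNReal.ofReal (4 * (|ξ| ^ 3)⁻¹)))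
  rw [← lintegral_const_mul' _ _ ENNReal.ofReal_ne_top]
  refine setLIntegral_mono' measurableSet_Icc fun z hz => ?_
  rw [← mul_assoc, ← ENNReal.ofReal_mul (by positivity)]
  gcongr
  have h1 := (hder z hz).trans (le_abs_self _)
  have hz1 : |z| ≤ 1 := abs_le.2 hz
  have h2 : |z * (ξ - z)| ≤ 2 * |ξ| := by
    rw [abs_mul]
    have := abs_sub ξ z
    calc |z| * |ξ - z| ≤ 1 * (2 * |ξ|) := by gcongr; linarith
      _ = _ := one_mul _
  calc |z * (ξ - z)| ≤ 2 * |ξ| := h2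
    _ = 4 * (|ξ| ^ 3)⁻¹ * (|ξ| ^ 4 / 2) := by field_simp; norm_num
    _ ≤ _ := by gcongr

/-- Both ranges of κ give O(ξ^{-2}), which cancels the derivative loss ξ². The constant is 2 from
|κ| ≥ |ξ| (z has range 2) plus 8 from |κ| < |ξ| (κ has range 2|ξ|). -/
lemma lintegral_lowHigh_le {α p : ℝ} {k : Freq} (hξ : 9 + 10 * |α| ≤ |k.2.1|) :
    ENNReal.ofReal (k.2.1 ^ 2) * ∫⁻ ξ in Set.Icc (-1 : ℝ) 1, ∫⁻ μ,
      jb p (k.1 - omega α ξ μ - omega α (k.2.1 - ξ) (k.2.2 - μ)) ≤ 10 * ∫⁻ s, jb p s := by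
  obtain ⟨τ, ξ, μ₀⟩ := k
  simp only at hξ ⊢
  have hα := abs_nonneg α
  have hX : 0 < |ξ| := by linarith
  have hξ0 : ξ ≠ 0 := abs_pos.1 hX
  set I := ∫⁻ s, jb p s
  set σ := τ - omega α ξ μ₀
  have hcoord : ∫⁻ z in Set.Icc (-1 : ℝ) 1, ∫⁻ μ,
      jb p (τ - omega α z μ - omega α (ξ - z) (μ₀ - μ)) =
      ∫⁻ z in Set.Icc (-1 : ℝ) 1, ∫⁻ κ,
        ENNReal.ofReal |z * (ξ - z)| * jb p (σ + res α z (ξ - z) κ) := by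
    refine lintegral_congr_ae ?_
    filter_upwards [ae_restrict_of_ae (ae_ne_real 0), ae_restrict_of_ae (ae_ne_real ξ)]
      with z hz0 hz
    have hz' : ξ - z ≠ 0 := sub_ne_zero.2 hz.symm
    rw [lintegral_comp_affine _ (mul_ne_zero hz0 hz') (z * (μ₀ / ξ)),
      ← lintegral_const_mul' _ _ ENNReal.ofReal_ne_top]
    refine lintegral_congr fun κ => ?_
    congr 2
    have h := omega_sub_sub_eq_res (α := α) (m := μ₀ / ξ) (κ := κ) hz0 hz'
      (by rwa [add_sub_cancel])
    rw [← h, add_sub_cancel, mul_div_cancel₀ _ hξ0]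
    simp only [σ]
    have e1 : z * (ξ - z) * κ + z * (μ₀ / ξ) = z * (μ₀ / ξ + (ξ - z) * κ) := by ring
    have e2 : μ₀ - z * (μ₀ / ξ + (ξ - z) * κ) = (ξ - z) * (μ₀ / ξ - z * κ) := by
      field_simp
      ring
    rw [e1, e2]
    ring
  rw [hcoord]
  have hm : Measurable fun x : ℝ × ℝ =>
      ENNReal.ofReal |x.1 * (ξ - x.1)| * jb p (σ + res α x.1 (ξ - x.1) x.2) := by
    unfold res
    fun_prop
  have hlarge : ∫⁻ z in Set.Icc (-1 : ℝ) 1, ∫⁻ κ in {κ : ℝ | |ξ| ≤ |κ|},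
      ENNReal.ofReal |z * (ξ - z)| * jb p (σ + res α z (ξ - z) κ) ≤
      ENNReal.ofReal ((ξ ^ 2)⁻¹) * I * 2 := by
    calc _ ≤ ∫⁻ z in Set.Icc (-1 : ℝ) 1, ENNReal.ofReal ((ξ ^ 2)⁻¹) * I := by
          refine lintegral_mono_ae ?_
          filter_upwards [ae_restrict_of_ae (ae_ne_real 0), ae_restrict_of_ae (ae_ne_real ξ)]
            with z hz0 hz
          exact lintegral_res_large_le α (by linarith) hz0 (sub_ne_zero.2 hz.symm)
      _ = _ := by
          rw [setLIntegral_const, Real.volume_Icc]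
          norm_num
  have hsmall : ∫⁻ z in Set.Icc (-1 : ℝ) 1, ∫⁻ κ in {κ : ℝ | |κ| < |ξ|},
      ENNReal.ofReal |z * (ξ - z)| * jb p (σ + res α z (ξ - z) κ) ≤
      ENNReal.ofReal (8 * (ξ ^ 2)⁻¹) * I := by
    rw [lintegral_lintegral_swap hm.aemeasurable]
    have hms : MeasurableSet {κ : ℝ | |κ| < |ξ|} := measurableSet_lt (by fun_prop) (by fun_prop)
    calc _ ≤ ∫⁻ κ in {κ : ℝ | |κ| < |ξ|}, ENNReal.ofReal (4 * (|ξ| ^ 3)⁻¹) * I :=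
          setLIntegral_mono' hms fun κ hκ => lintegral_res_small_le hξ (le_of_lt hκ)
      _ ≤ ENNReal.ofReal (4 * (|ξ| ^ 3)⁻¹) * I * ENNReal.ofReal (2 * |ξ|) := by
          rw [setLIntegral_const]
          gcongr
          refine (measure_mono (t := Set.Icc (-|ξ|) |ξ|) fun κ hκ =>
            abs_le.1 (le_of_lt hκ)).trans ?_
          rw [Real.volume_Icc]
          exact ENNReal.ofReal_le_ofReal (by linarith)
      _ = _ := by
          rw [mul_right_comm, ← ENNReal.ofReal_mul (by positivity)]
          congr 2
          rw [← sq_abs ξ]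
          field_simp
          norm_num
  have hms : MeasurableSet {κ : ℝ | |ξ| ≤ |κ|} := measurableSet_le (by fun_prop) (by fun_prop)
  have hcompl : {κ : ℝ | |ξ| ≤ |κ|}ᶜ = {κ : ℝ | |κ| < |ξ|} := by
    ext κ
    simp
  have hsplit : ∫⁻ z in Set.Icc (-1 : ℝ) 1, ∫⁻ κ,
        ENNReal.ofReal |z * (ξ - z)| * jb p (σ + res α z (ξ - z) κ) ≤
      ENNReal.ofReal ((ξ ^ 2)⁻¹) * I * 2 + ENNReal.ofReal (8 * (ξ ^ 2)⁻¹) * I := by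
    refine le_trans (le_of_eq ?_) (add_le_add hlarge hsmall)
    rw [← lintegral_add_left]
    · refine lintegral_congr fun z => ?_
      rw [← hcompl, lintegral_add_compl _ hms]
    · exact Measurable.lintegral_prod_right' hm
  calc _ ≤ ENNReal.ofReal (ξ ^ 2) * (ENNReal.ofReal ((ξ ^ 2)⁻¹) * I * 2 +
        ENNReal.ofReal (8 * (ξ ^ 2)⁻¹) * I) := by gcongr
    _ = (ENNReal.ofReal (ξ ^ 2) * ENNReal.ofReal ((ξ ^ 2)⁻¹)) * (10 * I) := by
        rw [ENNReal.ofReal_mul (by norm_num)]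
        norm_num
        ring
    _ = _ := by
        rw [← ENNReal.ofReal_mul (by positivity), mul_inv_cancel₀ (by positivity)]
        simp

lemma exists_formBound_lowHigh (α : ℝ) {p q : ℝ} (hp : 1 < p) (hq : 0 ≤ q) :
    ∃ C : ℝ≥0, FormBound (kerOn α p q
      {z | |z.1.2.1| ≤ 1 ∧ 10 + 10 * |α| ≤ |z.2.2.1|}) C := by
  have hA : MeasurableSet {z : Freq × Freq | |z.1.2.1| ≤ 1 ∧ 10 + 10 * |α| ≤ |z.2.2.1|} :=
    measurableSet_and (measurableSet_le (by fun_prop) (by fun_prop))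
      (measurableSet_le (by fun_prop) (by fun_prop))
  obtain ⟨C, hC⟩ := exists_lintegral_sum_le α (q := q) hp
  have hfin := lintegral_jb_lt_top hp
  have hlh := fun k hξ => lintegral_lowHigh_le (α := α) (p := p) (k := k) hξ
  lift (∫⁻ s, jb p s) to ℝ≥0 using hfin.ne with I hI
  refine exists_formBound_of_sum (measurable_kerOn α p q hA) (C := C * (10 * I)) fun k => ?_
  by_cases hξ : 9 + 10 * |α| ≤ |k.2.1|
  · refine (hC k (Set.Icc (-1) 1) _ hA measurableSet_Icc fun k₁ h => abs_le.1 h.1).trans ?_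
    rw [ENNReal.coe_mul, ENNReal.coe_mul]
    gcongr (C : ℝ≥0∞) * ?_
    refine le_trans ?_ (hlh k hξ)
    gcongr
    calc _ ≤ ENNReal.ofReal (k.2.1 ^ 2) * 1 := by gcongr; exact jb_le_one hq _
      _ = _ := mul_one _
  · have h0 : ∀ k₁, kerOn α p q {z | |z.1.2.1| ≤ 1 ∧ 10 + 10 * |α| ≤ |z.2.2.1|} k₁ (k - k₁) = 0 := by
      intro k₁
      -- As |ξ₁| ≤ 1, a second frequency above 10 + 10|α| forces the total frequency above 9 +
      -- 10|α|.
      refine kerOn_of_notMem fun h => hξ ?_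
      have h1 : |k₁.2.1| ≤ 1 := h.1
      have h2 : 10 + 10 * |α| ≤ |k.2.1 - k₁.2.1| := h.2
      linarith [abs_sub k.2.1 k₁.2.1]
    simp [h0]

/-! ### The resonance function along a curve of resonant interactions -/

/-- The value of `κ²` determined by the resonance function `ρ`, for `ξ₁ = ξ - x`, `ξ₂ = x`. -/
def curveSq (α ξ ρ x : ℝ) : ℝ :=
  5 * (ξ ^ 2 - ξ * x + x ^ 2) - 3 * α - ρ / (ξ * (ξ - x) * x)

/-- The slope `μ₂ / ξ₂` along the curve of interactions with `μ / ξ = m` and resonance `ρ`. -/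
def curveSlope (α ξ m ρ x : ℝ) : ℝ := m - (ξ - x) * √(curveSq α ξ ρ x)

/-- The resonance function of a fixed frequency `(a, a M)` with the point `x` of the curve. -/
def curveRes (α ξ m ρ a M x : ℝ) : ℝ :=
  res α a x ((M - curveSlope α ξ m ρ x) / (a + x))

/-- The quantity `B` with `d(μ₂ / ξ₂) / dx = B / (2 κ x)`. -/
def curveB (α ξ ρ x : ℝ) : ℝ :=
  (2 * x - ξ) * (5 * (x ^ 2 + (ξ - x) ^ 2) - 3 * α) + ξ * curveSq α ξ ρ x

lemma hasDerivAt_curveSq {α ξ ρ x : ℝ} (hξ : ξ ≠ 0) (hx : x ≠ 0) (hξx : ξ - x ≠ 0) :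
    HasDerivAt (curveSq α ξ ρ)
      (5 * (2 * x - ξ) - ρ * (2 * x - ξ) / (ξ * ((ξ - x) * x) ^ 2)) x := by
  have h1 : HasDerivAt (fun x : ℝ => 5 * (ξ ^ 2 - ξ * x + x ^ 2) - 3 * α) (5 * (-ξ + 2 * x)) x := by
    refine (((((hasDerivAt_id x).const_mul ξ).const_sub (ξ ^ 2)).add
      (hasDerivAt_pow 2 x)).const_mul (5 : ℝ) |>.sub_const (3 * α)).congr_deriv ?_
    norm_num
  have h2 : HasDerivAt (fun x : ℝ => ξ * (ξ - x) * x) (ξ * (-1) * x + ξ * (ξ - x) * 1) x :=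
    (((hasDerivAt_id x).const_sub ξ).const_mul ξ).mul (hasDerivAt_id x)
  have h3 := (hasDerivAt_const x ρ).div h2 (by positivity)
  refine (h1.sub h3).congr_deriv ?_
  field_simp
  ring

lemma hasDerivAt_curveSlope {α ξ m ρ x : ℝ} (hξ : ξ ≠ 0) (hx : x ≠ 0) (hξx : ξ - x ≠ 0)
    (hG : 0 < curveSq α ξ ρ x) :
    HasDerivAt (curveSlope α ξ m ρ)
      (curveB α ξ ρ x / (2 * √(curveSq α ξ ρ x) * x)) x := by
  have h1 := (hasDerivAt_curveSq (α := α) (ρ := ρ) hξ hx hξx).sqrt hG.ne'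
  have h2 := (((hasDerivAt_id x).const_sub ξ).mul h1).const_sub m
  refine h2.congr_deriv ?_
  have hs : 0 < √(curveSq α ξ ρ x) := Real.sqrt_pos.2 hG
  have hs2 : √(curveSq α ξ ρ x) ^ 2 = curveSq α ξ ρ x := Real.sq_sqrt hG.le
  have hρ : ρ / (ξ * (ξ - x) * x) = 5 * (ξ ^ 2 - ξ * x + x ^ 2) - 3 * α - curveSq α ξ ρ x := by
    unfold curveSq
    ring
  have h3 : ρ * (2 * x - ξ) / (ξ * ((ξ - x) * x) ^ 2) =
      (5 * (ξ ^ 2 - ξ * x + x ^ 2) - 3 * α - curveSq α ξ ρ x) * (2 * x - ξ) / ((ξ - x) * x) := by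
    rw [← hρ]
    field_simp
  rw [h3]
  unfold curveB
  simp only [id]
  set κ := √(curveSq α ξ ρ x)
  rw [← hs2]
  field_simp
  ring

lemma hasDerivAt_curveRes {α ξ m ρ a M x : ℝ} (hξ : ξ ≠ 0) (hx : x ≠ 0) (hξx : ξ - x ≠ 0)
    (hax : a + x ≠ 0) (hG : 0 < curveSq α ξ ρ x) :
    HasDerivAt (curveRes α ξ m ρ a M)
      (a * ((2 * x + a) * (5 * ((a + x) ^ 2 + x ^ 2) - 3 * α) -
        a * ((M - curveSlope α ξ m ρ x) / (a + x)) ^ 2 +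
        (M - curveSlope α ξ m ρ x) / (a + x) * curveB α ξ ρ x / √(curveSq α ξ ρ x))) x := by
  have h1 := (hasDerivAt_curveSlope (m := m) hξ hx hξx hG).const_sub M
  have h2 : HasDerivAt (fun x : ℝ => a + x) 1 x := (hasDerivAt_id x).const_add a
  have h3 := (h1.div h2 hax).pow 2
  have h4 : HasDerivAt (fun x : ℝ => 5 * (a ^ 2 + a * x + x ^ 2) - 3 * α) (5 * (a + 2 * x)) x := by
    refine (((((hasDerivAt_id x).const_mul a).const_add (a ^ 2)).add
      (hasDerivAt_pow 2 x)).const_mul (5 : ℝ) |>.sub_const (3 * α)).congr_deriv ?_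
    norm_num
  have h5 := ((h2.mul_const a).mul (hasDerivAt_id x)).mul (h4.sub h3)
  refine h5.congr_deriv ?_
  have hs : 0 < √(curveSq α ξ ρ x) := Real.sqrt_pos.2 hG
  simp only [id, Pi.div_apply, Pi.sub_apply, Pi.pow_apply, Pi.mul_apply]
  set κ := √(curveSq α ξ ρ x)
  set D := M - curveSlope α ξ m ρ x
  push_cast
  field_simp
  ring

/-- The part of the curve on which `ξ₁ = ξ - x` has the sign of `s`. -/
def curveDom (α ξ ρ a s : ℝ) : Set ℝ :=
  {x | 10 + 10 * |α| ≤ x ∧ ξ ≤ 2 * x ∧ |a| ≤ x ∧ 0 < a + x ∧ 0 < s * (ξ - x) ∧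
    0 < curveSq α ξ ρ x}

/-- The part of the curve on which the interaction with `(a, a M)` is nearly resonant. -/
def curveSet (α ξ m ρ a M s : ℝ) : Set ℝ :=
  {x | x ∈ curveDom α ξ ρ a s ∧ 0 ≤ M - curveSlope α ξ m ρ x ∧
    M - curveSlope α ξ m ρ x ≤ 4 * x * (a + x)}

lemma three_mul_le_sq {α x : ℝ} (hx : 10 + 10 * |α| ≤ x) : 3 * α ≤ x ^ 2 / 3 := by
  nlinarith [le_abs_self α, abs_nonneg α]

/-- Beyond the midpoint ξ/2 the factor ξ - 2x is nonpositive, and the other factors are nonnegative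
once x dominates α. This is what keeps the domain of the curve connected. -/
lemma antitoneOn_res {α ξ : ℝ} (hξ : 0 < ξ) :
    AntitoneOn (fun x => res α x (ξ - x) 0) {x | 10 + 10 * |α| ≤ x ∧ ξ ≤ 2 * x} := by
  have hconv : Convex ℝ {x : ℝ | 10 + 10 * |α| ≤ x ∧ ξ ≤ 2 * x} := by
    refine Set.OrdConnected.convex ⟨fun x hx y _ z hz => ⟨hx.1.trans hz.1, hx.2.trans ?_⟩⟩
    linarith [hz.1]
  refine antitoneOn_of_deriv_nonpos hconv
    (fun x _ => (hasDerivAt_res_sub α ξ 0 x).continuousAt.continuousWithinAt)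
    (fun x _ => (hasDerivAt_res_sub α ξ 0 x).differentiableAt.differentiableWithinAt) fun x hx => ?_
  have hx' := interior_subset hx
  rw [(hasDerivAt_res_sub α ξ 0 x).deriv]
  have h1 := three_mul_le_sq hx'.1
  have h2 : 0 ≤ 5 * (x ^ 2 + (ξ - x) ^ 2) - 3 * α - 0 ^ 2 := by nlinarith [sq_nonneg (ξ - x)]
  exact mul_nonpos_of_nonpos_of_nonneg
    (mul_nonpos_of_nonneg_of_nonpos hξ.le (by linarith [hx'.2])) h2

lemma res_sub_eq_curveSq {α ξ ρ x : ℝ} (hξ : ξ ≠ 0) (hx : x ≠ 0) (hξx : ξ - x ≠ 0) :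
    res α x (ξ - x) 0 - ρ = ξ * (ξ - x) * x * curveSq α ξ ρ x := by
  unfold res curveSq
  field_simp
  ring

/-- Only the positivity of κ² needs an argument. It says that `res α x (ξ - x) 0` - ρ has the sign
of ξ - x; this difference is antitone in x, so for s = 1 positivity passes from the right endpoint,
and for s = -1 negativity passes from the left one. -/
lemma ordConnected_curveDom {α ξ ρ a s : ℝ} (hξ : 0 < ξ) (hs : s = 1 ∨ s = -1) :
    (curveDom α ξ ρ a s).OrdConnected := by
  refine ⟨fun x hx y hy z hz => ?_⟩
  obtain ⟨hx1, hx2, hx3, hx4, hx5, hx6⟩ := hx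
  obtain ⟨hy1, hy2, hy3, hy4, hy5, hy6⟩ := hy
  have h1 : 10 + 10 * |α| ≤ z := hx1.trans hz.1
  have h2 : ξ ≤ 2 * z := by linarith [hz.1]
  have hα := abs_nonneg α
  refine ⟨h1, h2, hx3.trans hz.1, by linarith [hz.1], ?_, ?_⟩
  · rcases hs with rfl | rfl <;> linarith [hz.1, hz.2]
  rcases hs with rfl | rfl
  · have hy0 : 0 < ξ - y := by linarith
    have hz0 : 0 < ξ - z := by linarith [hz.2]
    have ha := antitoneOn_res (α := α) hξ ⟨h1, h2⟩ ⟨hy1, hy2⟩ hz.2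
    have ey := res_sub_eq_curveSq (α := α) (ρ := ρ) hξ.ne' (by linarith : y ≠ 0) hy0.ne'
    have ez := res_sub_eq_curveSq (α := α) (ρ := ρ) hξ.ne' (by linarith : z ≠ 0) hz0.ne'
    have hpy : 0 < ξ * (ξ - y) * y * curveSq α ξ ρ y := by
      have : 0 < y := by linarith
      positivity
    have hpz : 0 < ξ * (ξ - z) * z * curveSq α ξ ρ z := by
      simp only at ha
      linarith
    have : 0 < z := by linarith
    exact (mul_pos_iff_of_pos_left (by positivity)).1 hpz
  · have hx0 : 0 < x - ξ := by linarith
    have hz0 : 0 < z - ξ := by linarith [hz.1]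
    have ha := antitoneOn_res (α := α) hξ ⟨hx1, hx2⟩ ⟨h1, h2⟩ hz.1
    have ex := res_sub_eq_curveSq (α := α) (ρ := ρ) hξ.ne' (by linarith : x ≠ 0)
      (by linarith : ξ - x ≠ 0)
    have ez := res_sub_eq_curveSq (α := α) (ρ := ρ) hξ.ne' (by linarith : z ≠ 0)
      (by linarith : ξ - z ≠ 0)
    have hpx : 0 < ξ * (x - ξ) * x * curveSq α ξ ρ x := by
      have : 0 < x := by linarith
      positivity
    have hpz : 0 < ξ * (z - ξ) * z * curveSq α ξ ρ z := by
      simp only at ha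
      linarith
    have : 0 < z := by linarith
    exact (mul_pos_iff_of_pos_left (by positivity)).1 hpz

lemma curveDom_sub_ne_zero {α ξ ρ a s x : ℝ} (hx : x ∈ curveDom α ξ ρ a s) : ξ - x ≠ 0 := by
  intro h
  have := hx.2.2.2.2.1
  rw [h] at this
  linarith

lemma curveB_nonneg {α ξ ρ a s x : ℝ} (hξ : 0 < ξ) (hx : x ∈ curveDom α ξ ρ a s) :
    0 ≤ curveB α ξ ρ x := by
  have h1 := three_mul_le_sq hx.1
  have h2 : 0 ≤ 5 * (x ^ 2 + (ξ - x) ^ 2) - 3 * α := by nlinarith [sq_nonneg (ξ - x)]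
  have h3 : 0 ≤ 2 * x - ξ := by linarith [hx.2.1]
  have h4 := hx.2.2.2.2.2
  unfold curveB
  positivity

lemma curveDom_pos {α ξ ρ a s x : ℝ} (hx : x ∈ curveDom α ξ ρ a s) : 0 < x := by
  linarith [hx.1, abs_nonneg α]

/-- Because x ≥ ξ/2 and x dominates α, both terms of `curveB` are nonnegative. -/
lemma monotoneOn_curveSlope {α ξ m ρ a s : ℝ} (hξ : 0 < ξ) (hs : s = 1 ∨ s = -1) :
    MonotoneOn (curveSlope α ξ m ρ) (curveDom α ξ ρ a s) := by
  have hd : ∀ x ∈ curveDom α ξ ρ a s, HasDerivAt (curveSlope α ξ m ρ)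
      (curveB α ξ ρ x / (2 * √(curveSq α ξ ρ x) * x)) x := fun x hx =>
    hasDerivAt_curveSlope hξ.ne' (curveDom_pos hx).ne' (curveDom_sub_ne_zero hx) hx.2.2.2.2.2
  refine monotoneOn_of_deriv_nonneg (ordConnected_curveDom hξ hs).convex
    (fun x hx => (hd x hx).continuousAt.continuousWithinAt)
    (fun x hx => (hd x (interior_subset hx)).differentiableAt.differentiableWithinAt) fun x hx => ?_
  have hx' := interior_subset hx
  rw [(hd x hx').deriv]
  have h1 := curveB_nonneg hξ hx'
  have h2 := curveDom_pos hx'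
  positivity

/-- M minus the slope decreases along the curve and 4x(a + x) increases, so the lower constraint is
inherited from the right endpoint and the upper one from the left. -/
lemma ordConnected_curveSet {α ξ m ρ a M s : ℝ} (hξ : 0 < ξ) (hs : s = 1 ∨ s = -1) :
    (curveSet α ξ m ρ a M s).OrdConnected := by
  refine ⟨fun x hx y hy z hz => ?_⟩
  have hzD := (ordConnected_curveDom hξ hs).out hx.1 hy.1 hz
  have h1 := monotoneOn_curveSlope (m := m) hξ hs hx.1 hzD hz.1
  have h2 := monotoneOn_curveSlope (m := m) hξ hs hzD hy.1 hz.2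
  refine ⟨hzD, by linarith [hy.2.1], ?_⟩
  have h3 := hx.2.2
  have h4 := curveDom_pos hx.1
  have h5 := hx.1.2.2.2.1
  have h6 : x * (a + x) ≤ z * (a + z) :=
    mul_le_mul hz.1 (by linarith [hz.1]) h5.le (h4.le.trans hz.1)
  linarith

/-- The quotient is the coordinate κ of the fixed frequency with the moving point. Being
nonnegative, it makes the contribution of the increasing slope harmless; being at most 4x, it cannot
let -aκ² cancel the leading term. -/
lemma pow_three_le_curveRes_deriv {α ξ m ρ a M s x : ℝ} (hξ : 0 < ξ)
    (hx : x ∈ curveSet α ξ m ρ a M s) :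
    x ^ 3 ≤ (2 * x + a) * (5 * ((a + x) ^ 2 + x ^ 2) - 3 * α) -
        a * ((M - curveSlope α ξ m ρ x) / (a + x)) ^ 2 +
        (M - curveSlope α ξ m ρ x) / (a + x) * curveB α ξ ρ x / √(curveSq α ξ ρ x) := by
  have hx0 := curveDom_pos hx.1
  have h1 := three_mul_le_sq hx.1.1
  have hB := curveB_nonneg hξ hx.1
  have hax := hx.1.2.2.2.1
  have hκ0 : 0 ≤ (M - curveSlope α ξ m ρ x) / (a + x) := div_nonneg hx.2.1 hax.le
  have hκ1 : (M - curveSlope α ξ m ρ x) / (a + x) ≤ 4 * x := by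
    rw [div_le_iff₀ hax]
    exact hx.2.2
  set κ := (M - curveSlope α ξ m ρ x) / (a + x)
  have h2 : 0 ≤ κ * curveB α ξ ρ x / √(curveSq α ξ ρ x) := by positivity
  have ha := abs_le.1 hx.1.2.2.1
  have h3 : κ ^ 2 ≤ 16 * x ^ 2 := by nlinarith
  have h4 : x ^ 3 ≤ (2 * x + a) * (5 * ((a + x) ^ 2 + x ^ 2) - 3 * α) - a * κ ^ 2 := by
    -- For a ≥ 0 the leading product is at least 18x³ and aκ² at most 16x³. For a ≤ 0 the term -aκ²
    -- has the good sign and 2x + a ≥ x.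
    rcases le_total 0 a with h | h
    · have h5 : a * κ ^ 2 ≤ x * (16 * x ^ 2) := by gcongr; exact ha.2
      have h6 : 2 * x * (9 * x ^ 2) ≤ (2 * x + a) * (5 * ((a + x) ^ 2 + x ^ 2) - 3 * α) := by
        gcongr
        · linarith
        · nlinarith
      nlinarith [pow_pos hx0 3]
    · have h5 : 0 ≤ -a * κ ^ 2 := by
        have : 0 ≤ -a := by linarith
        positivity
      have h6 : x * (x ^ 2) ≤ (2 * x + a) * (5 * ((a + x) ^ 2 + x ^ 2) - 3 * α) :=
        mul_le_mul (by linarith [ha.1]) (by nlinarith [sq_nonneg (a + x)]) (by positivity)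
          (by linarith)
      nlinarith
  linarith

lemma measurable_curveSq {X : Type*} [MeasurableSpace X] {α : ℝ} {f g h : X → ℝ}
    (hf : Measurable f) (hg : Measurable g) (hh : Measurable h) :
    Measurable fun x => curveSq α (f x) (g x) (h x) := by
  unfold curveSq
  fun_prop

lemma measurableSet_curveSet {α ξ m ρ a M s : ℝ} : MeasurableSet (curveSet α ξ m ρ a M s) := by
  have hG : Measurable (curveSq α ξ ρ) :=
    measurable_curveSq measurable_const measurable_const measurable_id
  have hS : Measurable (curveSlope α ξ m ρ) := by
    unfold curveSlope
    fun_prop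
  refine measurableSet_and (measurableSet_and ?_ (measurableSet_and ?_ (measurableSet_and ?_
    (measurableSet_and ?_ (measurableSet_and ?_ ?_))))) (measurableSet_and ?_ ?_)
  · exact measurableSet_le (by fun_prop) (by fun_prop)
  · exact measurableSet_le (by fun_prop) (by fun_prop)
  · exact measurableSet_le (by fun_prop) (by fun_prop)
  · exact measurableSet_lt (by fun_prop) (by fun_prop)
  · exact measurableSet_lt (by fun_prop) (by fun_prop)
  · exact measurableSet_lt (by fun_prop) (by fun_prop)
  · exact measurableSet_le (by fun_prop) (by fun_prop)
  · exact measurableSet_le (by fun_prop) (by fun_prop)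

/-- The resonance function of the fixed frequency is an admissible variable along the curve: its
derivative has constant sign on an interval, and size at least |a| x³ ≥ x³. -/
lemma lintegral_curveSet_le {α p ξ m ρ ρ₀ a M s : ℝ} (hξ : 0 < ξ) (ha : 1 ≤ |a|)
    (hs : s = 1 ∨ s = -1) :
    ∫⁻ x in curveSet α ξ m ρ a M s,
      ENNReal.ofReal (x ^ 3) * jb p (ρ₀ - curveRes α ξ m ρ a M x) ≤ ∫⁻ y, jb p y := by
  set E : ℝ → ℝ := fun x => (2 * x + a) * (5 * ((a + x) ^ 2 + x ^ 2) - 3 * α) -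
        a * ((M - curveSlope α ξ m ρ x) / (a + x)) ^ 2 +
        (M - curveSlope α ξ m ρ x) / (a + x) * curveB α ξ ρ x / √(curveSq α ξ ρ x)
  have hd : ∀ x ∈ curveSet α ξ m ρ a M s,
      HasDerivAt (curveRes α ξ m ρ a M) (a * E x) x := fun x hx =>
    hasDerivAt_curveRes hξ.ne' (curveDom_pos hx.1).ne' (curveDom_sub_ne_zero hx.1)
      hx.1.2.2.2.1.ne' hx.1.2.2.2.2.2
  have hE : ∀ x ∈ curveSet α ξ m ρ a M s, x ^ 3 ≤ E x := fun x hx =>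
    pow_three_le_curveRes_deriv hξ hx
  have ha0 : a ≠ 0 := by
    rintro rfl
    simp at ha
    linarith
  -- The extra factor a turns the derivative into a² times a positive quantity, whatever the sign of
  -- a.
  have hmono : StrictMonoOn (fun x => a * curveRes α ξ m ρ a M x) (curveSet α ξ m ρ a M s) := by
    refine strictMonoOn_of_deriv_pos (ordConnected_curveSet hξ hs).convex
      (fun x hx => ((hd x hx).const_mul a).continuousAt.continuousWithinAt) fun x hx => ?_
    have hx' := interior_subset hx
    rw [((hd x hx').const_mul a).deriv]
    have h1 : 0 < x ^ 3 := pow_pos (curveDom_pos hx'.1) 3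
    have h2 : 0 < E x := h1.trans_le (hE x hx')
    have h3 : 0 < a * a := mul_self_pos.2 ha0
    nlinarith [mul_pos h3 h2]
  have hinj : Set.InjOn (curveRes α ξ m ρ a M) (curveSet α ξ m ρ a M s) := by
    intro x hx y hy h
    exact hmono.injOn hx hy (by simp only [h])
  have h := lintegral_abs_deriv_mul_comp_le measurableSet_curveSet hd hinj
    (fun y => jb p (ρ₀ - y))
  rw [lintegral_sub_left_eq_self (μ := (volume : Measure ℝ)) (jb p) ρ₀] at h
  refine le_trans (setLIntegral_mono' measurableSet_curveSet fun x hx => ?_) h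
  gcongr
  have h1 : 0 < x ^ 3 := pow_pos (curveDom_pos hx.1) 3
  have h2 := hE x hx
  rw [abs_mul]
  calc x ^ 3 ≤ 1 * |E x| := by rw [one_mul]; exact h2.trans (le_abs_self _)
    _ ≤ |a| * |E x| := by gcongr

/-! ### Resonant interactions at fixed modulations -/

/-- The resonance function `ω(ζ₁ + ζ₂) - ω(ζ₁) - ω(ζ₂)`. -/
def resPair (α : ℝ) (u v : ℝ × ℝ) : ℝ :=
  omega α (u.1 + v.1) (u.2 + v.2) - omega α u.1 u.2 - omega α v.1 v.2

/-- The coordinate `κ = (μ₁ / ξ₁ - μ₂ / ξ₂) / (ξ₁ + ξ₂)`. -/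
def kap (u v : ℝ × ℝ) : ℝ := (u.2 / u.1 - v.2 / v.1) / (u.1 + v.1)

/-- Resonant pairs, for `ξ₂ > 0` and `κ > 0`, when `σ₁ + σ₂ = ρ₀`. -/
def resonantPlane (α ρ₀ : ℝ) : Set ((ℝ × ℝ) × (ℝ × ℝ)) :=
  {z | 1 ≤ |z.1.1| ∧ |z.1.1| ≤ z.2.1 ∧ 10 + 10 * |α| ≤ z.2.1 ∧ 0 < z.1.1 + z.2.1 ∧
    0 < kap z.1 z.2 ∧
    |resPair α z.1 z.2| ≤ 3 / 10 * ((z.1.1 + z.2.1) * |z.1.1| * z.2.1 ^ 3) ∧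
    |ρ₀ - resPair α z.1 z.2| ≤ (z.1.1 + z.2.1) * |z.1.1| * z.2.1 ^ 3 / 10}

lemma measurable_resPair (α : ℝ) :
    Measurable fun z : (ℝ × ℝ) × (ℝ × ℝ) => resPair α z.1 z.2 := by
  unfold resPair
  fun_prop

lemma measurableSet_resonantPlane (α ρ₀ : ℝ) : MeasurableSet (resonantPlane α ρ₀) := by
  have h1 := measurable_resPair α
  have h2 : Measurable fun z : (ℝ × ℝ) × (ℝ × ℝ) => kap z.1 z.2 := by
    unfold kap
    fun_prop
  refine measurableSet_and ?_ (measurableSet_and ?_ (measurableSet_and ?_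
    (measurableSet_and ?_ (measurableSet_and ?_ (measurableSet_and ?_ ?_)))))
  · exact measurableSet_le (by fun_prop) (by fun_prop)
  · exact measurableSet_le (by fun_prop) (by fun_prop)
  · exact measurableSet_le (by fun_prop) (by fun_prop)
  · exact measurableSet_lt (by fun_prop) (by fun_prop)
  · exact measurableSet_lt (by fun_prop) (by fun_prop)
  · exact measurableSet_le (by fun_prop) (by fun_prop)
  · exact measurableSet_le (by fun_prop) (by fun_prop)

lemma resPair_eq_res {α : ℝ} {u v : ℝ × ℝ} (_hu : u.1 ≠ 0) (_hv : v.1 ≠ 0)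
    (_huv : u.1 + v.1 ≠ 0) : resPair α u v = res α u.1 v.1 (kap u v) := by
  unfold resPair res kap omega
  field_simp
  ring

lemma resonantPlane_fst_ne_zero {α ρ₀ : ℝ} {u v : ℝ × ℝ} (h : (u, v) ∈ resonantPlane α ρ₀) :
    u.1 ≠ 0 := by
  have h1 : 1 ≤ |u.1| := h.1
  intro h0
  rw [h0, abs_zero] at h1
  linarith

lemma resonantPlane_snd_pos {α ρ₀ : ℝ} {u v : ℝ × ℝ} (h : (u, v) ∈ resonantPlane α ρ₀) :
    10 ≤ v.1 := by
  have h1 : 10 + 10 * |α| ≤ v.1 := h.2.2.1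
  linarith [abs_nonneg α]

/-- Dividing the resonance condition by ξ |ξ₁| ξ₂ places κ² within 3ξ₂²/10 of 5(ξ₁² + ξ₁ξ₂ + ξ₂²) -
3α. As |ξ₁| ≤ ξ₂, the quadratic form lies between 15ξ₂²/4 and 15ξ₂², while 3|α| ≤ ξ₂²/3. -/
lemma kap_bounds {α ρ₀ : ℝ} {u v : ℝ × ℝ} (h : (u, v) ∈ resonantPlane α ρ₀) :
    v.1 ≤ kap u v ∧ kap u v ≤ 4 * v.1 := by
  have hu := resonantPlane_fst_ne_zero h
  have hv := resonantPlane_snd_pos h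
  have hres := resPair_eq_res (α := α) hu (by linarith) (h.2.2.2.1.ne')
  obtain ⟨h1, h2, h3, h4, h5, h6, -⟩ := h
  simp only at h1 h2 h3 h4 h5 h6
  set x := v.1
  set y := u.1
  set κ := kap u v
  have hα : 3 * |α| ≤ x ^ 2 / 3 := by nlinarith [abs_nonneg α]
  have hα1 := le_abs_self α
  have hα2 := neg_abs_le α
  have hy0 : 0 < |y| := by linarith
  have hx0 : 0 < x := by linarith
  have h7 : |5 * (y ^ 2 + y * x + x ^ 2) - 3 * α - κ ^ 2| ≤ 3 / 10 * x ^ 2 := by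
    rw [hres, res, abs_mul, abs_mul, abs_mul, abs_of_pos h4, abs_of_pos hx0] at h6
    have hpos : 0 < (y + x) * |y| * x := by positivity
    refine le_of_mul_le_mul_left ?_ hpos
    calc _ ≤ _ := h6
      _ = _ := by ring
  have h8 := abs_le.1 h7
  have hy := abs_le.1 h2
  constructor
  · refine le_of_sq_le_sq ?_ h5.le
    nlinarith [sq_nonneg (2 * y + x)]
  · refine le_of_sq_le_sq ?_ (by linarith)
    have : y ^ 2 ≤ x ^ 2 := by nlinarith
    nlinarith

/-- The weight `|ξ|` on resonant pairs. -/
def resWeight (α ρ₀ : ℝ) (u v : ℝ × ℝ) : ℝ≥0∞ :=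
  (resonantPlane α ρ₀).indicator (fun z => ENNReal.ofReal (z.1.1 + z.2.1)) (u, v)

lemma measurable_resWeight (α ρ₀ : ℝ) : Measurable (Function.uncurry (resWeight α ρ₀)) :=
  Measurable.indicator (by fun_prop) (measurableSet_resonantPlane α ρ₀)

/-! ### From pairs of resonant interactions to integrals along curves -/

lemma jb_le_pow_three_mul {q x s : ℝ} (hx : 1 ≤ x) (hs : |s| ≤ x ^ 5 / 5) :
    jb q s ≤ ENNReal.ofReal (2 * x ^ 3) * jb (q + 1 / 2) s := by
  have hb := bracket_pos s
  unfold jb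
  rw [← ENNReal.ofReal_mul (by positivity)]
  refine ENNReal.ofReal_le_ofReal ?_
  have h1 : bracket s ≤ (2 * x ^ 3) ^ 2 := by
    have h2 := bracket_le_one_add_abs s
    have h3 : 1 ≤ x ^ 6 := one_le_pow₀ hx
    have h4 : x ^ 5 ≤ x ^ 6 := pow_le_pow_right₀ hx (by norm_num)
    nlinarith
  have h5 : bracket s ^ (1 / 2 : ℝ) ≤ 2 * x ^ 3 := by
    rw [← Real.sqrt_eq_rpow]
    exact Real.sqrt_le_iff.2 ⟨by positivity, h1⟩
  calc bracket s ^ (-q) = bracket s ^ (1 / 2 : ℝ) * bracket s ^ (-(q + 1 / 2)) := by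
        rw [← Real.rpow_add hb]
        congr 1
        ring
    _ ≤ _ := by gcongr

/-- The majorant of the weights of a pair of resonant interactions along a curve. -/
def curveWeight (α q ξ m ρ₀ c a M s : ℝ) (x τ : ℝ) : ℝ≥0∞ :=
  {z : ℝ × ℝ | z.1 ∈ curveSet α ξ m (c - z.2) a M s}.indicator
    (fun z => ENNReal.ofReal (z.1 ^ 3) *
      jb (q + 1 / 2) (ρ₀ - curveRes α ξ m (c - z.2) a M z.1)) (x, τ)

lemma measurable_curveWeight (α q ξ m ρ₀ c a M s : ℝ) :
    Measurable fun z : ℝ × ℝ => curveWeight α q ξ m ρ₀ c a M s z.1 z.2 := by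
  have hG : Measurable fun z : ℝ × ℝ => curveSq α ξ (c - z.2) z.1 :=
    measurable_curveSq measurable_const (by fun_prop) measurable_fst
  have hS : Measurable fun z : ℝ × ℝ => curveSlope α ξ m (c - z.2) z.1 := by
    unfold curveSlope
    fun_prop
  refine Measurable.indicator ?_ ?_
  · unfold curveRes res
    fun_prop
  refine measurableSet_and (measurableSet_and ?_ (measurableSet_and ?_ (measurableSet_and ?_
    (measurableSet_and ?_ (measurableSet_and ?_ ?_))))) (measurableSet_and ?_ ?_)
  · exact measurableSet_le (by fun_prop) (by fun_prop)
  · exact measurableSet_le (by fun_prop) (by fun_prop)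
  · exact measurableSet_le (by fun_prop) (by fun_prop)
  · exact measurableSet_lt (by fun_prop) (by fun_prop)
  · exact measurableSet_lt (by fun_prop) (by fun_prop)
  · exact measurableSet_lt (by fun_prop) (by fun_prop)
  · exact measurableSet_le (by fun_prop) (by fun_prop)
  · exact measurableSet_le (by fun_prop) (by fun_prop)

lemma lintegral_curveWeight_le {α q ξ m ρ₀ c a M s τ : ℝ} (hξ : 0 < ξ) (ha : 1 ≤ |a|)
    (hs : s = 1 ∨ s = -1) :
    ∫⁻ x, curveWeight α q ξ m ρ₀ c a M s x τ ≤ ∫⁻ y, jb (q + 1 / 2) y := by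
  refine le_trans (le_of_eq ?_) (lintegral_curveSet_le (α := α) (m := m) (ρ := c - τ) (M := M)
    (ρ₀ := ρ₀) (p := q + 1 / 2) hξ ha hs)
  rw [← lintegral_indicator measurableSet_curveSet]
  rfl

/-- The value ρ determines κ² and hence, as κ > 0, the slope of the second frequency. That u is also
resonant with this point bounds its own coordinate κ by `kap_bounds`, which gives the two remaining
constraints. -/
lemma mem_curveSet_of_resonant {α ρ₀ ρ ξ μ κ x s : ℝ} {u : ℝ × ℝ}
    (hξ : 0 < ξ) (hx : x ≠ 0) (hξx : ξ - x ≠ 0) (hs : 0 < s * (ξ - x))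
    (hκ : 0 < κ) (hρ : ρ = res α (ξ - x) x κ) (hx2 : ξ ≤ 2 * x)
    (h : (u, (x, x * (μ / ξ - (ξ - x) * κ))) ∈ resonantPlane α ρ₀) :
    x ∈ curveSet α ξ (μ / ξ) ρ u.1 (u.2 / u.1) s ∧
    curveRes α ξ (μ / ξ) ρ u.1 (u.2 / u.1) x =
      resPair α u (x, x * (μ / ξ - (ξ - x) * κ)) := by
  have hG : curveSq α ξ ρ x = κ ^ 2 := by
    rw [hρ]
    unfold curveSq res
    field_simp
    ring
  have hsl : curveSlope α ξ (μ / ξ) ρ x = μ / ξ - (ξ - x) * κ := by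
    rw [curveSlope, hG, Real.sqrt_sq hκ.le]
  have hkap : kap u (x, x * (μ / ξ - (ξ - x) * κ)) =
      (u.2 / u.1 - curveSlope α ξ (μ / ξ) ρ x) / (u.1 + x) := by
    rw [kap, hsl, mul_div_cancel_left₀ _ hx]
  have hb := kap_bounds h
  have hu := resonantPlane_fst_ne_zero h
  have hv := resonantPlane_snd_pos h
  have hax : 0 < u.1 + x := h.2.2.2.1
  rw [hkap] at hb
  simp only at hb hv
  refine ⟨⟨⟨h.2.2.1, hx2, h.2.1, hax, hs, by rw [hG]; positivity⟩, ?_, ?_⟩, ?_⟩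
  · have := mul_le_mul_of_nonneg_right hb.1 hax.le
    rw [div_mul_cancel₀ _ hax.ne'] at this
    exact le_trans (by positivity) this
  · have := mul_le_mul_of_nonneg_right hb.2 hax.le
    rwa [div_mul_cancel₀ _ hax.ne'] at this
  · rw [resPair_eq_res hu hx hax.ne', hkap]
    rfl

/-- The output modulation is at most x⁵/5, so half a power of its bracket costs at most 2x³, the
amount that the derivative along the curve repays. The weight of u contributes a + x ≤ 2x. -/
lemma resWeight_mul_le {α q ρ₀ x μ : ℝ} {u : ℝ × ℝ} (h : (u, (x, μ)) ∈ resonantPlane α ρ₀) :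
    resWeight α ρ₀ u (x, μ) * jb (q / 2) (ρ₀ - resPair α u (x, μ)) ^ 2 ≤
      ENNReal.ofReal (4 * x) *
        (ENNReal.ofReal (x ^ 3) * jb (q + 1 / 2) (ρ₀ - resPair α u (x, μ))) := by
  have hx := resonantPlane_snd_pos h
  simp only at hx
  have h2 : |u.1| ≤ x := h.2.1
  have h3 := abs_le.1 h2
  have h4 : 0 < u.1 + x := h.2.2.2.1
  have h7 : |ρ₀ - resPair α u (x, μ)| ≤ (u.1 + x) * |u.1| * x ^ 3 / 10 := h.2.2.2.2.2.2
  have h8 : |ρ₀ - resPair α u (x, μ)| ≤ x ^ 5 / 5 := by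
    refine h7.trans ?_
    calc (u.1 + x) * |u.1| * x ^ 3 / 10 ≤ (2 * x) * x * x ^ 3 / 10 := by gcongr; linarith
      _ = _ := by ring
  rw [resWeight, Set.indicator_of_mem h, jb_sq]
  calc ENNReal.ofReal (u.1 + x) * jb q (ρ₀ - resPair α u (x, μ))
      ≤ ENNReal.ofReal (2 * x) *
        (ENNReal.ofReal (2 * x ^ 3) * jb (q + 1 / 2) (ρ₀ - resPair α u (x, μ))) := by
        gcongr
        · linarith
        · exact jb_le_pow_three_mul (by linarith) h8
    _ = _ := by
        rw [← mul_assoc, ← mul_assoc, ← ENNReal.ofReal_mul (by linarith),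
          ← ENNReal.ofReal_mul (by linarith)]
        congr 2
        ring

@[fun_prop]
lemma measurable_resPair_comp {X : Type*} [MeasurableSpace X] {α : ℝ} {f g : X → ℝ × ℝ}
    (hf : Measurable f) (hg : Measurable g) : Measurable fun x => resPair α (f x) (g x) :=
  Measurable.comp (g := fun z : (ℝ × ℝ) × (ℝ × ℝ) => resPair α z.1 z.2)
    (f := fun x => (f x, g x)) (measurable_resPair α) (hf.prodMk hg)

@[fun_prop]
lemma measurable_resWeight_comp {X : Type*} [MeasurableSpace X] {α ρ₀ : ℝ} {f g : X → ℝ × ℝ}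
    (hf : Measurable f) (hg : Measurable g) : Measurable fun x => resWeight α ρ₀ (f x) (g x) :=
  Measurable.comp (g := Function.uncurry (resWeight α ρ₀))
    (f := fun x => (f x, g x)) (measurable_resWeight α ρ₀) (hf.prodMk hg)

/-- With ζ = (ξ, μ) and x fixed, ν is traded first for κ > 0 and then for the time frequency τ of
the sum, where dτ = 2κ ξ |ξ - x| |x| dκ up to sign. Splitting by the sign of ξ - x selects one of
the two pieces of the curve. -/
lemma lintegral_resonant_fiber_le {α q ρ₀ ξ μ x : ℝ} {u : ℝ × ℝ} (hξ : 0 < ξ) (hx : x ≠ 0)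
    (hξx : ξ - x ≠ 0) (F : ℝ → ℝ≥0∞) :
    ∫⁻ ν, resWeight α ρ₀ (ξ - x, μ - ν) (x, ν) *
        F (ρ₀ + omega α (ξ - x) (μ - ν) + omega α x ν) *
        (resWeight α ρ₀ u (x, ν) * jb (q / 2) (ρ₀ - resPair α u (x, ν)) ^ 2) ≤
      ∫⁻ τ, F τ * (2 *
        (curveWeight α q ξ (μ / ξ) ρ₀ (ρ₀ + omega α ξ μ) u.1 (u.2 / u.1) 1 x τ +
        curveWeight α q ξ (μ / ξ) ρ₀ (ρ₀ + omega α ξ μ) u.1 (u.2 / u.1) (-1) x τ)) := by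
  set c := ρ₀ + omega α ξ μ
  set f : ℝ → ℝ := fun κ => c - res α (ξ - x) x κ
  set b := ξ * (ξ - x) * x with hb
  have hd : ∀ κ ∈ Set.Ioi (0 : ℝ), HasDerivAt f (b * (2 * κ)) κ := by
    intro κ _
    have := (((hasDerivAt_pow 2 κ).const_sub
      (5 * ((ξ - x) ^ 2 + (ξ - x) * x + x ^ 2) - 3 * α)).const_mul
        ((ξ - x + x) * (ξ - x) * x)).const_sub c
    refine this.congr_deriv ?_
    rw [hb]
    norm_num
  have hinj : Set.InjOn f (Set.Ioi 0) := by
    intro κ hκ κ' hκ' e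
    have e' : b * (κ ^ 2 - κ' ^ 2) = 0 := by
      simp only [f, res] at e
      rw [hb]
      linear_combination e
    have hb0 : b ≠ 0 := by rw [hb]; positivity
    have h2 : κ ^ 2 - κ' ^ 2 = 0 := by simpa [hb0] using e'
    exact (sq_eq_sq₀ (le_of_lt hκ) (le_of_lt hκ')).1 (by linarith)
  have key := lintegral_abs_deriv_mul_comp_le measurableSet_Ioi hd hinj
    (fun τ => F τ * (2 * (curveWeight α q ξ (μ / ξ) ρ₀ c u.1 (u.2 / u.1) 1 x τ +
        curveWeight α q ξ (μ / ξ) ρ₀ c u.1 (u.2 / u.1) (-1) x τ)))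
  refine le_trans ?_ key
  -- The substitution is ν = x(μ/ξ - (ξ - x)κ), with Jacobian |x(ξ - x)|.
  rw [lintegral_comp_affine _ (neg_ne_zero.2 (mul_ne_zero hx hξx)) (x * (μ / ξ)),
    ← lintegral_const_mul' _ _ ENNReal.ofReal_ne_top, ← lintegral_indicator measurableSet_Ioi]
  refine lintegral_mono fun κ => ?_
  have e1 : -(x * (ξ - x)) * κ + x * (μ / ξ) = x * (μ / ξ - (ξ - x) * κ) := by ring
  simp only [e1]
  set ν := x * (μ / ξ - (ξ - x) * κ) with hν
  by_cases h1 : ((ξ - x, μ - ν), (x, ν)) ∈ resonantPlane α ρ₀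
  swap
  · simp [resWeight, h1]
  by_cases h2 : (u, (x, ν)) ∈ resonantPlane α ρ₀
  swap
  · simp [resWeight, h2]
  have hkap : kap (ξ - x, μ - ν) (x, ν) = κ := by
    have e2 : μ - ν = (ξ - x) * (μ / ξ + x * κ) := by
      rw [hν]
      field_simp
      ring
    rw [kap]
    simp only [e2]
    rw [hν, mul_div_cancel_left₀ _ hξx, mul_div_cancel_left₀ _ hx,
      div_eq_iff (by rw [sub_add_cancel]; exact hξ.ne')]
    ring
  have hκx := (kap_bounds h1).1
  rw [hkap] at hκx
  simp only at hκx
  have hx10 := resonantPlane_snd_pos h1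
  simp only at hx10
  have hκ : 0 < κ := by linarith
  rw [Set.indicator_of_mem (show κ ∈ Set.Ioi (0 : ℝ) from hκ)]
  have hfκ : ρ₀ + omega α (ξ - x) (μ - ν) + omega α x ν = f κ := by
    have := resPair_eq_res (α := α) (u := (ξ - x, μ - ν)) (v := (x, ν)) hξx hx
      (by simpa using hξ.ne')
    rw [hkap] at this
    simp only [resPair, sub_add_cancel] at this
    simp only [f, c]
    linarith
  rw [hfκ]
  have hx2 : ξ ≤ 2 * x := by
    have := (le_abs_self (ξ - x)).trans (show |ξ - x| ≤ x from h1.2.1)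
    linarith
  have hcw : ENNReal.ofReal (x ^ 3) * jb (q + 1 / 2) (ρ₀ - resPair α u (x, ν)) ≤
      curveWeight α q ξ (μ / ξ) ρ₀ c u.1 (u.2 / u.1) 1 x (f κ) +
        curveWeight α q ξ (μ / ξ) ρ₀ c u.1 (u.2 / u.1) (-1) x (f κ) := by
    have hρ : c - f κ = res α (ξ - x) x κ := by simp only [f]; ring
    rcases lt_or_gt_of_ne hξx with hlt | hgt
    · obtain ⟨hm, hr⟩ := mem_curveSet_of_resonant (s := -1) hξ hx hξx (by linarith) hκ hρ hx2 h2
      refine le_trans (le_of_eq ?_) le_add_self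
      have hm' : (x, f κ) ∈ {z : ℝ × ℝ | z.1 ∈
        curveSet α ξ (μ / ξ) (c - z.2) u.1 (u.2 / u.1) (-1)} := hm
      rw [curveWeight, Set.indicator_of_mem hm']
      simp only
      rw [hr]
    · obtain ⟨hm, hr⟩ := mem_curveSet_of_resonant (s := 1) hξ hx hξx (by linarith) hκ hρ hx2 h2
      refine le_trans (le_of_eq ?_) le_self_add
      have hm' : (x, f κ) ∈ {z : ℝ × ℝ | z.1 ∈
        curveSet α ξ (μ / ξ) (c - z.2) u.1 (u.2 / u.1) 1} := hm
      rw [curveWeight, Set.indicator_of_mem hm']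
      simp only
      rw [hr]
  set Wt := curveWeight α q ξ (μ / ξ) ρ₀ c u.1 (u.2 / u.1) 1 x (f κ) +
        curveWeight α q ξ (μ / ξ) ρ₀ c u.1 (u.2 / u.1) (-1) x (f κ)
  have hw1 : resWeight α ρ₀ (ξ - x, μ - ν) (x, ν) = ENNReal.ofReal ξ := by
    rw [resWeight, Set.indicator_of_mem h1]
    simp
  rw [hw1]
  calc ENNReal.ofReal |-(x * (ξ - x))| * (ENNReal.ofReal ξ * F (f κ) *
        (resWeight α ρ₀ u (x, ν) * jb (q / 2) (ρ₀ - resPair α u (x, ν)) ^ 2))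
      ≤ ENNReal.ofReal |-(x * (ξ - x))| * (ENNReal.ofReal ξ * F (f κ) *
        (ENNReal.ofReal (4 * x) * Wt)) := by
        refine mul_le_mul_right (mul_le_mul_right ?_ _) _
        exact (resWeight_mul_le h2).trans (by gcongr)
    _ = (ENNReal.ofReal |-(x * (ξ - x))| * ENNReal.ofReal ξ * ENNReal.ofReal (4 * x)) *
        (F (f κ) * Wt) := by ring
    -- The remaining factor 4x from the weight of u is absorbed by the Jacobian in τ, thanks to x ≤
    -- κ.
    _ ≤ (ENNReal.ofReal |b * (2 * κ)| * ENNReal.ofReal 2) * (F (f κ) * Wt) := by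
        rw [← ENNReal.ofReal_mul (by positivity), ← ENNReal.ofReal_mul (by positivity),
          ← ENNReal.ofReal_mul (by positivity)]
        refine mul_le_mul_left (ENNReal.ofReal_le_ofReal ?_) _
        rw [hb, abs_neg, abs_mul, abs_mul, abs_mul, abs_mul, abs_of_pos hξ,
          abs_of_pos (by linarith : 0 < x), abs_of_pos (by linarith : 0 < 2 * κ)]
        have : 0 ≤ ξ * |ξ - x| * x := by positivity
        nlinarith
    _ = _ := by
        rw [show ENNReal.ofReal 2 = 2 by simp]
        ring

/-- After the fibre change of variables h depends only on (τ, ζ), so x can be integrated first along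
the curve, uniformly in τ. The 4 is the fibre constant 2 times the two signs of ξ - x. -/
lemma lintegral_resonant_pair_le {α q ρ₀ : ℝ} {h : Freq → ℝ≥0∞} (hh : Measurable h)
    {u : ℝ × ℝ} (hu : 1 ≤ |u.1|) (ζ : ℝ × ℝ) :
    ∫⁻ v : ℝ × ℝ, resWeight α ρ₀ (ζ - v) v *
      h (ρ₀ + omega α (ζ.1 - v.1) (ζ.2 - v.2) + omega α v.1 v.2, ζ) ^ 2 *
      (resWeight α ρ₀ u v * jb (q / 2) (ρ₀ - resPair α u v) ^ 2) ≤
      4 * (∫⁻ s, jb (q + 1 / 2) s) * ∫⁻ τ, h (τ, ζ) ^ 2 := by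
  obtain ⟨ξ, μ⟩ := ζ
  set I := ∫⁻ s, jb (q + 1 / 2) s
  by_cases hξ : 0 < ξ
  swap
  · have h0 : ∀ v : ℝ × ℝ, resWeight α ρ₀ ((ξ, μ) - v) v = 0 := by
      intro v
      refine Set.indicator_of_notMem (fun hm => hξ ?_) _
      have : 0 < (ξ - v.1) + v.1 := hm.2.2.2.1
      linarith
    simp [h0]
  set cw : ℝ → ℝ → ℝ → ℝ≥0∞ := fun s x τ =>
    curveWeight α q ξ (μ / ξ) ρ₀ (ρ₀ + omega α ξ μ) u.1 (u.2 / u.1) s x τ with hcw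
  have hm1 : Measurable fun z : ℝ × ℝ => cw 1 z.1 z.2 :=
    measurable_curveWeight α q ξ (μ / ξ) ρ₀ (ρ₀ + omega α ξ μ) u.1 (u.2 / u.1) 1
  have hm2 : Measurable fun z : ℝ × ℝ => cw (-1) z.1 z.2 :=
    measurable_curveWeight α q ξ (μ / ξ) ρ₀ (ρ₀ + omega α ξ μ) u.1 (u.2 / u.1) (-1)
  have hhτ : Measurable fun τ => h (τ, ξ, μ) := hh.comp measurable_prodMk_right
  calc ∫⁻ v : ℝ × ℝ, resWeight α ρ₀ ((ξ, μ) - v) v *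
        h (ρ₀ + omega α (ξ - v.1) (μ - v.2) + omega α v.1 v.2, (ξ, μ)) ^ 2 *
        (resWeight α ρ₀ u v * jb (q / 2) (ρ₀ - resPair α u v) ^ 2)
      = ∫⁻ x, ∫⁻ ν, resWeight α ρ₀ (ξ - x, μ - ν) (x, ν) *
        h (ρ₀ + omega α (ξ - x) (μ - ν) + omega α x ν, (ξ, μ)) ^ 2 *
        (resWeight α ρ₀ u (x, ν) * jb (q / 2) (ρ₀ - resPair α u (x, ν)) ^ 2) := by
        rw [Measure.volume_eq_prod, lintegral_prod _ (Measurable.aemeasurable ?_)]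
        · rfl
        · have h2 : Measurable fun v : ℝ × ℝ =>
              h (ρ₀ + omega α (ξ - v.1) (μ - v.2) + omega α v.1 v.2, (ξ, μ)) :=
            hhτ.comp (by fun_prop)
          fun_prop
    _ ≤ ∫⁻ x, ∫⁻ τ, h (τ, ξ, μ) ^ 2 * (2 * (cw 1 x τ + cw (-1) x τ)) := by
        refine lintegral_mono_ae ?_
        filter_upwards [ae_ne_real 0, ae_ne_real ξ] with x hx hxξ
        exact lintegral_resonant_fiber_le (q := q) hξ hx (sub_ne_zero.2 hxξ.symm)
          (fun τ => h (τ, ξ, μ) ^ 2)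
    _ = ∫⁻ τ, ∫⁻ x, h (τ, ξ, μ) ^ 2 * (2 * (cw 1 x τ + cw (-1) x τ)) := by
        refine lintegral_lintegral_swap (Measurable.aemeasurable ?_)
        have hm3 : Measurable fun z : ℝ × ℝ => cw 1 z.1 z.2 + cw (-1) z.1 z.2 := hm1.add hm2
        simp only [Function.uncurry_def]
        fun_prop
    _ ≤ ∫⁻ τ, 4 * I * h (τ, ξ, μ) ^ 2 := by
        refine lintegral_mono fun τ => ?_
        have n1 : Measurable fun x => cw 1 x τ :=
          Measurable.comp (g := fun z : ℝ × ℝ => cw 1 z.1 z.2) (f := fun x => (x, τ)) hm1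
            measurable_prodMk_right
        have n2 : Measurable fun x => cw (-1) x τ :=
          Measurable.comp (g := fun z : ℝ × ℝ => cw (-1) z.1 z.2) (f := fun x => (x, τ)) hm2
            measurable_prodMk_right
        rw [lintegral_const_mul _ (by fun_prop), lintegral_const_mul _ (by fun_prop),
          lintegral_add_left n1, mul_comm]
        refine mul_le_mul_left ?_ _
        have i1 : ∫⁻ x, cw 1 x τ ≤ I :=
          lintegral_curveWeight_le (α := α) (q := q) (m := μ / ξ) (ρ₀ := ρ₀)
            (c := ρ₀ + omega α ξ μ) (M := u.2 / u.1) (τ := τ) hξ hu (Or.inl rfl)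
        have i2 : ∫⁻ x, cw (-1) x τ ≤ I :=
          lintegral_curveWeight_le (α := α) (q := q) (m := μ / ξ) (ρ₀ := ρ₀)
            (c := ρ₀ + omega α ξ μ) (M := u.2 / u.1) (τ := τ) hξ hu (Or.inr rfl)
        exact (mul_le_mul_right (add_le_add i1 i2) _).trans (le_of_eq (by ring))
    _ = _ := by rw [lintegral_const_mul _ (hhτ.pow_const 2)]

lemma lintegral_resonant_kernel_le {α q ρ₀ : ℝ} {h : Freq → ℝ≥0∞} (hh : Measurable h)
    (u : ℝ × ℝ) :
    ∫⁻ v : ℝ × ℝ, ∫⁻ w : ℝ × ℝ, resWeight α ρ₀ w v *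
      h (ρ₀ + omega α w.1 w.2 + omega α v.1 v.2, w + v) ^ 2 *
      (resWeight α ρ₀ u v * jb (q / 2) (ρ₀ - resPair α u v) ^ 2) ≤
      4 * (∫⁻ s, jb (q + 1 / 2) s) * ∫⁻ k, h k ^ 2 := by
  by_cases hu : 1 ≤ |u.1|
  swap
  · have h0 : ∀ v, resWeight α ρ₀ u v = 0 := fun v =>
      Set.indicator_of_notMem (fun hm => hu hm.1) _
    simp [h0]
  have hshift : ∀ v : ℝ × ℝ, ∫⁻ w : ℝ × ℝ, resWeight α ρ₀ w v *
      h (ρ₀ + omega α w.1 w.2 + omega α v.1 v.2, w + v) ^ 2 *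
      (resWeight α ρ₀ u v * jb (q / 2) (ρ₀ - resPair α u v) ^ 2) =
      ∫⁻ ζ : ℝ × ℝ, resWeight α ρ₀ (ζ - v) v *
        h (ρ₀ + omega α (ζ.1 - v.1) (ζ.2 - v.2) + omega α v.1 v.2, ζ) ^ 2 *
        (resWeight α ρ₀ u v * jb (q / 2) (ρ₀ - resPair α u v) ^ 2) := by
    intro v
    rw [← lintegral_sub_right_eq_self _ v]
    simp only [sub_add_cancel, Prod.fst_sub, Prod.snd_sub]
  simp_rw [hshift]
  -- The total frequency ζ = w + v becomes the outer variable, so that the bound for fixed ζ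
  -- applies.
  rw [lintegral_lintegral_swap]
  · refine (lintegral_mono fun ζ => lintegral_resonant_pair_le hh hu ζ).trans (le_of_eq ?_)
    have hm : Measurable fun ζ : ℝ × ℝ => ∫⁻ τ, h (τ, ζ) ^ 2 :=
      Measurable.lintegral_prod_left' (f := fun k : Freq => h k ^ 2) (hh.pow_const 2)
    rw [lintegral_const_mul _ hm, Measure.volume_eq_prod ℝ (ℝ × ℝ),
      lintegral_prod_symm' _ (hh.pow_const 2)]
  · refine Measurable.aemeasurable ?_
    have h1 : Measurable fun z : (ℝ × ℝ) × (ℝ × ℝ) => resWeight α ρ₀ (z.2 - z.1) z.1 := by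
      fun_prop
    have h2 : Measurable fun z : (ℝ × ℝ) × (ℝ × ℝ) =>
        h (ρ₀ + omega α (z.2.1 - z.1.1) (z.2.2 - z.1.2) + omega α z.1.1 z.1.2, z.2) :=
      hh.comp (Measurable.prodMk (by fun_prop) measurable_snd)
    have h3 : Measurable fun z : (ℝ × ℝ) × (ℝ × ℝ) =>
        resWeight α ρ₀ u z.1 * jb (q / 2) (ρ₀ - resPair α u z.1) ^ 2 := by
      fun_prop
    exact (h1.mul (h2.pow_const 2)).mul h3

/-- The resonant trilinear form at fixed modulations `σ₁`, `σ₂` with `σ₁ + σ₂ = ρ₀`. -/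
lemma exists_lintegral_resonant_le (α : ℝ) {q : ℝ} (hq : 1 / 2 < q) :
    ∃ C : ℝ≥0, ∀ (ρ₀ : ℝ) (h : Freq → ℝ≥0∞) (g₁ g₂ : ℝ × ℝ → ℝ≥0∞), Measurable h →
      Measurable g₁ → Measurable g₂ →
      ∫⁻ v : ℝ × ℝ, ∫⁻ w : ℝ × ℝ, resWeight α ρ₀ w v * jb (q / 2) (ρ₀ - resPair α w v) *
        h (ρ₀ + omega α w.1 w.2 + omega α v.1 v.2, w + v) * g₁ w * g₂ v ≤
      C * l2 h * l2 g₁ * l2 g₂ := by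
  have hfin := lintegral_jb_lt_top (p := q + 1 / 2) (by linarith)
  lift (∫⁻ s, jb (q + 1 / 2) s) to ℝ≥0 using hfin.ne with I hI
  refine ⟨NNReal.sqrt (4 * I), fun ρ₀ h g₁ g₂ hh hg₁ hg₂ => ?_⟩
  have hR := measurable_resPair α
  refine lintegral_kernel_le_of_forall (e := resWeight α ρ₀)
    (t := fun w v => jb (q / 2) (ρ₀ - resPair α w v))
    (H := fun w v => h (ρ₀ + omega α w.1 w.2 + omega α v.1 v.2, w + v))
    (measurable_resWeight α ρ₀) ?_ ?_ (fun u => ?_) hg₁ hg₂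
  · simp only [Function.uncurry_def]
    fun_prop
  · simp only [Function.uncurry_def]
    fun_prop
  · refine (lintegral_resonant_kernel_le hh u).trans (le_of_eq ?_)
    rw [← hI, mul_pow, l2_sq, ← ENNReal.coe_pow, NNReal.sq_sqrt]
    push_cast
    rfl

/-! ### The resonant region -/

/-- The change of variables `(σ, ζ) ↦ (σ + ω(ζ), ζ)`. -/
def shear (α : ℝ) (k : Freq) : Freq := (k.1 + omega α k.2.1 k.2.2, k.2)

@[fun_prop]
lemma measurable_shear (α : ℝ) : Measurable (shear α) := by
  unfold shear
  fun_prop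

lemma measurePreserving_shear (α : ℝ) : MeasurePreserving (shear α) := by
  have h1 : MeasurePreserving (fun z : (ℝ × ℝ) × ℝ => (z.1, z.2 + omega α z.1.1 z.1.2))
      ((volume : Measure (ℝ × ℝ)).prod (volume : Measure ℝ))
      ((volume : Measure (ℝ × ℝ)).prod (volume : Measure ℝ)) :=
    (MeasurePreserving.id (volume : Measure (ℝ × ℝ))).skew_product
      (g := fun ζ σ => σ + omega α ζ.1 ζ.2)
      (by simp only [Function.uncurry_def]; fun_prop)
      (Filter.Eventually.of_forall fun ζ =>
        (measurePreserving_add_right (volume : Measure ℝ) (omega α ζ.1 ζ.2)).map_eq)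
  exact (Measure.measurePreserving_swap.comp h1).comp
    (Measure.measurePreserving_swap (μ := (volume : Measure ℝ))
      (ν := (volume : Measure (ℝ × ℝ))))

lemma lintegral_prod_prod_swap {f : Freq × Freq → ℝ≥0∞} (hf : Measurable f) :
    ∫⁻ z, f z = ∫⁻ a, ∫⁻ b, ∫⁻ v, ∫⁻ w, f ((a, w), (b, v)) := by
  rw [Measure.volume_eq_prod, lintegral_prod _ hf.aemeasurable]
  have h1 : ∀ k₁, ∫⁻ k₂, f (k₁, k₂) = ∫⁻ b, ∫⁻ v, f (k₁, (b, v)) := by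
    intro k₁
    rw [Measure.volume_eq_prod ℝ (ℝ × ℝ), lintegral_prod _ (by fun_prop)]
  simp_rw [h1]
  have hm : Measurable fun z : Freq × ℝ => ∫⁻ v, f (z.1, (z.2, v)) :=
    Measurable.lintegral_prod_right' (f := fun y : (Freq × ℝ) × (ℝ × ℝ) => f (y.1.1, (y.1.2, y.2)))
      (by fun_prop)
  rw [Measure.volume_eq_prod ℝ (ℝ × ℝ), lintegral_prod _ (Measurable.aemeasurable
    (Measurable.lintegral_prod_right' hm))]
  refine lintegral_congr fun a => ?_
  simp only
  rw [lintegral_lintegral_swap]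
  · refine lintegral_congr fun b => ?_
    rw [lintegral_lintegral_swap]
    exact Measurable.aemeasurable (hf.comp
      (f := fun y : (ℝ × ℝ) × (ℝ × ℝ) => ((a, y.1), (b, y.2))) (by fun_prop))
  · exact Measurable.aemeasurable (hm.comp
      (f := fun y : (ℝ × ℝ) × ℝ => ((a, y.1), y.2)) (by fun_prop))

/-- Resonant interactions with `ξ₂ > 0` and `κ > 0`. -/
def resonantRegion (α : ℝ) : Set (Freq × Freq) :=
  {z | (1 ≤ |z.1.2.1| ∧ |z.1.2.1| ≤ z.2.2.1 ∧ 10 + 10 * |α| ≤ z.2.2.1 ∧ 0 < z.1.2.1 + z.2.2.1 ∧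
    0 < kap z.1.2 z.2.2) ∧ |modulation α (z.1 + z.2)| ≤ resSize z / 10 ∧
    |modulation α z.1| ≤ resSize z / 10 ∧ |modulation α z.2| ≤ resSize z / 10}

lemma measurableSet_resonantRegion (α : ℝ) : MeasurableSet (resonantRegion α) := by
  have h1 := measurable_resSize
  have h2 : Measurable fun z : Freq × Freq => kap z.1.2 z.2.2 := by
    unfold kap
    fun_prop
  refine measurableSet_and (measurableSet_and ?_ (measurableSet_and ?_ (measurableSet_and ?_
    (measurableSet_and ?_ ?_)))) (measurableSet_and ?_ (measurableSet_and ?_ ?_))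
  · exact measurableSet_le (by fun_prop) (by fun_prop)
  · exact measurableSet_le (by fun_prop) (by fun_prop)
  · exact measurableSet_le (by fun_prop) (by fun_prop)
  · exact measurableSet_lt (by fun_prop) (by fun_prop)
  · exact measurableSet_lt (by fun_prop) (by fun_prop)
  · exact measurableSet_le (by fun_prop) (by fun_prop)
  · exact measurableSet_le (by fun_prop) (by fun_prop)
  · exact measurableSet_le (by fun_prop) (by fun_prop)

lemma modulation_shear (α : ℝ) (k : Freq) : modulation α (shear α k) = k.1 := by
  simp [modulation, shear]

lemma modulation_shear_add_shear (α : ℝ) (k₁ k₂ : Freq) :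
    modulation α (shear α k₁ + shear α k₂) = k₁.1 + k₂.1 - resPair α k₁.2 k₂.2 := by
  simp only [modulation, shear, resPair, Prod.fst_add, Prod.snd_add]
  ring

lemma kerOn_resonantRegion_shear_le (α p q : ℝ) (k₁ k₂ : Freq) :
    kerOn α p q (resonantRegion α) (shear α k₁) (shear α k₂) ≤
      jb (p / 2) k₁.1 * (jb (p / 2) k₂.1 * (resWeight α (k₁.1 + k₂.1) k₁.2 k₂.2 *
        jb (q / 2) (k₁.1 + k₂.1 - resPair α k₁.2 k₂.2))) := by
  by_cases h : (shear α k₁, shear α k₂) ∈ resonantRegion α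
  swap
  · rw [kerOn_of_notMem h]
    exact zero_le
  rw [kerOn_of_mem h]
  obtain ⟨⟨h1, h2, h3, h4, h5⟩, h6, h7, h8⟩ := h
  simp only [resSize, modulation_shear_add_shear, modulation_shear] at h1 h2 h3 h4 h5 h6 h7 h8
  simp only [shear] at h1 h2 h3 h4 h5 h6 h7 h8
  have hx : 0 < k₂.2.1 := by linarith [abs_nonneg α]
  rw [abs_of_pos h4, abs_of_pos hx] at h6 h7 h8
  have hm : (k₁.2, k₂.2) ∈ resonantPlane α (k₁.1 + k₂.1) := by
    refine ⟨h1, h2, h3, h4, h5, ?_, h6⟩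
    simp only
    have e : resPair α k₁.2 k₂.2 = k₁.1 + k₂.1 - (k₁.1 + k₂.1 - resPair α k₁.2 k₂.2) := by ring
    rw [e]
    refine (abs_sub _ _).trans ?_
    have := abs_add_le k₁.1 k₂.1
    linarith
  rw [resWeight, Set.indicator_of_mem hm, ker, modulation_shear_add_shear, modulation_shear,
    modulation_shear]
  simp only [shear]
  rw [abs_of_pos h4]
  exact le_of_eq (by ring)

/-- Cauchy-Schwarz in the modulation alone: this recombines the estimates at fixed modulations, and
for p > 1 the constant is finite. -/
lemma lintegral_jb_mul_l2_le {p : ℝ} {g : Freq → ℝ≥0∞} (hg : Measurable g) :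
    ∫⁻ σ, jb (p / 2) σ * l2 (fun ζ : ℝ × ℝ => g (σ, ζ)) ≤
      (∫⁻ σ, jb p σ) ^ (1 / 2 : ℝ) * l2 g := by
  have hm : Measurable fun σ : ℝ => l2 (fun ζ : ℝ × ℝ => g (σ, ζ)) := by
    unfold l2
    exact (Measurable.lintegral_prod_right' (f := fun k : Freq => g k ^ 2)
      (hg.pow_const 2)).pow_const _
  refine (lintegral_mul_le_l2 (by fun_prop) hm).trans (le_of_eq ?_)
  congr 1
  · simp only [l2, jb_sq]
  · simp only [l2]
    congr 1
    have : ∀ σ : ℝ, ((∫⁻ ζ : ℝ × ℝ, g (σ, ζ) ^ 2) ^ (1 / 2 : ℝ)) ^ 2 = ∫⁻ ζ : ℝ × ℝ, g (σ, ζ) ^ 2 :=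
      fun σ => l2_sq (fun ζ : ℝ × ℝ => g (σ, ζ))
    simp_rw [this]
    rw [Measure.volume_eq_prod ℝ (ℝ × ℝ), lintegral_prod _ (hg.pow_const 2).aemeasurable]

/-- After the shear in both inputs, σ₁ and σ₂ are parameters. The constant of the fixed-modulation
estimate depends on neither, so they can be integrated against their weights afterwards. -/
lemma exists_formBound_resonantRegion (α : ℝ) {p q : ℝ} (hp : 1 < p) (hq : 1 / 2 < q) :
    ∃ C : ℝ≥0, FormBound (kerOn α p q (resonantRegion α)) C := by
  obtain ⟨C, hC⟩ := exists_lintegral_resonant_le α hq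
  have hfin := lintegral_jb_lt_top hp
  have hI : ((∫⁻ σ, jb p σ) ^ (1 / 2 : ℝ)) ≠ ∞ := by
    refine ENNReal.rpow_ne_top_of_nonneg (by norm_num) hfin.ne
  obtain ⟨I, hI'⟩ := WithTop.ne_top_iff_exists.1 hI
  refine ⟨C * I * I, fun h g₁ g₂ hh hg₁ hg₂ => ?_⟩
  have hK : Measurable fun z : Freq × Freq => kerOn α p q (resonantRegion α) z.1 z.2 :=
    measurable_kerOn α p q (measurableSet_resonantRegion α)
  set F : Freq × Freq → ℝ≥0∞ := fun k => kerOn α p q (resonantRegion α) k.1 k.2 *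
    h (k.1 + k.2) * g₁ k.1 * g₂ k.2 with hF
  have hFm : Measurable F := by fun_prop
  set G₁ : Freq → ℝ≥0∞ := fun k => g₁ (shear α k) with hG₁
  set G₂ : Freq → ℝ≥0∞ := fun k => g₂ (shear α k) with hG₂
  have hG₁m : Measurable G₁ := by fun_prop
  have hG₂m : Measurable G₂ := by fun_prop
  have e1 : form (kerOn α p q (resonantRegion α)) h g₁ g₂ =
      ∫⁻ z : Freq × Freq, F (shear α z.1, shear α z.2) :=
    (((measurePreserving_shear α).prod (measurePreserving_shear α)).lintegral_comp hFm).symm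
  have hl : ∀ g : Freq → ℝ≥0∞, Measurable g → l2 (fun k => g (shear α k)) = l2 g :=
    fun g hg => l2_comp (measurePreserving_shear α) hg
  have hpt : ∀ (a b : ℝ) (v w : ℝ × ℝ), F (shear α (a, w), shear α (b, v)) ≤
      jb (p / 2) a * (jb (p / 2) b * (resWeight α (a + b) w v *
        jb (q / 2) (a + b - resPair α w v) *
        h (a + b + omega α w.1 w.2 + omega α v.1 v.2, w + v) * G₁ (a, w) * G₂ (b, v))) := by
    intro a b v w
    have e : shear α (a, w) + shear α (b, v) =
        (a + b + omega α w.1 w.2 + omega α v.1 v.2, w + v) := by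
      simp only [shear, Prod.mk_add_mk]
      congr 1
      ring
    simp only [hF, e]
    calc _ ≤ jb (p / 2) a * (jb (p / 2) b * (resWeight α (a + b) w v *
        jb (q / 2) (a + b - resPair α w v))) *
        h (a + b + omega α w.1 w.2 + omega α v.1 v.2, w + v) * G₁ (a, w) * G₂ (b, v) :=
          mul_le_mul_left (mul_le_mul_left (mul_le_mul_left
            (kerOn_resonantRegion_shear_le α p q (a, w) (b, v)) _) _) _
      _ = _ := by ring
  rw [e1, lintegral_prod_prod_swap (by fun_prop)]
  have hfib : ∀ a b : ℝ, ∫⁻ v : ℝ × ℝ, ∫⁻ w : ℝ × ℝ, F (shear α (a, w), shear α (b, v)) ≤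
      (C * l2 h) * ((jb (p / 2) a * l2 fun ζ => G₁ (a, ζ)) *
        (jb (p / 2) b * l2 fun ζ => G₂ (b, ζ))) := by
    intro a b
    calc ∫⁻ v : ℝ × ℝ, ∫⁻ w : ℝ × ℝ, F (shear α (a, w), shear α (b, v))
        ≤ ∫⁻ v : ℝ × ℝ, ∫⁻ w : ℝ × ℝ, jb (p / 2) a * (jb (p / 2) b * (resWeight α (a + b) w v *
        jb (q / 2) (a + b - resPair α w v) *
        h (a + b + omega α w.1 w.2 + omega α v.1 v.2, w + v) * G₁ (a, w) * G₂ (b, v))) :=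
          lintegral_mono fun v => lintegral_mono fun w => hpt a b v w
      _ = jb (p / 2) a * (jb (p / 2) b * ∫⁻ v : ℝ × ℝ, ∫⁻ w : ℝ × ℝ, resWeight α (a + b) w v *
        jb (q / 2) (a + b - resPair α w v) *
        h (a + b + omega α w.1 w.2 + omega α v.1 v.2, w + v) * G₁ (a, w) * G₂ (b, v)) := by
          simp_rw [lintegral_const_mul' _ _ (jb_ne_top _ _)]
      _ ≤ jb (p / 2) a * (jb (p / 2) b * (C * l2 h * l2 (fun ζ => G₁ (a, ζ)) *
        l2 (fun ζ => G₂ (b, ζ)))) :=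
          mul_le_mul_right (mul_le_mul_right (hC (a + b) h (fun ζ => G₁ (a, ζ))
            (fun ζ => G₂ (b, ζ)) hh (by fun_prop) (by fun_prop)) _) _
      _ = _ := by ring
  have hm : ∀ g : Freq → ℝ≥0∞, Measurable g →
      Measurable fun σ : ℝ => jb (p / 2) σ * l2 (fun ζ : ℝ × ℝ => g (σ, ζ)) := by
    intro g hg
    have : Measurable fun σ : ℝ => l2 (fun ζ : ℝ × ℝ => g (σ, ζ)) := by
      unfold l2
      exact (Measurable.lintegral_prod_right' (f := fun k : Freq => g k ^ 2)
        (hg.pow_const 2)).pow_const _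
    fun_prop
  have hm1 := hm G₁ hG₁m
  have hm2 := hm G₂ hG₂m
  calc _ ≤ ∫⁻ a, ∫⁻ b, (C * l2 h) * ((jb (p / 2) a * l2 fun ζ => G₁ (a, ζ)) *
        (jb (p / 2) b * l2 fun ζ => G₂ (b, ζ))) :=
        lintegral_mono fun a => lintegral_mono fun b => hfib a b
    _ = (C * l2 h) * ((∫⁻ a, jb (p / 2) a * l2 fun ζ => G₁ (a, ζ)) *
        ∫⁻ b, jb (p / 2) b * l2 fun ζ => G₂ (b, ζ)) := by
        have : ∀ a : ℝ, ∫⁻ b, (C * l2 h) * ((jb (p / 2) a * l2 fun ζ => G₁ (a, ζ)) *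
          (jb (p / 2) b * l2 fun ζ => G₂ (b, ζ))) = (C * l2 h) *
          ((jb (p / 2) a * l2 fun ζ => G₁ (a, ζ)) *
            ∫⁻ b, jb (p / 2) b * l2 fun ζ => G₂ (b, ζ)) := by
          intro a
          rw [lintegral_const_mul _ (by fun_prop), lintegral_const_mul _ hm2]
        simp_rw [this]
        rw [lintegral_const_mul _ (by fun_prop), lintegral_mul_const _ hm1]
    _ ≤ (C * l2 h) * ((I * l2 G₁) * (I * l2 G₂)) := by
        rw [show (I : ℝ≥0∞) = _ from hI']
        exact mul_le_mul_right (mul_le_mul' (lintegral_jb_mul_l2_le hG₁m)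
          (lintegral_jb_mul_l2_le hG₂m)) _
    _ = _ := by
        rw [hG₁, hG₂, hl g₁ hg₁, hl g₂ hg₂]
        push_cast
        ring

/-! ### The trilinear estimate -/

/-- The reflection `(τ, ξ, μ) ↦ (ε τ, ε ξ, δ μ)`. -/
def reflect (ε δ : ℝ) (k : Freq) : Freq := (ε * k.1, ε * k.2.1, δ * k.2.2)

lemma measurePreserving_mul_sign {ε : ℝ} (hε : ε = 1 ∨ ε = -1) :
    MeasurePreserving (fun x : ℝ => ε * x) := by
  rcases hε with rfl | rfl
  · simp only [one_mul]
    exact MeasurePreserving.id _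
  · simp only [neg_mul, one_mul]
    exact Measure.measurePreserving_neg volume

lemma measurePreserving_reflect {ε δ : ℝ} (hε : ε = 1 ∨ ε = -1) (hδ : δ = 1 ∨ δ = -1) :
    MeasurePreserving (reflect ε δ) :=
  (measurePreserving_mul_sign hε).prod
    ((measurePreserving_mul_sign hε).prod (measurePreserving_mul_sign hδ))

lemma reflect_add (ε δ : ℝ) (a b : Freq) : reflect ε δ (a + b) = reflect ε δ a + reflect ε δ b := by
  simp only [reflect, Prod.fst_add, Prod.snd_add, mul_add, Prod.mk_add_mk]

lemma reflect_reflect {ε δ : ℝ} (hε : ε = 1 ∨ ε = -1) (hδ : δ = 1 ∨ δ = -1) (a : Freq) :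
    reflect ε δ (reflect ε δ a) = a := by
  have h1 : ε * ε = 1 := by rcases hε with rfl | rfl <;> norm_num
  have h2 : δ * δ = 1 := by rcases hδ with rfl | rfl <;> norm_num
  simp only [reflect, ← mul_assoc, h1, h2, one_mul]

lemma modulation_reflect (α : ℝ) {ε δ : ℝ} (hε : ε = 1 ∨ ε = -1) (hδ : δ = 1 ∨ δ = -1) (k : Freq) :
    modulation α (reflect ε δ k) = ε * modulation α k := by
  simp only [modulation, reflect, omega]
  rcases hε with rfl | rfl <;> rcases hδ with rfl | rfl <;> ring

lemma abs_sign_mul {ε : ℝ} (hε : ε = 1 ∨ ε = -1) (x : ℝ) : |ε * x| = |x| := by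
  rcases hε with rfl | rfl <;> simp

lemma jb_sign_mul {ε : ℝ} (hε : ε = 1 ∨ ε = -1) (p x : ℝ) : jb p (ε * x) = jb p x := by
  rcases hε with rfl | rfl <;> simp [jb_neg]

lemma ker_reflect (α p q : ℝ) {ε δ : ℝ} (hε : ε = 1 ∨ ε = -1) (hδ : δ = 1 ∨ δ = -1)
    (a b : Freq) : ker α p q (reflect ε δ a) (reflect ε δ b) = ker α p q a b := by
  unfold ker
  rw [← reflect_add, modulation_reflect α hε hδ, modulation_reflect α hε hδ,
    modulation_reflect α hε hδ, jb_sign_mul hε, jb_sign_mul hε, jb_sign_mul hε]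
  simp only [reflect]
  rw [← mul_add, abs_sign_mul hε]

lemma kap_reflect {ε δ : ℝ} (hε : ε = 1 ∨ ε = -1) (a b : Freq) :
    kap (reflect ε δ a).2 (reflect ε δ b).2 = δ * kap a.2 b.2 := by
  simp only [kap, reflect]
  rcases hε with rfl | rfl
  · simp only [one_mul]
    ring
  · rw [← mul_add, neg_one_mul, div_neg, neg_one_mul, neg_one_mul, div_neg, div_neg]
    ring

lemma resSize_reflect {ε δ : ℝ} (hε : ε = 1 ∨ ε = -1) (a b : Freq) :
    resSize (reflect ε δ a, reflect ε δ b) = resSize (a, b) := by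
  simp only [resSize, reflect]
  rw [← mul_add, abs_sign_mul hε, abs_sign_mul hε, abs_sign_mul hε]

/-- The kernel `W` is measurable and defines a bounded form. -/
def IsBoundedKernel (W : Freq → Freq → ℝ≥0∞) : Prop :=
  Measurable (Function.uncurry W) ∧ ∃ C : ℝ≥0, FormBound W C

lemma IsBoundedKernel.add {W W' : Freq → Freq → ℝ≥0∞} (h : IsBoundedKernel W)
    (h' : IsBoundedKernel W') : IsBoundedKernel fun a b => W a b + W' a b := by
  obtain ⟨hm, C, hC⟩ := h
  obtain ⟨hm', C', hC'⟩ := h'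
  exact ⟨hm.add hm', C + C', by push_cast; exact hC.add hC' hm⟩

lemma isBoundedKernel_kerOn {α p q : ℝ} {A : Set (Freq × Freq)}
    (h : ∃ C : ℝ≥0, FormBound (kerOn α p q A) C) (hA : MeasurableSet A) :
    IsBoundedKernel (kerOn α p q A) :=
  ⟨measurable_kerOn α p q hA, h⟩

lemma isBoundedKernel_reflect (α : ℝ) {p q : ℝ} (hp : 1 < p) (hq : 1 / 2 < q)
    {ε δ : ℝ} (hε : ε = 1 ∨ ε = -1) (hδ : δ = 1 ∨ δ = -1) :
    IsBoundedKernel fun a b => kerOn α p q (resonantRegion α) (reflect ε δ a)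
      (reflect ε δ b) := by
  obtain ⟨C, hC⟩ := exists_formBound_resonantRegion α hp hq
  have hm := measurable_kerOn α p q (measurableSet_resonantRegion α)
  exact ⟨hm.comp
      ((measurePreserving_reflect hε hδ).prod (measurePreserving_reflect hε hδ)).measurable, C,
    hC.comp_involution hm
      (measurePreserving_reflect hε hδ) (reflect_add ε δ) (reflect_reflect hε hδ)⟩

/-- At κ = 0 the last factor of the resonance function is at least 15ξ₂²/4 - 3α, too large to be
balanced by three modulations of size at most `resSize` / 10. -/
lemma kap_ne_zero_of_resonant {α : ℝ} {a b : Freq} (h1 : 1 ≤ |a.2.1|) (h2 : |a.2.1| ≤ |b.2.1|)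
    (h3 : 10 + 10 * |α| ≤ |b.2.1|) (h4 : a.2.1 + b.2.1 ≠ 0)
    (h5 : |modulation α (a + b)| ≤ resSize (a, b) / 10)
    (h6 : |modulation α a| ≤ resSize (a, b) / 10) (h7 : |modulation α b| ≤ resSize (a, b) / 10) :
    kap a.2 b.2 ≠ 0 := by
  intro h0
  have ha : a.2.1 ≠ 0 := fun h => by rw [h, abs_zero] at h1; linarith
  have hb : b.2.1 ≠ 0 := fun h => by rw [h, abs_zero] at h3; linarith [abs_nonneg α]
  have hr := resPair_eq_res (α := α) ha hb h4
  rw [h0] at hr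
  have e : resPair α a.2 b.2 = modulation α a + modulation α b - modulation α (a + b) := by
    simp only [resPair, modulation, Prod.fst_add, Prod.snd_add]
    ring
  have h8 : |resPair α a.2 b.2| ≤ 3 / 10 * resSize (a, b) := by
    rw [e]
    refine (abs_sub _ _).trans ?_
    have := abs_add_le (modulation α a) (modulation α b)
    linarith
  rw [hr, res] at h8
  simp only [resSize] at h8
  set x := b.2.1
  set y := a.2.1
  rw [abs_mul, abs_mul, abs_mul] at h8
  have hpos : 0 < |y + x| * |y| * |x| := by positivity
  have h9 : |5 * (y ^ 2 + y * x + x ^ 2) - 3 * α - 0 ^ 2| ≤ 3 / 10 * |x| ^ 2 := by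
    refine le_of_mul_le_mul_left ?_ hpos
    calc _ ≤ _ := h8
      _ = _ := by ring
  rw [sq_abs] at h9
  have h10 := (abs_le.1 h9).2
  have hα := le_abs_self α
  have hα' := abs_nonneg α
  have hx2 : x ^ 2 = |x| ^ 2 := (sq_abs x).symm
  nlinarith [sq_nonneg (2 * y + x)]

lemma exists_sign_mul_eq_abs (x : ℝ) : ∃ ε : ℝ, (ε = 1 ∨ ε = -1) ∧ ε * x = |x| := by
  rcases abs_choice x with h | h
  · exact ⟨1, Or.inl rfl, by rw [h, one_mul]⟩
  · exact ⟨-1, Or.inr rfl, by rw [h, neg_one_mul]⟩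

/-- The sign of ξ₂ is corrected by reflecting (τ, ξ), under which ω is odd, and the sign of κ by
reflecting μ, under which ω is even. Modulations change at most in sign. -/
lemma exists_reflect_mem_resonantRegion {α : ℝ} {a b : Freq} (h1 : 1 ≤ |a.2.1|)
    (h2 : |a.2.1| ≤ |b.2.1|) (h3 : 10 + 10 * |α| ≤ |b.2.1|) (h4 : a.2.1 + b.2.1 ≠ 0)
    (h5 : |modulation α (a + b)| ≤ resSize (a, b) / 10)
    (h6 : |modulation α a| ≤ resSize (a, b) / 10) (h7 : |modulation α b| ≤ resSize (a, b) / 10) :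
    ∃ ε δ : ℝ, (ε = 1 ∨ ε = -1) ∧ (δ = 1 ∨ δ = -1) ∧
      (reflect ε δ a, reflect ε δ b) ∈ resonantRegion α := by
  have hk := kap_ne_zero_of_resonant h1 h2 h3 h4 h5 h6 h7
  obtain ⟨ε, hε, he⟩ := exists_sign_mul_eq_abs b.2.1
  obtain ⟨δ, hδ, hd⟩ := exists_sign_mul_eq_abs (kap a.2 b.2)
  refine ⟨ε, δ, hε, hδ, ⟨?_, ?_, ?_, ?_, ?_⟩, ?_, ?_, ?_⟩
  · simp only [reflect]
    rwa [abs_sign_mul hε]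
  · simp only [reflect]
    rwa [abs_sign_mul hε, he]
  · simp only [reflect]
    rwa [he]
  · simp only [reflect]
    have hne : ε * a.2.1 + ε * b.2.1 ≠ 0 := by
      rw [← mul_add]
      refine mul_ne_zero ?_ h4
      rcases hε with rfl | rfl <;> norm_num
    refine lt_of_le_of_ne ?_ hne.symm
    have := neg_abs_le (ε * a.2.1)
    rw [abs_sign_mul hε] at this
    linarith
  · simp only [kap_reflect hε, hd]
    exact abs_pos.2 hk
  · simp only
    rwa [← reflect_add, modulation_reflect α hε hδ, abs_sign_mul hε, resSize_reflect hε]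
  · simp only
    rwa [modulation_reflect α hε hδ, abs_sign_mul hε, resSize_reflect hε]
  · simp only
    rwa [modulation_reflect α hε hδ, abs_sign_mul hε, resSize_reflect hε]

/-- The trilinear estimate on `|ξ₁| ≤ |ξ₂|`. -/
lemma exists_isBoundedKernel_half (α : ℝ) {p q : ℝ} (hp : 1 < p) (hq : 3 / 4 ≤ q) (hpq : q ≤ p) :
    ∃ W : Freq → Freq → ℝ≥0∞, IsBoundedKernel W ∧
      ∀ a b, |a.2.1| ≤ |b.2.1| → ker α p q a b ≤ W a b := by
  have hq' : 1 / 2 < q := by linarith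
  have hs1 : (1 : ℝ) = 1 ∨ (1 : ℝ) = -1 := Or.inl rfl
  have hs2 : (-1 : ℝ) = 1 ∨ (-1 : ℝ) = -1 := Or.inr rfl
  have hrs := measurable_resSize
  have h₁ := isBoundedKernel_kerOn (exists_formBound_low α hp (by linarith : 0 ≤ q)
    (10 + 10 * |α|)) (measurableSet_and (measurableSet_le (by fun_prop) (by fun_prop))
      (measurableSet_le (by fun_prop) (by fun_prop)))
  have h₂ := isBoundedKernel_kerOn (exists_formBound_lowHigh α hp (by linarith : 0 ≤ q))
    (measurableSet_and (measurableSet_le (by fun_prop) (by fun_prop))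
      (measurableSet_le (by fun_prop) (by fun_prop)))
  have h₃ := isBoundedKernel_kerOn (exists_formBound_sum_nonresonant α hp hq)
    (measurableSet_highRegion.inter (measurableSet_le (hrs.div_const 10) (by fun_prop)))
  have h₄ := isBoundedKernel_kerOn (exists_formBound_right_nonresonant α hp hq hpq)
    (measurableSet_highRegion.inter (measurableSet_le (hrs.div_const 10) (by fun_prop)))
  have h₅ := isBoundedKernel_kerOn (exists_formBound_left_nonresonant α hp hq' hpq)
    (measurableSet_highRegion.inter (measurableSet_le (hrs.div_const 10) (by fun_prop)))
  have h₆ := isBoundedKernel_reflect α hp hq' hs1 hs1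
  have h₇ := isBoundedKernel_reflect α hp hq' hs1 hs2
  have h₈ := isBoundedKernel_reflect α hp hq' hs2 hs1
  have h₉ := isBoundedKernel_reflect α hp hq' hs2 hs2
  -- The majorant adds five restricted kernels and the four reflections of the resonant one; each
  -- pair lies in at least one region unless ξ₁ + ξ₂ = 0, where the kernel vanishes.
  refine ⟨_, (((((((h₁.add h₂).add h₃).add h₄).add h₅).add h₆).add h₇).add h₈).add h₉,
    fun a b hab => ?_⟩
  by_cases hN : |b.2.1| ≤ 10 + 10 * |α|
  · refine le_add_right (le_add_right (le_add_right (le_add_right (le_add_right (le_add_right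
      (le_add_right (le_add_right ?_)))))))
    exact le_of_eq (Eq.symm (kerOn_of_mem ⟨hab.trans hN, hN⟩))
  push Not at hN
  by_cases h1 : |a.2.1| ≤ 1
  · refine le_add_right (le_add_right (le_add_right (le_add_right (le_add_right (le_add_right
      (le_add_right (le_add_left ?_)))))))
    exact le_of_eq (Eq.symm (kerOn_of_mem ⟨h1, hN.le⟩))
  push Not at h1
  by_cases h5 : resSize (a, b) / 10 ≤ |modulation α (a + b)|
  · refine le_add_right (le_add_right (le_add_right (le_add_right (le_add_right (le_add_right
      (le_add_left ?_))))))
    exact le_of_eq (Eq.symm (kerOn_of_mem ⟨⟨h1.le, hab⟩, h5⟩))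
  by_cases h7 : resSize (a, b) / 10 ≤ |modulation α b|
  · refine le_add_right (le_add_right (le_add_right (le_add_right (le_add_right
      (le_add_left ?_)))))
    exact le_of_eq (Eq.symm (kerOn_of_mem ⟨⟨h1.le, hab⟩, h7⟩))
  by_cases h6 : resSize (a, b) / 10 ≤ |modulation α a|
  · refine le_add_right (le_add_right (le_add_right (le_add_right (le_add_left ?_))))
    exact le_of_eq (Eq.symm (kerOn_of_mem ⟨⟨h1.le, hab⟩, h6⟩))
  push Not at h5 h6 h7
  by_cases h4 : a.2.1 + b.2.1 = 0
  · simp [ker, h4]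
  obtain ⟨ε, δ, hε, hδ, hm⟩ :=
    exists_reflect_mem_resonantRegion h1.le hab hN.le h4 h5.le h6.le h7.le
  have hk : ker α p q a b =
      kerOn α p q (resonantRegion α) (reflect ε δ a) (reflect ε δ b) := by
    rw [kerOn_of_mem hm, ker_reflect α p q hε hδ]
  rcases hε with rfl | rfl <;> rcases hδ with rfl | rfl
  · exact le_add_right (le_add_right (le_add_right (le_add_left hk.le)))
  · exact le_add_right (le_add_right (le_add_left hk.le))
  · exact le_add_right (le_add_left hk.le)
  · exact le_add_left hk.le

/-- The trilinear form of the bilinear estimate is bounded on `L²`. -/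
lemma exists_formBound_ker (α : ℝ) {p q : ℝ} (hp : 1 < p) (hq : 3 / 4 ≤ q) (hpq : q ≤ p) :
    ∃ C : ℝ≥0, FormBound (ker α p q) C := by
  obtain ⟨W, ⟨hm, C, hC⟩, hle⟩ := exists_isBoundedKernel_half α hp hq hpq
  refine ⟨C + C, ?_⟩
  push_cast
  refine (hC.add hC.swap hm).mono fun a b => ?_
  rcases le_total |a.2.1| |b.2.1| with h | h
  · exact le_add_right (hle a b h)
  · rw [ker_comm]
    exact le_add_left (hle b a h)

/-! ### The bilinear estimate by duality -/

/-- The weighted convolution `k ↦ ∫ W(k₁, k - k₁) g₁(k₁) g₂(k - k₁) dk₁`. -/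
def wconv (W : Freq → Freq → ℝ≥0∞) (g₁ g₂ : Freq → ℝ≥0∞) (k : Freq) : ℝ≥0∞ :=
  ∫⁻ k₁, W k₁ (k - k₁) * g₁ k₁ * g₂ (k - k₁)

lemma measurable_wconv {W : Freq → Freq → ℝ≥0∞} (hW : Measurable (Function.uncurry W))
    {g₁ g₂ : Freq → ℝ≥0∞} (hg₁ : Measurable g₁) (hg₂ : Measurable g₂) :
    Measurable (wconv W g₁ g₂) := by
  have hs : Measurable fun z : Freq × Freq => z.1 - z.2 := measurable_fst.sub measurable_snd
  have h1 : Measurable fun z : Freq × Freq => W z.2 (z.1 - z.2) :=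
    hW.comp (measurable_snd.prodMk hs)
  exact Measurable.lintegral_prod_right' (f := fun z : Freq × Freq =>
    W z.2 (z.1 - z.2) * g₁ z.2 * g₂ (z.1 - z.2))
    ((h1.mul (hg₁.comp measurable_snd)).mul (hg₂.comp hs))

lemma lintegral_mul_wconv {W : Freq → Freq → ℝ≥0∞} (hW : Measurable (Function.uncurry W))
    {h g₁ g₂ : Freq → ℝ≥0∞} (hh : Measurable h) (hg₁ : Measurable g₁) (hg₂ : Measurable g₂) :
    ∫⁻ k, h k * wconv W g₁ g₂ k = form W h g₁ g₂ := by
  have hs : Measurable fun z : Freq × Freq => z.1 - z.2 := measurable_fst.sub measurable_snd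
  have h1 : Measurable fun z : Freq × Freq => W z.2 (z.1 - z.2) :=
    hW.comp (measurable_snd.prodMk hs)
  have h2 : Measurable fun z : Freq × Freq => W z.2 (z.1 - z.2) * g₁ z.2 * g₂ (z.1 - z.2) :=
    (h1.mul (hg₁.comp measurable_snd)).mul (hg₂.comp hs)
  have hW' : Measurable fun z : Freq × Freq => W z.1 z.2 := hW
  calc ∫⁻ k, h k * wconv W g₁ g₂ k
      = ∫⁻ k, ∫⁻ k₁, h k * (W k₁ (k - k₁) * g₁ k₁ * g₂ (k - k₁)) := by
        refine lintegral_congr fun k => ?_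
        rw [wconv, lintegral_const_mul]
        exact h2.comp (measurable_const.prodMk measurable_id)
    _ = ∫⁻ k₁, ∫⁻ k, h k * (W k₁ (k - k₁) * g₁ k₁ * g₂ (k - k₁)) := by
        refine lintegral_lintegral_swap (Measurable.aemeasurable ?_)
        exact (hh.comp measurable_fst).mul h2
    _ = ∫⁻ k₁, ∫⁻ k₂, W k₁ k₂ * h (k₁ + k₂) * g₁ k₁ * g₂ k₂ := by
        refine lintegral_congr fun k₁ => ?_
        rw [← lintegral_add_left_eq_self _ k₁]
        refine lintegral_congr fun k₂ => ?_
        rw [add_sub_cancel_left]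
        ring
    _ = _ := by
        rw [form, Measure.volume_eq_prod Freq Freq, lintegral_prod _ (by fun_prop)]

/-- Duality for the `L²` norm. -/
lemma l2_le_of_forall_lintegral_mul_le {X : Type*} [MeasureSpace X]
    [SigmaFinite (volume : Measure X)] {Φ : X → ℝ≥0∞}
    (hΦ : Measurable Φ) {C : ℝ≥0∞}
    (h : ∀ f : X → ℝ≥0∞, Measurable f → ∫⁻ x, f x * Φ x ≤ C * l2 f) : l2 Φ ≤ C := by
  -- Testing against Φ itself is not allowed before its norm is known to be finite. The truncations
  -- have finite norm, which can be cancelled, and monotone convergence removes them.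
  set f : ℕ → X → ℝ≥0∞ := fun n =>
    (spanningSets (volume : Measure X) n).indicator (fun x => min (Φ x) n) with hf
  have hfm : ∀ n, Measurable (f n) := fun n =>
    (hΦ.min measurable_const).indicator (measurableSet_spanningSets _ n)
  have hfin : ∀ n, l2 (f n) ≠ ∞ := by
    intro n
    refine ENNReal.rpow_ne_top_of_nonneg (by norm_num) (ne_of_lt ?_)
    calc ∫⁻ x, f n x ^ 2 ≤ ∫⁻ x, (spanningSets (volume : Measure X) n).indicator
          (fun _ => (n : ℝ≥0∞) ^ 2) x := by
          refine lintegral_mono fun x => ?_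
          by_cases hx : x ∈ spanningSets (volume : Measure X) n
          · simp only [hf, Set.indicator_of_mem hx]
            gcongr
            exact min_le_right _ _
          · simp [hf, Set.indicator_of_notMem hx]
      _ = (n : ℝ≥0∞) ^ 2 * volume (spanningSets (volume : Measure X) n) :=
          lintegral_indicator_const (measurableSet_spanningSets _ n) _
      _ < ∞ := ENNReal.mul_lt_top (by finiteness) (measure_spanningSets_lt_top _ n)
  have hle : ∀ n x, f n x ≤ Φ x := by
    intro n x
    refine (Set.indicator_le_self _ _ _).trans (min_le_left _ _)
  have hb : ∀ n, l2 (f n) ≤ C := by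
    intro n
    by_cases h0 : l2 (f n) = 0
    · rw [h0]
      exact zero_le
    have h1 : l2 (f n) * l2 (f n) ≤ C * l2 (f n) := by
      refine le_trans ?_ (h (f n) (hfm n))
      rw [← pow_two, l2_sq]
      refine lintegral_mono fun x => ?_
      simp only [pow_two]
      exact mul_le_mul_right (hle n x) _
    exact (ENNReal.mul_le_mul_iff_left h0 (hfin n)).1 h1
  have hmono : Monotone fun n x => f n x ^ 2 := by
    intro m n hmn x
    simp only [hf]
    gcongr
    by_cases hx : x ∈ spanningSets (volume : Measure X) m
    · rw [Set.indicator_of_mem hx, Set.indicator_of_mem (monotone_spanningSets _ hmn hx)]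
      exact min_le_min_left _ (by exact_mod_cast hmn)
    · rw [Set.indicator_of_notMem hx]
      exact zero_le
  have hsup : ∀ x, ⨆ n, f n x ^ 2 = Φ x ^ 2 := by
    intro x
    refine iSup_eq_of_tendsto (fun m n hmn => hmono hmn x) ?_
    have h1 : Filter.Tendsto (fun n : ℕ => min (Φ x) n ^ 2) Filter.atTop (nhds (Φ x ^ 2)) := by
      have h2 := (tendsto_const_nhds (x := Φ x)).min ENNReal.tendsto_nat_nhds_top
      rw [min_eq_left le_top] at h2
      exact ENNReal.Tendsto.pow h2
    refine h1.congr' ?_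
    filter_upwards [Filter.eventually_ge_atTop (spanningSetsIndex (volume : Measure X) x)]
      with n hn
    have hx : x ∈ spanningSets (volume : Measure X) n :=
      monotone_spanningSets _ hn (mem_spanningSetsIndex _ x)
    simp only [hf, Set.indicator_of_mem hx]
  refine le_of_sq_le_sq_ennreal ?_
  rw [l2_sq]
  simp_rw [← hsup]
  rw [lintegral_iSup (fun n => (hfm n).pow_const 2) hmono]
  refine iSup_le fun n => ?_
  rw [← l2_sq]
  gcongr
  exact hb n

/-- The bilinear estimate in Fourier variables. -/
lemma exists_l2_wconv_ker_le (α : ℝ) {p q : ℝ} (hp : 1 < p) (hq : 3 / 4 ≤ q) (hpq : q ≤ p) :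
    ∃ C : ℝ≥0, ∀ g₁ g₂ : Freq → ℝ≥0∞, Measurable g₁ → Measurable g₂ →
      l2 (wconv (ker α p q) g₁ g₂) ≤ C * l2 g₁ * l2 g₂ := by
  obtain ⟨C, hC⟩ := exists_formBound_ker α hp hq hpq
  have hm : Measurable (Function.uncurry (ker α p q)) := measurable_ker α p q
  refine ⟨C, fun g₁ g₂ hg₁ hg₂ => l2_le_of_forall_lintegral_mul_le (measurable_wconv hm hg₁ hg₂)
    fun f hf => ?_⟩
  rw [lintegral_mul_wconv hm hf hg₁ hg₂]
  exact (hC f g₁ g₂ hf hg₁ hg₂).trans (le_of_eq (by ring))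

/-! ### Representatives of tempered distributions -/

lemma IsGivenBy.locallyIntegrable {f : 𝓢'(SpaceTime, ℂ)} {F : SpaceTime → ℂ} (hF : IsGivenBy f F) :
    LocallyIntegrable F := by
  intro x
  let b : ContDiffBump x := ⟨1, 2, one_pos, one_lt_two⟩
  have hg₁ : HasCompactSupport (Complex.ofRealCLM ∘ b) := b.hasCompactSupport.comp_left rfl
  have hg₂ : ContDiff ℝ (⊤ : ℕ∞) (Complex.ofRealCLM ∘ b) :=
    Complex.ofRealCLM.contDiff.comp b.contDiff
  refine ⟨Metric.closedBall x 1, Metric.closedBall_mem_nhds x one_pos, ?_⟩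
  refine ((hF (hg₁.toSchwartzMap hg₂)).1.integrableOn (s := Metric.closedBall x 1)).congr_fun
    (fun y hy => ?_) measurableSet_closedBall
  have h1 : b y = 1 := b.one_of_mem_closedBall hy
  simp [h1]

/-- Smooth compactly supported test functions already separate locally integrable functions. Hence
the infimum defining `bourgainNorm` runs over a single almost everywhere class, so norms can also be
bounded from below. -/
lemma IsGivenBy.ae_eq {f : 𝓢'(SpaceTime, ℂ)} {F G : SpaceTime → ℂ} (hF : IsGivenBy f F)
    (hG : IsGivenBy f G) : F =ᵐ[volume] G := by
  refine ae_eq_of_integral_contDiff_smul_eq hF.locallyIntegrable hG.locallyIntegrable ?_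
  intro g g_smooth g_cpt
  have hg₁ : HasCompactSupport (Complex.ofRealCLM ∘ g) := g_cpt.comp_left rfl
  have hg₂ : ContDiff ℝ (⊤ : ℕ∞) (Complex.ofRealCLM ∘ g) := by fun_prop
  have h1 := (hF (hg₁.toSchwartzMap hg₂)).2
  have h2 := (hG (hg₁.toSchwartzMap hg₂)).2
  simpa using h1.symm.trans h2

lemma isGivenBy_fourier (u : Lp ℂ 2 (volume : Measure SpaceTime)) :
    IsGivenBy (𝓕 (Lp.toTemperedDistribution u)) (𝓕 u : Lp ℂ 2 (volume : Measure SpaceTime)) := by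
  intro φ
  constructor
  · exact (φ.memLp 2 volume).integrable_mul (Lp.memLp (𝓕 u))
  · rw [Lp.fourier_toTemperedDistribution_eq, Lp.toTemperedDistribution_apply]
    rfl

/-! ### The Fourier transform of a product -/

/-- The convolution of Schwartz functions unfolds to 𝓕⁻ of the product of transforms; as 𝓕𝓕 is the
reflection, that product is φχ reflected, and the reflection turns 𝓕⁻ back into 𝓕. -/
lemma convolution_fourier_apply (φ χ : 𝓢(SpaceTime, ℂ)) (k : SpaceTime) :
    SchwartzMap.convolution (ContinuousLinearMap.mul ℂ ℂ) (𝓕 φ) (𝓕 χ) k =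
      𝓕 (fun x => φ x * χ x) k := by
  have h3 : ∀ (θ : 𝓢(SpaceTime, ℂ)) (y : SpaceTime), 𝓕 (𝓕 θ) y = θ (-y) := by
    intro θ y
    have h4 : 𝓕⁻ (𝓕 θ) (-y) = θ (-y) := by rw [FourierTransform.fourierInv_fourier_eq]
    rw [← h4, SchwartzMap.fourierInv_coe, SchwartzMap.fourier_coe,
      Real.fourierInv_eq_fourier_neg, neg_neg]
  change (𝓕⁻ (SchwartzMap.pairing (ContinuousLinearMap.mul ℂ ℂ) (𝓕 (𝓕 φ)) (𝓕 (𝓕 χ)))) k = _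
  rw [SchwartzMap.fourierInv_coe, Real.fourierInv_eq_fourier_comp_neg]
  refine congrArg (fun f : SpaceTime → ℂ => 𝓕 f k) (funext fun y => ?_)
  simp [h3]

set_option maxHeartbeats 800000 in
/-- The product of two square integrable functions, integrated against a character. -/
lemma integral_fourier_mul_fourier_sub (u v : Lp ℂ 2 (volume : Measure SpaceTime))
    (k : SpaceTime) :
    ∫ k', (𝓕 u : Lp ℂ 2 (volume : Measure SpaceTime)) k' *
      (𝓕 v : Lp ℂ 2 (volume : Measure SpaceTime)) (k - k') = 𝓕 (fun x => u x * v x) k := by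
  have hmp : MeasurePreserving (fun k' : SpaceTime => k - k') := 
    Measure.measurePreserving_sub_left volume k
  set e : SpaceTime → ℂ := fun x => (Real.fourierChar (-(inner ℝ x k)) : ℂ) with he
  have hem : MemLp e ∞ (volume : Measure SpaceTime) := by
    refine memLp_top_of_bound (C := 1) ?_ (Filter.Eventually.of_forall fun x => ?_)
    · refine Continuous.aestronglyMeasurable ?_
      fun_prop
    · exact (Circle.norm_coe _).le
  set B := ContinuousLinearMap.mul ℂ ℂ
  set comp := (Lp.compMeasurePreservingₗᵢ ℂ (fun k' : SpaceTime => k - k') hmp :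
    Lp ℂ 2 (volume : Measure SpaceTime) →ₗᵢ[ℂ] Lp ℂ 2 (volume : Measure SpaceTime))
  have hL : ∀ f g : Lp ℂ 2 (volume : Measure SpaceTime),
      ∫ k', f k' * g (k - k') = B.lpPairing volume 2 2 f (comp g) := by
    intro f g
    rw [ContinuousLinearMap.lpPairing_eq_integral]
    refine integral_congr_ae ?_
    filter_upwards [Lp.coeFn_compMeasurePreserving g hmp] with x hx
    simp only [B, ContinuousLinearMap.mul_apply']
    congr 1
    exact hx.symm
  have hR : ∀ f g : Lp ℂ 2 (volume : Measure SpaceTime), 𝓕 (fun x => f x * g x) k =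
      B.lpPairing volume 2 2 (B.holderL volume ∞ 2 2 (hem.toLp e) f) g := by
    intro f g
    rw [ContinuousLinearMap.lpPairing_eq_integral, Real.fourier_eq]
    refine integral_congr_ae ?_
    filter_upwards [B.coeFn_holder (r := 2) (hem.toLp e) f, hem.coeFn_toLp] with x hx hx2
    simp only [ContinuousLinearMap.holderL_apply_apply]
    rw [hx, hx2]
    simp only [B, ContinuousLinearMap.mul_apply', he, Circle.smul_def, smul_eq_mul]
    ring
  have hd := SchwartzMap.denseRange_toLpCLM (E := SpaceTime) (F := ℂ) (p := 2)
    (μ := (volume : Measure SpaceTime)) ENNReal.ofNat_ne_top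
  rw [hL, hR]
  -- At fixed k both sides are continuous bilinear forms on L², since 𝓕, translated reflection and
  -- multiplication by the character are bounded; density reduces the identity to Schwartz
  -- functions.
  refine hd.induction_on u (p := fun u => B.lpPairing volume 2 2 (𝓕 u) (comp (𝓕 v)) =
    B.lpPairing volume 2 2 (B.holderL volume ∞ 2 2 (hem.toLp e) u) v)
    (isClosed_eq (by fun_prop) (by fun_prop)) fun φ => ?_
  refine hd.induction_on v (p := fun v => B.lpPairing volume 2 2
    (𝓕 (SchwartzMap.toLpCLM ℝ ℂ 2 volume φ)) (comp (𝓕 v)) =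
    B.lpPairing volume 2 2 (B.holderL volume ∞ 2 2 (hem.toLp e)
      (SchwartzMap.toLpCLM ℝ ℂ 2 volume φ)) v)
    (isClosed_eq (by fun_prop) (by fun_prop)) fun χ => ?_
  rw [← hL, ← hR]
  simp only [SchwartzMap.toLpCLM_apply, SchwartzMap.toLp_fourier_eq]
  have h1 : ∫ k', ((𝓕 φ).toLp 2 : Lp ℂ 2 (volume : Measure SpaceTime)) k' *
      ((𝓕 χ).toLp 2 : Lp ℂ 2 (volume : Measure SpaceTime)) (k - k') =
      SchwartzMap.convolution B (𝓕 φ) (𝓕 χ) k := by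
    rw [SchwartzMap.convolution_apply]
    refine integral_congr_ae ?_
    filter_upwards [(𝓕 φ).coeFn_toLp 2 (volume : Measure SpaceTime),
      hmp.quasiMeasurePreserving.ae ((𝓕 χ).coeFn_toLp 2 (volume : Measure SpaceTime))]
      with x hx hx'
    rw [hx, hx']
    rfl
  have h2 : 𝓕 (fun x => (φ.toLp 2 : Lp ℂ 2 (volume : Measure SpaceTime)) x *
      (χ.toLp 2 : Lp ℂ 2 (volume : Measure SpaceTime)) x) k = 𝓕 (fun x => φ x * χ x) k := by
    rw [Real.fourier_eq, Real.fourier_eq]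
    refine integral_congr_ae ?_
    filter_upwards [φ.coeFn_toLp 2 (volume : Measure SpaceTime),
      χ.coeFn_toLp 2 (volume : Measure SpaceTime)] with x hx hx'
    rw [hx, hx']
  rw [h1, h2]
  exact convolution_fourier_apply φ χ k

/-- The Fourier transform of `∂ₓ(uv)` is the function `2πi ξ 𝓕(uv)`. -/
lemma isGivenBy_fourier_dxMul (u v : Lp ℂ 2 (volume : Measure SpaceTime)) :
    IsGivenBy (𝓕 (dxMul u v))
      (fun k => 2 * Real.pi * Complex.I * k 1 * 𝓕 (fun x => u x * v x) k) := by
  set w : Lp ℂ 1 (volume : Measure SpaceTime) := u • v with hw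
  have hwi : Integrable w := L1.integrable_coeFn w
  have hF : 𝓕 (fun x => u x * v x) = 𝓕 (w : SpaceTime → ℂ) := by
    funext k
    refine Real.fourier_congr_ae ?_ k
    filter_upwards [Lp.coeFn_lpSMul (r := 1) u v] with x hx
    rw [hw, hx]
    rfl
  rw [hF]
  have hcont : Continuous (𝓕 (w : SpaceTime → ℂ)) :=
    VectorFourier.fourierIntegral_continuous Real.continuous_fourierChar
      (L := innerₗ SpaceTime) continuous_inner hwi
  have hbd : ∀ k, ‖𝓕 (w : SpaceTime → ℂ) k‖ ≤ ∫ x, ‖w x‖ := fun k =>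
    VectorFourier.norm_fourierIntegral_le_integral_norm _ _ _ _ _
  intro φ
  set m : SpaceTime := EuclideanSpace.single 1 1
  have hm : ∀ k : SpaceTime, inner ℝ k m = k 1 := by
    intro k
    simp [m, EuclideanSpace.inner_single_right]
  set ψ : 𝓢(SpaceTime, ℂ) := SchwartzMap.smulLeftCLM ℂ (fun k => ((inner ℝ k m : ℝ) : ℂ)) φ
  have hψ : ∀ k, ψ k = k 1 * φ k := by
    intro k
    rw [SchwartzMap.smulLeftCLM_apply_apply (by fun_prop), hm]
    rfl
  have hfun : (fun k : SpaceTime => φ k * (2 * Real.pi * Complex.I * k 1 *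
      𝓕 (w : SpaceTime → ℂ) k)) =
      fun k => (2 * Real.pi * Complex.I) * (ψ k * 𝓕 (w : SpaceTime → ℂ) k) := by
    funext k
    rw [hψ]
    ring
  rw [hfun]
  constructor
  · refine Integrable.const_mul ?_ _
    exact ψ.integrable.mul_bdd hcont.aestronglyMeasurable (Filter.Eventually.of_forall hbd)
  · have h1 : (𝓕 (dxMul u v)) φ =
        (2 * Real.pi * Complex.I) * (Lp.toTemperedDistribution w) (𝓕 ψ) := by
      rw [dxMul, TemperedDistribution.fourier_lineDerivOp_eq]
      rfl
    rw [h1, Lp.toTemperedDistribution_apply, integral_const_mul]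
    congr 1
    simpa using! (VectorFourier.integral_fourierIntegral_smul_eq_flip (L := innerₗ SpaceTime)
      Real.continuous_fourierChar continuous_inner ψ.integrable hwi)

/-! ### Bourgain norms as weighted L² norms -/

lemma eLpNorm_two_eq_l2 {X : Type*} [MeasureSpace X] (f : X → ℂ) :
    eLpNorm f 2 volume = l2 fun x => ‖f x‖ₑ := by
  rw [eLpNorm_eq_lintegral_rpow_enorm_toReal two_ne_zero ENNReal.ofNat_ne_top, l2]
  simp

lemma l2_const_mul {X : Type*} [MeasureSpace X] {c : ℝ≥0∞} (hc : c ≠ ∞) (f : X → ℝ≥0∞) :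
    l2 (fun x => c * f x) = c * l2 f := by
  unfold l2
  simp_rw [mul_pow]
  rw [lintegral_const_mul' _ _ (by finiteness), ENNReal.mul_rpow_of_nonneg _ _ (by norm_num),
    ← ENNReal.rpow_natCast, ← ENNReal.rpow_mul]
  norm_num

/-- The weighted Fourier transform of a square integrable function. -/
def weighted (α s₁ s₂ b : ℝ) (u : Lp ℂ 2 (volume : Measure SpaceTime)) (k : SpaceTime) : ℝ≥0∞ :=
  ENNReal.ofReal (weight α s₁ s₂ b k) *
    ‖(𝓕 u : Lp ℂ 2 (volume : Measure SpaceTime)) ((2 * Real.pi)⁻¹ • k)‖ₑ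

lemma weight_pos (α s₁ s₂ b : ℝ) (k : SpaceTime) : 0 < weight α s₁ s₂ b k := by
  have h1 := bracket_pos (k 0 - omega α (k 1) (k 2))
  have h2 := bracket_pos (k 1)
  have h3 := bracket_pos (k 2)
  unfold weight
  positivity

lemma enorm_weight_mul (α s₁ s₂ b : ℝ) (k : SpaceTime) (z : ℂ) :
    ‖(weight α s₁ s₂ b k : ℂ) * z‖ₑ = ENNReal.ofReal (weight α s₁ s₂ b k) * ‖z‖ₑ := by
  rw [enorm_mul]
  congr 1
  rw [← ofReal_norm, Complex.norm_real, Real.norm_of_nonneg (weight_pos ..).le]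

lemma ae_comp_scale {P : SpaceTime → Prop} (h : ∀ᵐ k, P k) :
    ∀ᵐ k : SpaceTime, P ((2 * Real.pi)⁻¹ • k) := by
  have hq : Measure.QuasiMeasurePreserving (fun k : SpaceTime => (2 * Real.pi)⁻¹ • k) := by
    refine ⟨by fun_prop, ?_⟩
    rw [Measure.map_addHaar_smul _ (by positivity)]
    exact Measure.smul_absolutelyContinuous
  exact hq.ae h

lemma l2_weighted_le_bourgainNorm (α s₁ s₂ b : ℝ) (u : Lp ℂ 2 (volume : Measure SpaceTime)) :
    l2 (weighted α s₁ s₂ b u) ≤ bourgainNorm α s₁ s₂ b (Lp.toTemperedDistribution u) := by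
  refine le_iInf₂ fun F hF => ?_
  have hae := ae_comp_scale (hF.ae_eq (isGivenBy_fourier u))
  rw [eLpNorm_two_eq_l2]
  refine le_of_eq ?_
  unfold l2
  congr 1
  refine lintegral_congr_ae ?_
  filter_upwards [hae] with k hk
  rw [hk, enorm_weight_mul]
  rfl

lemma lintegral_eq_scale {f : SpaceTime → ℝ≥0∞} (hf : Measurable f) :
    ∫⁻ k, f k = ENNReal.ofReal ((2 * Real.pi)⁻¹ ^ 3) * ∫⁻ k, f ((2 * Real.pi)⁻¹ • k) := by
  have h := Measure.map_addHaar_smul (volume : Measure SpaceTime) (r := (2 * Real.pi)⁻¹)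
    (by positivity)
  have h2 : ∫⁻ k, f ((2 * Real.pi)⁻¹ • k) =
      ∫⁻ k, f k ∂(Measure.map ((2 * Real.pi)⁻¹ • ·) (volume : Measure SpaceTime)) :=
    (lintegral_map hf (by fun_prop)).symm
  rw [h2, h, lintegral_smul_measure, smul_eq_mul, ← mul_assoc, ← ENNReal.ofReal_mul (by positivity)]
  simp only [finrank_euclideanSpace, Fintype.card_fin]
  rw [abs_of_nonneg (by positivity), mul_inv_cancel₀ (by positivity)]
  simp

/-- The Bourgain norm of `∂ₓ(uv)` in terms of the convolution of the transforms. -/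
lemma bourgainNorm_dxMul_le (α s₁ s₂ b : ℝ) (u v : Lp ℂ 2 (volume : Measure SpaceTime)) :
    bourgainNorm α s₁ s₂ b (dxMul u v) ≤
      ENNReal.ofReal ((2 * Real.pi)⁻¹ ^ 3) * l2 fun k : SpaceTime =>
        ENNReal.ofReal (weight α s₁ s₂ b k * |k 1|) * ∫⁻ k',
        ‖(𝓕 u : Lp ℂ 2 (volume : Measure SpaceTime)) ((2 * Real.pi)⁻¹ • k')‖ₑ *
        ‖(𝓕 v : Lp ℂ 2 (volume : Measure SpaceTime)) ((2 * Real.pi)⁻¹ • (k - k'))‖ₑ := by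
  refine (iInf₂_le _ (isGivenBy_fourier_dxMul u v)).trans ?_
  rw [eLpNorm_two_eq_l2]
  set c := ENNReal.ofReal ((2 * Real.pi)⁻¹ ^ 3)
  set J : SpaceTime → ℝ≥0∞ := fun k => ∫⁻ k',
        ‖(𝓕 u : Lp ℂ 2 (volume : Measure SpaceTime)) ((2 * Real.pi)⁻¹ • k')‖ₑ *
        ‖(𝓕 v : Lp ℂ 2 (volume : Measure SpaceTime)) ((2 * Real.pi)⁻¹ • (k - k'))‖ₑ
  have hf := (Lp.stronglyMeasurable (𝓕 u : Lp ℂ 2 (volume : Measure SpaceTime))).measurable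
  have hg := (Lp.stronglyMeasurable (𝓕 v : Lp ℂ 2 (volume : Measure SpaceTime))).measurable
  have hpt : ∀ k : SpaceTime, ‖(weight α s₁ s₂ b k : ℂ) * (2 * Real.pi * Complex.I *
      ((2 * Real.pi)⁻¹ • k : SpaceTime) 1 *
      𝓕 (fun x => u x * v x) ((2 * Real.pi)⁻¹ • k))‖ₑ ≤
      c * (ENNReal.ofReal (weight α s₁ s₂ b k * |k 1|) * J k) := by
    intro k
    have h1 : ‖𝓕 (fun x => u x * v x) ((2 * Real.pi)⁻¹ • k)‖ₑ ≤ c * J k := by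
      rw [← integral_fourier_mul_fourier_sub]
      refine (enorm_integral_le_lintegral_enorm _).trans ?_
      simp_rw [enorm_mul]
      rw [lintegral_eq_scale (by fun_prop)]
      refine le_of_eq ?_
      simp only [J, smul_sub]
      rfl
    have h2 : (2 * Real.pi * Complex.I * (((2 * Real.pi)⁻¹ • k : SpaceTime) 1 : ℂ)) =
        Complex.I * (k 1 : ℂ) := by
      have hpi : (Real.pi : ℂ) ≠ 0 := by exact_mod_cast Real.pi_ne_zero
      simp only [PiLp.smul_apply, smul_eq_mul]
      push_cast
      field_simp
    rw [enorm_weight_mul, h2, enorm_mul, enorm_mul, ENNReal.ofReal_mul (weight_pos ..).le]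
    have h3 : ‖Complex.I‖ₑ * ‖(k 1 : ℂ)‖ₑ = ENNReal.ofReal |k 1| := by
      rw [← ofReal_norm, ← ofReal_norm]
      simp
    rw [h3]
    calc _ ≤ ENNReal.ofReal (weight α s₁ s₂ b k) * (ENNReal.ofReal |k 1| * (c * J k)) := by
          gcongr
      _ = _ := by ring
  rw [← l2_const_mul ENNReal.ofReal_ne_top]
  unfold l2
  gcongr with k
  exact hpt k

/-! ### Transfer to space-time -/

/-- The identification of `ℝ × ℝ × ℝ` with the Euclidean space `ℝ³`. -/
def toSpaceTime (k : Freq) : SpaceTime := WithLp.toLp 2 ![k.1, k.2.1, k.2.2]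

lemma measurePreserving_toSpaceTime : MeasurePreserving toSpaceTime := by
  have h1 := (volume_preserving_piFinSuccAbove (fun _ : Fin 3 => ℝ) 0).symm
  have h2 := (MeasurePreserving.id (volume : Measure ℝ)).prod (volume_preserving_finTwoArrow ℝ).symm
  have h3 := ((PiLp.volume_preserving_toLp (Fin 3)).comp h1).comp h2
  convert! h3 using 1
  funext k
  refine (WithLp.ofLp_injective 2) (funext fun i => ?_)
  fin_cases i <;> rfl

lemma toSpaceTime_sub (a b : Freq) : toSpaceTime (a - b) = toSpaceTime a - toSpaceTime b := by
  refine (WithLp.ofLp_injective 2) (funext fun i => ?_)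
  fin_cases i <;> rfl

lemma weight_toSpaceTime (α s₁ s₂ b : ℝ) (k : Freq) : weight α s₁ s₂ b (toSpaceTime k) =
    bracket (modulation α k) ^ b * bracket k.2.1 ^ s₁ * bracket k.2.2 ^ s₂ := rfl

@[fun_prop]
lemma measurable_weight (α s₁ s₂ b : ℝ) : Measurable (weight α s₁ s₂ b) := by
  unfold weight
  fun_prop

lemma measurable_weighted (α s₁ s₂ b : ℝ) (u : Lp ℂ 2 (volume : Measure SpaceTime)) :
    Measurable (weighted α s₁ s₂ b u) := by
  have hf := (Lp.stronglyMeasurable (𝓕 u : Lp ℂ 2 (volume : Measure SpaceTime))).measurable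
  unfold weighted
  fun_prop

lemma bracket_add_rpow_le {s : ℝ} (hs : 0 ≤ s) (x y : ℝ) :
    bracket (x + y) ^ s ≤ 2 ^ s * (bracket x ^ s * bracket y ^ s) := by
  have hx := (bracket_pos x).le
  have hy := (bracket_pos y).le
  rw [← Real.mul_rpow hx hy, ← Real.mul_rpow (by norm_num) (by positivity)]
  exact Real.rpow_le_rpow (bracket_pos _).le (bracket_add_le x y) hs

/-- The weights are submultiplicative up to a constant, away from the modulations. -/
lemma weight_mul_le_ker (α : ℝ) {s₁ s₂ : ℝ} (hs₁ : 0 ≤ s₁) (hs₂ : 0 ≤ s₂) (p q : ℝ)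
    (k₁ k₂ : Freq) :
    ENNReal.ofReal (weight α s₁ s₂ (-(q / 2)) (toSpaceTime (k₁ + k₂)) * |k₁.2.1 + k₂.2.1|) ≤
      ENNReal.ofReal (2 ^ s₁ * 2 ^ s₂) * (ker α p q k₁ k₂ *
        ENNReal.ofReal (weight α s₁ s₂ (p / 2) (toSpaceTime k₁)) *
        ENNReal.ofReal (weight α s₁ s₂ (p / 2) (toSpaceTime k₂))) := by
  unfold ker jb
  have b0 := bracket_pos (modulation α (k₁ + k₂))
  have b1 := bracket_pos (modulation α k₁)
  have b2 := bracket_pos (modulation α k₂)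
  have c1 := weight_pos α s₁ s₂ (p / 2) (toSpaceTime k₁)
  have c2 := weight_pos α s₁ s₂ (p / 2) (toSpaceTime k₂)
  rw [← ENNReal.ofReal_mul (by positivity), ← ENNReal.ofReal_mul (by positivity),
    ← ENNReal.ofReal_mul (by positivity), ← ENNReal.ofReal_mul (by positivity),
    ← ENNReal.ofReal_mul (by positivity), ← ENNReal.ofReal_mul (by positivity)]
  refine ENNReal.ofReal_le_ofReal ?_
  rw [weight_toSpaceTime, weight_toSpaceTime, weight_toSpaceTime]
  have e1 : bracket (modulation α k₁) ^ (-(p / 2)) * bracket (modulation α k₁) ^ (p / 2) = 1 := by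
    rw [← Real.rpow_add b1]
    simp
  have e2 : bracket (modulation α k₂) ^ (-(p / 2)) * bracket (modulation α k₂) ^ (p / 2) = 1 := by
    rw [← Real.rpow_add b2]
    simp
  have d1 := bracket_pos k₁.2.1
  have d2 := bracket_pos k₂.2.1
  have d3 := bracket_pos k₁.2.2
  have d4 := bracket_pos k₂.2.2
  have d5 := bracket_pos (k₁.2.1 + k₂.2.1)
  have d6 := bracket_pos (k₁.2.2 + k₂.2.2)
  calc bracket (modulation α (k₁ + k₂)) ^ (-(q / 2)) * bracket (k₁.2.1 + k₂.2.1) ^ s₁ *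
        bracket (k₁.2.2 + k₂.2.2) ^ s₂ * |k₁.2.1 + k₂.2.1|
      ≤ bracket (modulation α (k₁ + k₂)) ^ (-(q / 2)) *
        (2 ^ s₁ * (bracket k₁.2.1 ^ s₁ * bracket k₂.2.1 ^ s₁)) *
        (2 ^ s₂ * (bracket k₁.2.2 ^ s₂ * bracket k₂.2.2 ^ s₂)) * |k₁.2.1 + k₂.2.1| := by
        gcongr
        · exact bracket_add_rpow_le hs₁ _ _
        · exact bracket_add_rpow_le hs₂ _ _
    _ = bracket (modulation α (k₁ + k₂)) ^ (-(q / 2)) *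
        (2 ^ s₁ * (bracket k₁.2.1 ^ s₁ * bracket k₂.2.1 ^ s₁)) *
        (2 ^ s₂ * (bracket k₁.2.2 ^ s₂ * bracket k₂.2.2 ^ s₂)) * |k₁.2.1 + k₂.2.1| *
        (bracket (modulation α k₁) ^ (-(p / 2)) * bracket (modulation α k₁) ^ (p / 2)) *
        (bracket (modulation α k₂) ^ (-(p / 2)) * bracket (modulation α k₂) ^ (p / 2)) := by
        rw [e1, e2]
        ring
    _ = _ := by ring

lemma exists_bourgainNorm_dxMul_le (α : ℝ) {s₁ s₂ : ℝ} (hs₁ : 0 ≤ s₁) (hs₂ : 0 ≤ s₂) {p q : ℝ}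
    (hp : 1 < p) (hq : 3 / 4 ≤ q) (hpq : q ≤ p) :
    ∃ C : ℝ≥0, ∀ u v : Lp ℂ 2 (volume : Measure SpaceTime),
      bourgainNorm α s₁ s₂ (-(q / 2)) (dxMul u v) ≤
        C * bourgainNorm α s₁ s₂ (p / 2) (Lp.toTemperedDistribution u) *
          bourgainNorm α s₁ s₂ (p / 2) (Lp.toTemperedDistribution v) := by
  obtain ⟨C, hC⟩ := exists_l2_wconv_ker_le α hp hq hpq
  set c := ((2 * Real.pi)⁻¹ ^ 3).toNNReal
  set D := ((2 : ℝ) ^ s₁ * 2 ^ s₂).toNNReal with hD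
  refine ⟨c * (D * C), fun u v => ?_⟩
  have hf := (Lp.stronglyMeasurable (𝓕 u : Lp ℂ 2 (volume : Measure SpaceTime))).measurable
  have hg := (Lp.stronglyMeasurable (𝓕 v : Lp ℂ 2 (volume : Measure SpaceTime))).measurable
  have hι := measurePreserving_toSpaceTime
  have hιm := hι.measurable
  set A : SpaceTime → ℝ≥0∞ := fun k =>
    ‖(𝓕 u : Lp ℂ 2 (volume : Measure SpaceTime)) ((2 * Real.pi)⁻¹ • k)‖ₑ with hA
  set B : SpaceTime → ℝ≥0∞ := fun k =>
    ‖(𝓕 v : Lp ℂ 2 (volume : Measure SpaceTime)) ((2 * Real.pi)⁻¹ • k)‖ₑ with hB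
  have hAm : Measurable A := by fun_prop
  have hBm : Measurable B := by fun_prop
  set a : Freq → ℝ≥0∞ := fun k => weighted α s₁ s₂ (p / 2) u (toSpaceTime k) with ha
  set b : Freq → ℝ≥0∞ := fun k => weighted α s₁ s₂ (p / 2) v (toSpaceTime k) with hb
  have ham : Measurable a := (measurable_weighted α s₁ s₂ (p / 2) u).comp hιm
  have hbm : Measurable b := (measurable_weighted α s₁ s₂ (p / 2) v).comp hιm
  have hs : Measurable fun z : SpaceTime × SpaceTime => z.1 - z.2 :=
    measurable_fst.sub measurable_snd
  have hJ : Measurable fun k => ∫⁻ k', A k' * B (k - k') :=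
    Measurable.lintegral_prod_right' (f := fun z : SpaceTime × SpaceTime => A z.2 * B (z.1 - z.2))
      ((hAm.comp measurable_snd).mul (hBm.comp hs))
  have hpt : ∀ k : Freq, ENNReal.ofReal (weight α s₁ s₂ (-(q / 2)) (toSpaceTime k) *
      |toSpaceTime k 1|) * ∫⁻ k', A k' * B (toSpaceTime k - k') ≤
      D * wconv (ker α p q) a b k := by
    intro k
    have hm : Measurable fun k' => A k' * B (toSpaceTime k - k') := by fun_prop
    rw [← hι.lintegral_comp hm, wconv, ← lintegral_const_mul' _ _ ENNReal.ofReal_ne_top,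
      ← lintegral_const_mul' _ _ ENNReal.coe_ne_top]
    refine lintegral_mono fun k' => ?_
    have h := weight_mul_le_ker α hs₁ hs₂ p q k' (k - k')
    rw [add_sub_cancel] at h
    have e : k'.2.1 + (k - k').2.1 = toSpaceTime k 1 := by
      change k'.2.1 + (k.2.1 - k'.2.1) = k.2.1
      ring
    rw [e] at h
    rw [← toSpaceTime_sub]
    calc _ ≤ ENNReal.ofReal (2 ^ s₁ * 2 ^ s₂) * (ker α p q k' (k - k') *
        ENNReal.ofReal (weight α s₁ s₂ (p / 2) (toSpaceTime k')) *
        ENNReal.ofReal (weight α s₁ s₂ (p / 2) (toSpaceTime (k - k')))) *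
          (A (toSpaceTime k') * B (toSpaceTime (k - k'))) := mul_le_mul_left h _
      _ = _ := by
        simp only [ha, hb, weighted, hA, hB, hD, ENNReal.ofReal]
        ring
  have hl : l2 (fun k : SpaceTime => ENNReal.ofReal (weight α s₁ s₂ (-(q / 2)) k * |k 1|) *
      ∫⁻ k', A k' * B (k - k')) ≤ D * l2 (wconv (ker α p q) a b) := by
    have hΨ : Measurable fun k : SpaceTime => ENNReal.ofReal (weight α s₁ s₂ (-(q / 2)) k * |k 1|) *
      ∫⁻ k', A k' * B (k - k') := by fun_prop
    rw [← l2_comp hι hΨ]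
    rw [← l2_const_mul ENNReal.coe_ne_top]
    unfold l2
    gcongr with k
    exact hpt k
  calc _ ≤ c * (D * l2 (wconv (ker α p q) a b)) :=
        (bourgainNorm_dxMul_le α s₁ s₂ (-(q / 2)) u v).trans (mul_le_mul_right hl _)
    _ ≤ c * (D * (C * l2 a * l2 b)) := by
        gcongr
        exact hC a b ham hbm
    _ ≤ c * (D * (C * bourgainNorm α s₁ s₂ (p / 2) (Lp.toTemperedDistribution u) *
          bourgainNorm α s₁ s₂ (p / 2) (Lp.toTemperedDistribution v))) := by
        gcongr
        · rw [ha, l2_comp hι (measurable_weighted α s₁ s₂ (p / 2) u)]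
          exact l2_weighted_le_bourgainNorm α s₁ s₂ (p / 2) u
        · rw [hb, l2_comp hι (measurable_weighted α s₁ s₂ (p / 2) v)]
          exact l2_weighted_le_bourgainNorm α s₁ s₂ (p / 2) v
    _ = _ := by
        push_cast
        ring

end KPI

end

theorem theorem3p1 :
    ∃ ε₀ : ℝ, 0 < ε₀ ∧
      ∀ (α s₁ s₂ : ℝ), 0 ≤ s₁ → 0 ≤ s₂ →
      ∀ (ε ε' : ℝ), 0 < ε → ε < ε₀ → 0 < ε' → ε' < ε₀ →
      ∃ C : ℝ≥0, ∀ (T : ℝ), 0 < T → T < 1 →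
      ∀ (u v : Lp ℂ 2 (volume : Measure KPI.SpaceTime)),
        KPI.TimeSupported T u → KPI.TimeSupported T v →
        KPI.bourgainNorm α s₁ s₂ (-1 / 2 + ε') (KPI.dxMul u v) ≤
          C * KPI.bourgainNorm α s₁ s₂ (1 / 2 + ε) (Lp.toTemperedDistribution u) *
            KPI.bourgainNorm α s₁ s₂ (1 / 2 + ε) (Lp.toTemperedDistribution v) := by
  -- The value 1/8 makes q = 1 - 2ε' exceed the threshold 3/4 of the non-resonant estimates.
  refine ⟨1 / 8, by norm_num, fun α s₁ s₂ hs₁ hs₂ ε ε' hε hε₀ hε' hε₀' => ?_⟩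
  obtain ⟨C, hC⟩ := KPI.exists_bourgainNorm_dxMul_le α hs₁ hs₂ (p := 1 + 2 * ε) (q := 1 - 2 * ε')
    (by linarith) (by linarith) (by linarith)
  refine ⟨C, fun T _ _ u v _ _ => ?_⟩
  have h := hC u v
  rwa [show -((1 - 2 * ε') / 2) = -1 / 2 + ε' by ring,
    show (1 + 2 * ε) / 2 = 1 / 2 + ε by ring] at h
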